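/- Let $\mathbb{K}$ be a commutative ring. A dg-module is a non-negatively graded chain complex of $\mathbb{K}$-modules (with differential of degree $-1$). A dg-$\Sigma_*$-module $M$ is a sequence of dg-modules $M(r)$, $r\in\mathbb{N}$, with an action of the symmetric group $\Sigma_r$ on $M(r)$ by morphisms of dg-modules (equivalently, a functor $I\mapsto M(I)$ from finite sets and bijections to dg-modules). Quasi-isomorphisms and $\mathbb{K}$-projectivity of dg-$\Sigma_*$-modules are understood arity by arity. The composition product of $M$ and $N$ is $$(M\circ N)(n)=\bigoplus_{r\ge 0}\Bigl(\bigoplus_{J_1\amalg\cdots\amalg J_r=\{1,\dots,n\}}M(r)\otimes N(J_1)\otimes\cdots\otimes N(J_r)\Bigr)_{\Sigma_r}.$$ A dg-operad $P$ is connected if $P(0)=0$ and $P(1)=\mathbb{K}\,1$, a free module on the unit. A quasi-free right $P$-module is a dg right $P$-module $L$ which, as a graded right $P$-module, is a free module $L=M\circ P$ on a dg-$\Sigma_*$-module $M$, and whose differential is $\delta_\theta=\delta+d_\theta$, where $\delta$ is the canonical differential of $M\circ P$, where $d_\theta$ is homogeneous of degree $-1$ with $d_\theta(x(q_1,\dots,q_r))=d_\theta(x)(q_1,\dots,q_r)$,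 and where the composite of $d_\theta$ with the projection $M\circ P\to M$ vanishes. The indecomposable quotient $\bar L=L\circ_P I$ of a right module $L$ over a connected operad $P$ is the quotient of $L$ by the composites $x\circ_i q$ with $x\in L$ and $q\in P(n)$, $n\ge 2$, with the induced differential; for $L$ quasi-free as above it is identified with $M$, so that $L=\bar L\circ P$. **Theorem.** Let $\psi:P\to P'$ be a morphism of connected dg-operads. Let $L$ be a quasi-free right $P$-module, let $L'$ be a quasi-free right $P'$-module, and let $\phi:L\to L'$ be a morphism of right $P$-modules, where $L'$ is regarded as a right $P$-module by restriction of structure along $\psi$. If $\mathbb{K}$ is not a field, assume in addition that $P$, $P'$, $\bar L$ and $\bar L'$ are projective as $\mathbb{K}$-modules. Let $\bar\phi:\bar L\to\bar L'$ be the morphism of dg-$\Sigma_*$-modules induced by $\phi$ on the indecomposable quotients of the right $P$-module $L$ and of the right $P'$-module $L'$. (a) If $\psi$ and $\bar\phi$ are quasi-isomorphisms, then so is $\phi$. (b) If $\psi$ and $\phi$ are quasi-isomorphisms, then so is $\bar\phi$. (c) Assume in addition that $\bar L(0)=\bar L'(0)=0$ and $\bar L(1)=\bar L'(1)=\mathbb{K}$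 (concentrated in degree $0$). If $\phi$ and $\bar\phi$ are quasi-isomorphisms, then so is $\psi$. -/

import Mathlib

open scoped TensorProduct DirectSum

universe u v

noncomputable section

namespace OperadComparison

/-! ## Differential graded modules -/

/-- A dg-module over `K`: an `ℕ`-graded `K`-module `V = ⨁ V_d` with a differential
`δ : V_d → V_{d-1}` (so `δ = 0` on `V_0`) such that `δ² = 0`. -/
structure DGModule (K : Type u) [CommRing K] where
  carrier : Type v
  [addCommGroup : AddCommGroup carrier]
  [module : Module K carrier]
  /-- The homogeneous component of degree `d`. -/
  gr : ℕ → Submodule K carrier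
  isInternal : DirectSum.IsInternal gr
  /-- The differential. -/
  δ : carrier →ₗ[K] carrier
  δ_mem : ∀ (d : ℕ) (x : carrier), x ∈ gr (d + 1) → δ x ∈ gr d
  δ_zero : ∀ x : carrier, x ∈ gr 0 → δ x = 0
  δ_δ : ∀ x : carrier, δ (δ x) = 0

namespace DGModule

variable {K : Type u} [CommRing K]

instance : CoeSort (DGModule.{u, v} K) (Type v) := ⟨DGModule.carrier⟩

instance (V : DGModule.{u, v} K) : AddCommGroup V := V.addCommGroup

instance (V : DGModule.{u, v} K) : Module K V := V.module

/-- A morphism of dg-modules: linear, homogeneous of degree `0`, commuting with differentials. -/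
structure Hom (V W : DGModule.{u, v} K) where
  toFun : V →ₗ[K] W
  map_gr : ∀ (d : ℕ) (x : V), x ∈ V.gr d → toFun x ∈ W.gr d
  map_δ : ∀ x : V, toFun (V.δ x) = W.δ (toFun x)

instance (V W : DGModule.{u, v} K) : CoeFun (Hom V W) (fun _ => V → W) := ⟨fun f => f.toFun⟩

/-- The cycles `ker δ`. -/
def cycles (V : DGModule.{u, v} K) : Submodule K V := LinearMap.ker V.δ

/-- The homology `H_*(V) = ker δ / im δ`. -/
abbrev homology (V : DGModule.{u, v} K) : Type v :=
  V.cycles ⧸ (LinearMap.range V.δ).submoduleOf V.cycles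

/-- The restriction to cycles of a morphism of dg-modules. -/
def Hom.cyclesMap {V W : DGModule.{u, v} K} (f : Hom V W) : V.cycles →ₗ[K] W.cycles :=
  f.toFun.restrict (by
    intro x hx
    have hx' : V.δ x = 0 := hx
    change W.δ (f.toFun x) = 0
    rw [← f.map_δ, hx', map_zero])

/-- The map induced in homology by a morphism of dg-modules. -/
def Hom.homologyMap {V W : DGModule.{u, v} K} (f : Hom V W) : V.homology →ₗ[K] W.homology :=
  Submodule.mapQ _ _ f.cyclesMap (by
    rintro ⟨x, hx⟩ ⟨y, hy⟩
    exact ⟨f.toFun y, by rw [← f.map_δ, hy]; rfl⟩)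

/-- A quasi-isomorphism: a morphism of dg-modules which induces an isomorphism in homology. -/
def Hom.QuasiIso {V W : DGModule.{u, v} K} (f : Hom V W) : Prop :=
  Function.Bijective f.homologyMap

/-- `V ≅ K` as a dg-module, with `K` concentrated in degree `0`. -/
def IsGroundRing (V : DGModule.{u, v} K) : Prop :=
  ∃ u ∈ V.gr 0, Function.Bijective (fun k : K => k • u)

theorem iSup_gr (V : DGModule.{u, v} K) : ⨆ d, V.gr d = ⊤ := V.isInternal.submodule_iSup_eq_top

theorem homogeneous_induction (V : DGModule.{u, v} K) {p : V → Prop} (x : V)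
    (hom : ∀ d, ∀ y ∈ V.gr d, p y) (zero : p 0) (add : ∀ y z, p y → p z → p (y + z)) : p x :=
  Submodule.iSup_induction V.gr (motive := p) (x := x) (by rw [V.iSup_gr]; trivial) hom zero add

/-- The projection of `V` onto its component of degree `d`, as an endomorphism of `V`. -/
def component (V : DGModule.{u, v} K) (d : ℕ) : V →ₗ[K] V :=
  (V.gr d).subtype ∘ₗ DirectSum.component K ℕ (fun d => V.gr d) d ∘ₗ
    (LinearEquiv.ofBijective (DirectSum.coeLinearMap V.gr) V.isInternal).symm.toLinearMap

theorem component_same (V : DGModule.{u, v} K) (d : ℕ) (x : V) (hx : x ∈ V.gr d) :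
    V.component d x = x := by
  exact congrArg Subtype.val (V.isInternal.ofBijective_coeLinearMap_of_mem hx)

theorem component_ne (V : DGModule.{u, v} K) (d e : ℕ) (h : e ≠ d) (x : V) (hx : x ∈ V.gr e) :
    V.component d x = 0 := by
  exact congrArg Subtype.val (V.isInternal.ofBijective_coeLinearMap_of_mem_ne h hx)

/-- The quotient of a dg-module by a submodule which is generated by homogeneous elements and
stable under the differential, with the induced grading and differential. -/
def quotient (V : DGModule.{u, v} K) (S : Set V) (hS : ∀ x ∈ S, ∃ d, x ∈ V.gr d)
    (hδ : ∀ x ∈ S, V.δ x ∈ Submodule.span K S) : DGModule.{u, v} K where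
  carrier := V ⧸ Submodule.span K S
  gr d := (V.gr d).map (Submodule.span K S).mkQ
  isInternal := by
    have hcomp : ∀ d, Submodule.span K S ≤ (Submodule.span K S).comap (V.component d) := by
      intro d
      refine Submodule.span_le.2 fun x hx => ?_
      obtain ⟨e, he⟩ := hS x hx
      change V.component d x ∈ Submodule.span K S
      by_cases h : e = d
      · subst h; rw [V.component_same e x he]; exact Submodule.subset_span hx
      · rw [V.component_ne d e h x he]; exact Submodule.zero_mem _
    refine (DirectSum.isInternal_submodule_iff_iSupIndep_and_iSup_eq_top _).2 ⟨?_, ?_⟩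
    · intro d
      rw [Submodule.disjoint_def]
      rintro _ ⟨x, hx, rfl⟩ h2
      have hker : (⨆ e, ⨆ (_ : e ≠ d), (V.gr e).map (Submodule.span K S).mkQ) ≤
          LinearMap.ker (Submodule.mapQ _ _ (V.component d) (hcomp d)) := by
        refine iSup₂_le fun e he => ?_
        rintro _ ⟨y, hy, rfl⟩
        change Submodule.mapQ _ _ (V.component d) (hcomp d) (Submodule.Quotient.mk y) = 0
        rw [Submodule.mapQ_apply, V.component_ne d e he y hy]; rfl
      have h3 : Submodule.mapQ _ _ (V.component d) (hcomp d) (Submodule.Quotient.mk x) = 0 :=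
        hker h2
      rw [Submodule.mapQ_apply, V.component_same d x hx] at h3
      exact h3
    · rw [← Submodule.map_iSup, V.iSup_gr, Submodule.map_top, Submodule.range_mkQ]
  δ := Submodule.mapQ _ _ V.δ (Submodule.span_le.2 hδ)
  δ_mem := by
    rintro d _ ⟨x, hx, rfl⟩
    exact ⟨V.δ x, V.δ_mem d x hx, rfl⟩
  δ_zero := by
    rintro _ ⟨x, hx, rfl⟩
    change Submodule.mapQ _ _ V.δ _ (Submodule.Quotient.mk x) = 0
    rw [Submodule.mapQ_apply, V.δ_zero x hx]; rfl
  δ_δ := by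
    intro x
    obtain ⟨x, rfl⟩ := Submodule.Quotient.mk_surjective _ x
    rw [Submodule.mapQ_apply, Submodule.mapQ_apply, V.δ_δ]; rfl

/-- The morphism induced on quotients. -/
def quotientMap {V W : DGModule.{u, v} K} (f : Hom V W) {S : Set V} {T : Set W}
    (hS : ∀ x ∈ S, ∃ d, x ∈ V.gr d) (hδS : ∀ x ∈ S, V.δ x ∈ Submodule.span K S)
    (hT : ∀ x ∈ T, ∃ d, x ∈ W.gr d) (hδT : ∀ x ∈ T, W.δ x ∈ Submodule.span K T)
    (hf : ∀ x ∈ S, f x ∈ Submodule.span K T) :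
    Hom (V.quotient S hS hδS) (W.quotient T hT hδT) where
  toFun := Submodule.mapQ (Submodule.span K S) (Submodule.span K T) f.toFun
    (Submodule.span_le.2 hf)
  map_gr := by
    rintro d _ ⟨x, hx, rfl⟩
    exact ⟨f x, f.map_gr d x hx, rfl⟩
  map_δ := by
    intro x
    obtain ⟨x, rfl⟩ := Submodule.Quotient.mk_surjective _ x
    exact congrArg Submodule.Quotient.mk (f.map_δ x)

end DGModule

/-! ## dg-`Σ_*`-modules -/

/-- A dg-`Σ_*`-module, indexed by finite sets: a functor `I ↦ M(I)` from finite sets and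
bijections to dg-modules.  Its arity `r` component is `M(r) = M({1, …, r})`, on which the
symmetric group `Σ_r` acts by `w ↦ map w`; the datum of the representations `M(r)`, `r ∈ ℕ`, is
equivalent to the datum of the functor. -/
structure SigmaModule (K : Type u) [CommRing K] where
  obj : (I : Type) → [Finite I] → DGModule.{u, v} K
  map : ∀ {I J : Type} [Finite I] [Finite J], I ≃ J → (obj I).Hom (obj J)
  map_refl : ∀ {I : Type} [Finite I] (x : obj I), map (Equiv.refl I) x = x
  map_trans : ∀ {I J A : Type} [Finite I] [Finite J] [Finite A] (e : I ≃ J) (e' : J ≃ A)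
    (x : obj I), map (e.trans e') x = map e' (map e x)

namespace SigmaModule

variable {K : Type u} [CommRing K]

/-- A morphism of dg-`Σ_*`-modules. -/
structure Hom (M N : SigmaModule.{u, v} K) where
  app : ∀ (I : Type) [Finite I], (M.obj I).Hom (N.obj I)
  naturality : ∀ {I J : Type} [Finite I] [Finite J] (e : I ≃ J) (x : M.obj I),
    app J (M.map e x) = N.map e (app I x)

/-- A quasi-isomorphism of dg-`Σ_*`-modules: a quasi-isomorphism in every arity. -/
def Hom.QuasiIso {M N : SigmaModule.{u, v} K} (f : Hom M N) : Prop :=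
  ∀ (I : Type) [Finite I], (f.app I).QuasiIso

/-- `M` is projective as a `K`-module, that is, in every arity. -/
def IsKProjective (M : SigmaModule.{u, v} K) : Prop :=
  ∀ (I : Type) [Finite I], Module.Projective K (M.obj I)

/-- `M(0) = 0`. -/
def ZeroInArityZero (M : SigmaModule.{u, v} K) : Prop := Subsingleton (M.obj Empty)

/-- `M(1) = K`, concentrated in degree `0`. -/
def GroundRingInArityOne (M : SigmaModule.{u, v} K) : Prop := (M.obj Unit).IsGroundRing

end SigmaModule

/-! ## Grafting of finite sets -/

/-- The set `(I ∖ {i}) ⊔ J`, in which the element `i` of `I` is replaced by the set `J`. -/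
abbrev Graft {I : Type} (i : I) (J : Type) : Type := {x : I // x ≠ i} ⊕ J

/-- Bijections `I ≃ I'` and `J ≃ J'` induce `(I ∖ {i}) ⊔ J ≃ (I' ∖ {u i}) ⊔ J'`. -/
def graftCongr {I I' J J' : Type} (u : I ≃ I') (v : J ≃ J') (i : I) :
    Graft i J ≃ Graft (u i) J' :=
  Equiv.sumCongr (u.subtypeEquiv fun _ => (u.injective.ne_iff).symm) v

/-- Substituting `J` for `i` and then `A` for `j ∈ J` is substituting for `i` the result of the
substitution of `A` for `j`. -/
def graftAssoc {I J : Type} (i : I) (j : J) (A : Type) :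
    Graft (Sum.inr j : Graft i J) A ≃ Graft i (Graft j A) where
  toFun
    | Sum.inl ⟨Sum.inl x, _⟩ => Sum.inl x
    | Sum.inl ⟨Sum.inr y, h⟩ => Sum.inr (Sum.inl ⟨y, fun e => h (congrArg Sum.inr e)⟩)
    | Sum.inr a => Sum.inr (Sum.inr a)
  invFun
    | Sum.inl x => Sum.inl ⟨Sum.inl x, Sum.inl_ne_inr⟩
    | Sum.inr (Sum.inl y) => Sum.inl ⟨Sum.inr y.1, fun e => y.2 (Sum.inr_injective e)⟩
    | Sum.inr (Sum.inr a) => Sum.inr a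
  left_inv := by rintro (⟨_ | _, _⟩ | _) <;> rfl
  right_inv := by rintro (_ | _ | _) <;> rfl

/-- Substitutions at two different elements commute. -/
def graftComm {I : Type} {i i' : I} (h : i ≠ i') (J J' : Type) :
    Graft (Sum.inl ⟨i', h.symm⟩ : Graft i J) J' ≃ Graft (Sum.inl ⟨i, h⟩ : Graft i' J') J where
  toFun
    | Sum.inl ⟨Sum.inl x, hx⟩ => Sum.inl ⟨Sum.inl ⟨x.1, fun e => hx (congrArg Sum.inl
        (Subtype.ext e))⟩, fun e => x.2 (congrArg Subtype.val (Sum.inl_injective e))⟩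
    | Sum.inl ⟨Sum.inr y, _⟩ => Sum.inr y
    | Sum.inr y => Sum.inl ⟨Sum.inr y, Sum.inr_ne_inl⟩
  invFun
    | Sum.inl ⟨Sum.inl x, hx⟩ => Sum.inl ⟨Sum.inl ⟨x.1, fun e => hx (congrArg Sum.inl
        (Subtype.ext e))⟩, fun e => x.2 (congrArg Subtype.val (Sum.inl_injective e))⟩
    | Sum.inl ⟨Sum.inr y, _⟩ => Sum.inr y
    | Sum.inr y => Sum.inl ⟨Sum.inr y, Sum.inr_ne_inl⟩
  left_inv := by rintro (⟨_ | _, _⟩ | _) <;> rfl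
  right_inv := by rintro (⟨_ | _, _⟩ | _) <;> rfl

/-- Substituting a one-element set for `i` gives back `I`. -/
def graftUnit {I : Type} (i : I) : Graft i Unit ≃ I :=
  Equiv.ofBijective (Sum.elim Subtype.val fun _ => i) (by
    constructor
    · rintro (⟨x, hx⟩ | ⟨⟩) (⟨y, hy⟩ | ⟨⟩) h
      · exact congrArg Sum.inl (Subtype.ext h)
      · exact (hx h).elim
      · exact (hy h.symm).elim
      · rfl
    · intro x
      by_cases h : x = i
      · exact ⟨Sum.inr (), h.symm⟩
      · exact ⟨Sum.inl ⟨x, h⟩, rfl⟩)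

/-- Substituting `J` for the element of a one-element set gives `J`. -/
def unitGraft (J : Type) : Graft () J ≃ J where
  toFun
    | Sum.inl x => (x.2 rfl).elim
    | Sum.inr y => y
  invFun := Sum.inr
  left_inv := by
    rintro (x | y)
    · exact (x.2 rfl).elim
    · rfl
  right_inv _ := rfl

/-! ## dg-operads and right modules -/

/-- A dg-operad: a dg-`Σ_*`-module `P` with a unit `1 ∈ P(1)` and partial composition products
`∘_i : P(I) ⊗ P(J) → P((I ∖ {i}) ⊔ J)`, which are morphisms of dg-modules (homogeneous of degree
`0` and satisfying the derivation relation), natural with respect to bijections, unital and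
associative; the commutation of composites at two different entries involves the Koszul sign. -/
structure DGOperad (K : Type u) [CommRing K] extends SigmaModule.{u, v} K where
  one : obj Unit
  comp : ∀ {I J : Type} [Finite I] [Finite J] (i : I),
    obj I →ₗ[K] obj J →ₗ[K] obj (Graft i J)
  one_mem : one ∈ (obj Unit).gr 0
  comp_mem : ∀ {I J : Type} [Finite I] [Finite J] (i : I) (a b : ℕ) (p : obj I) (q : obj J),
    p ∈ (obj I).gr a → q ∈ (obj J).gr b → comp i p q ∈ (obj (Graft i J)).gr (a + b)
  δ_comp : ∀ {I J : Type} [Finite I] [Finite J] (i : I) (a : ℕ) (p : obj I) (q : obj J),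
    p ∈ (obj I).gr a →
      (obj (Graft i J)).δ (comp i p q) =
        comp i ((obj I).δ p) q + (-1 : K) ^ a • comp i p ((obj J).δ q)
  comp_map : ∀ {I I' J J' : Type} [Finite I] [Finite I'] [Finite J] [Finite J']
    (u : I ≃ I') (v : J ≃ J') (i : I) (p : obj I) (q : obj J),
    comp (u i) (map u p) (map v q) = map (graftCongr u v i) (comp i p q)
  comp_one : ∀ {I : Type} [Finite I] (i : I) (p : obj I),
    map (graftUnit i) (comp i p one) = p
  one_comp : ∀ {J : Type} [Finite J] (q : obj J), map (unitGraft J) (comp () one q) = q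
  comp_assoc : ∀ {I J A : Type} [Finite I] [Finite J] [Finite A] (i : I) (j : J)
    (p : obj I) (q : obj J) (s : obj A),
    map (graftAssoc i j A) (comp (Sum.inr j : Graft i J) (comp i p q) s) =
      comp i p (comp j q s)
  comp_comm : ∀ {I J J' : Type} [Finite I] [Finite J] [Finite J'] {i i' : I} (h : i ≠ i')
    (a b : ℕ) (p : obj I) (q : obj J) (q' : obj J'),
    q ∈ (obj J).gr a → q' ∈ (obj J').gr b →
      map (graftComm h J J') (comp (Sum.inl ⟨i', h.symm⟩ : Graft i J) (comp i p q) q') =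
        (-1 : K) ^ (a * b) • comp (Sum.inl ⟨i, h⟩ : Graft i' J') (comp i' p q') q

namespace DGOperad

variable {K : Type u} [CommRing K]

/-- An operad is connected if `P(0) = 0` and `P(1) = K 1`. -/
structure IsConnected (P : DGOperad.{u, v} K) : Prop where
  zero : P.ZeroInArityZero
  one : Function.Bijective (fun k : K => k • P.one)

/-- A morphism of dg-operads. -/
structure Hom (P P' : DGOperad.{u, v} K) extends
    SigmaModule.Hom P.toSigmaModule P'.toSigmaModule where
  map_one : app Unit P.one = P'.one
  map_comp : ∀ {I J : Type} [Finite I] [Finite J] (i : I) (p : P.obj I) (q : P.obj J),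
    app (Graft i J) (P.comp i p q) = P'.comp i (app I p) (app J q)

end DGOperad

/-- A (dg-)right module over a dg-operad `P`: a dg-`Σ_*`-module `L` with partial composition
products `∘_i : L(I) ⊗ P(J) → L((I ∖ {i}) ⊔ J)`, subject to the same relations as the partial
composition products of an operad. -/
structure RightModule {K : Type u} [CommRing K] (P : DGOperad.{u, v} K) extends
    SigmaModule.{u, v} K where
  comp : ∀ {I J : Type} [Finite I] [Finite J] (i : I),
    obj I →ₗ[K] P.obj J →ₗ[K] obj (Graft i J)
  comp_mem : ∀ {I J : Type} [Finite I] [Finite J] (i : I) (a b : ℕ) (x : obj I) (q : P.obj J),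
    x ∈ (obj I).gr a → q ∈ (P.obj J).gr b → comp i x q ∈ (obj (Graft i J)).gr (a + b)
  δ_comp : ∀ {I J : Type} [Finite I] [Finite J] (i : I) (a : ℕ) (x : obj I) (q : P.obj J),
    x ∈ (obj I).gr a →
      (obj (Graft i J)).δ (comp i x q) =
        comp i ((obj I).δ x) q + (-1 : K) ^ a • comp i x ((P.obj J).δ q)
  comp_map : ∀ {I I' J J' : Type} [Finite I] [Finite I'] [Finite J] [Finite J']
    (u : I ≃ I') (v : J ≃ J') (i : I) (x : obj I) (q : P.obj J),
    comp (u i) (map u x) (P.map v q) = map (graftCongr u v i) (comp i x q)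
  comp_one : ∀ {I : Type} [Finite I] (i : I) (x : obj I),
    map (graftUnit i) (comp i x P.one) = x
  comp_assoc : ∀ {I J A : Type} [Finite I] [Finite J] [Finite A] (i : I) (j : J)
    (x : obj I) (q : P.obj J) (s : P.obj A),
    map (graftAssoc i j A) (comp (Sum.inr j : Graft i J) (comp i x q) s) =
      comp i x (P.comp j q s)
  comp_comm : ∀ {I J J' : Type} [Finite I] [Finite J] [Finite J'] {i i' : I} (h : i ≠ i')
    (a b : ℕ) (x : obj I) (q : P.obj J) (q' : P.obj J'),
    q ∈ (P.obj J).gr a → q' ∈ (P.obj J').gr b →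
      map (graftComm h J J') (comp (Sum.inl ⟨i', h.symm⟩ : Graft i J) (comp i x q) q') =
        (-1 : K) ^ (a * b) • comp (Sum.inl ⟨i, h⟩ : Graft i' J') (comp i' x q') q

/-! ## The composition product of `Σ_*`-modules -/

section CompositionProduct

variable {K : Type u} [CommRing K]

/-- The fibre `J_k = f⁻¹(k)` of a map `f : I → {1, …, r}`.  Such maps correspond to the ordered
decompositions `I = J_1 ⊔ ⋯ ⊔ J_r`. -/
abbrev Block {I : Type} {r : ℕ} (f : I → Fin r) (k : Fin r) : Type := {a : I // f a = k}

/-- The block `J_{w(k)}` of `I = J_1 ⊔ ⋯ ⊔ J_r` is the `k`-th block of the permuted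
decomposition `I = J_{w(1)} ⊔ ⋯ ⊔ J_{w(r)}`. -/
def blockPerm {I : Type} {r : ℕ} (f : I → Fin r) (w : Equiv.Perm (Fin r)) (k : Fin r) :
    Block f (w k) ≃ Block (fun a => w.symm (f a)) k :=
  Equiv.subtypeEquivRight fun _ => (Equiv.symm_apply_eq w).symm

/-- The Koszul sign of `y_1 ⊗ ⋯ ⊗ y_r ↦ y_{w(1)} ⊗ ⋯ ⊗ y_{w(r)}`, where `y_k` has degree `d k`. -/
def koszulSign (K : Type u) [CommRing K] {r : ℕ} (w : Equiv.Perm (Fin r)) (d : Fin r → ℕ) : K :=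
  ∏ k : Fin r, ∏ l : Fin r, if k < l ∧ w l < w k then (-1 : K) ^ (d (w k) * d (w l)) else 1

/-- `⨁_r ⨁_{J_1 ⊔ ⋯ ⊔ J_r = I} M(r) ⊗ N(J_1) ⊗ ⋯ ⊗ N(J_r)`. -/
abbrev PreComposite (M N : SigmaModule.{u, v} K) (I : Type) [Finite I] : Type (max u v) :=
  ⨁ s : (Σ r : ℕ, (I → Fin r)), M.obj (Fin s.1) ⊗[K] (⨂[K] k : Fin s.1, N.obj (Block s.2 k))

/-- The tensor `x ⊗ y_1 ⊗ ⋯ ⊗ y_r` in the summand of `I = J_1 ⊔ ⋯ ⊔ J_r`. -/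
def preCompositeMk (M N : SigmaModule.{u, v} K) {I : Type} [Finite I] {r : ℕ} (f : I → Fin r)
    (x : M.obj (Fin r)) (y : ∀ k, N.obj (Block f k)) : PreComposite M N I := by
  classical
  exact DirectSum.lof K (Σ r : ℕ, (I → Fin r))
    (fun s => M.obj (Fin s.1) ⊗[K] (⨂[K] k : Fin s.1, N.obj (Block s.2 k))) ⟨r, f⟩
    (x ⊗ₜ[K] PiTensorProduct.tprod K y)

/-- The relations `w_* x ⊗ (y_1 ⊗ ⋯ ⊗ y_r) ≡ ± x ⊗ (y_{w(1)} ⊗ ⋯ ⊗ y_{w(r)})` of the modules of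
`Σ_r`-coinvariants. -/
def coinvariantRelations (M N : SigmaModule.{u, v} K) (I : Type) [Finite I] :
    Submodule K (PreComposite M N I) :=
  Submodule.span K {t | ∃ (r : ℕ) (f : I → Fin r) (w : Equiv.Perm (Fin r)) (d : Fin r → ℕ)
    (x : M.obj (Fin r)) (y : ∀ k, N.obj (Block f k)),
    (∀ k, y k ∈ (N.obj (Block f k)).gr (d k)) ∧
    t = preCompositeMk M N f (M.map w x) y -
      koszulSign K w d •
        preCompositeMk M N (fun a => w.symm (f a)) x (fun k => N.map (blockPerm f w k) (y (w k)))}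

/-- The composition product
`(M ∘ N)(I) = ⨁_r {⨁_{J_1 ⊔ ⋯ ⊔ J_r = I} M(r) ⊗ N(J_1) ⊗ ⋯ ⊗ N(J_r)}_{Σ_r}` (as a module). -/
abbrev Composite (M N : SigmaModule.{u, v} K) (I : Type) [Finite I] : Type (max u v) :=
  PreComposite M N I ⧸ coinvariantRelations M N I

/-- The composite element `x(y_1, …, y_r)` of `(M ∘ N)(I)`. -/
def compositeMk (M N : SigmaModule.{u, v} K) {I : Type} [Finite I] {r : ℕ} (f : I → Fin r)
    (x : M.obj (Fin r)) (y : ∀ k, N.obj (Block f k)) : Composite M N I :=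
  Submodule.Quotient.mk (preCompositeMk M N f x y)

end CompositionProduct

/-! ## Composite elements in a right module -/

/-- The set obtained from `{1, …, r}` by substituting the blocks of `f : I → {1, …, r}` for the
first `k` elements. -/
abbrev Stage {I : Type} {r : ℕ} (f : I → Fin r) (k : ℕ) : Type :=
  {a : I // (f a : ℕ) < k} ⊕ {j : Fin r // k ≤ (j : ℕ)}

/-- Nothing has been substituted at the beginning. -/
def stageZero {I : Type} {r : ℕ} (f : I → Fin r) : Fin r ≃ Stage f 0 where
  toFun j := Sum.inr ⟨j, Nat.zero_le _⟩
  invFun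
    | Sum.inl a => (Nat.not_lt_zero _ a.2).elim
    | Sum.inr j => j.1
  left_inv _ := rfl
  right_inv := by
    rintro (a | j)
    · exact (Nat.not_lt_zero _ a.2).elim
    · rfl

/-- The next set is obtained by the substitution of the next block. -/
def stageSucc {I : Type} {r : ℕ} (f : I → Fin r) (k : ℕ) (h : k < r) :
    Graft (Sum.inr ⟨⟨k, h⟩, le_rfl⟩ : Stage f k) (Block f ⟨k, h⟩) ≃ Stage f (k + 1) :=
  Equiv.ofBijective
    (fun s => match s with
      | Sum.inl ⟨Sum.inl a, _⟩ => Sum.inl ⟨a.1, Nat.lt_succ_of_lt a.2⟩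
      | Sum.inl ⟨Sum.inr j, hj⟩ => Sum.inr ⟨j.1, Nat.lt_of_le_of_ne j.2 (fun e => hj
          (congrArg Sum.inr (Subtype.ext (Fin.ext e.symm))))⟩
      | Sum.inr a => Sum.inl ⟨a.1, by rw [a.2]; exact Nat.lt_succ_self k⟩)
    (by
      constructor
      · rintro (⟨⟨a, ha⟩ | ⟨j, hj⟩, h1⟩ | ⟨a, ha⟩) (⟨⟨a', ha'⟩ | ⟨j', hj'⟩, h1'⟩ | ⟨a', ha'⟩) e <;>
          simp at e
        · subst e; rfl
        · subst e; rw [ha'] at ha; exact (lt_irrefl _ ha).elim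
        · subst e; rfl
        · subst e; rw [ha] at ha'; exact (lt_irrefl _ ha').elim
        · subst e; rfl
      · rintro (⟨a, ha⟩ | ⟨j, hj⟩)
        · by_cases hk : (f a : ℕ) = k
          · exact ⟨Sum.inr ⟨a, Fin.ext hk⟩, rfl⟩
          · exact ⟨Sum.inl ⟨Sum.inl ⟨a, by omega⟩, by simp⟩, rfl⟩
        · refine ⟨Sum.inl ⟨Sum.inr ⟨j, by omega⟩, ?_⟩, rfl⟩
          intro e
          have e1 : j = ⟨k, h⟩ := congrArg Subtype.val (Sum.inr_injective e)
          subst e1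
          simp at hj)

/-- Everything has been substituted at the end. -/
def stageEnd {I : Type} {r : ℕ} (f : I → Fin r) : Stage f r ≃ I where
  toFun
    | Sum.inl a => a.1
    | Sum.inr j => (Nat.not_le_of_lt j.1.2 j.2).elim
  invFun a := Sum.inl ⟨a, (f a).2⟩
  left_inv := by
    rintro (a | j)
    · rfl
    · exact (Nat.not_le_of_lt j.1.2 j.2).elim
  right_inv _ := rfl

namespace RightModule

variable {K : Type u} [CommRing K] {P : DGOperad.{u, v} K}

/-- The partially composed element `x(q_1, …, q_k, 1, …, 1)`. -/
def partialComposite (L : RightModule P) {I : Type} [Finite I] {r : ℕ} (f : I → Fin r)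
    (x : L.obj (Fin r)) (q : ∀ k, P.obj (Block f k)) : (k : ℕ) → k ≤ r → L.obj (Stage f k)
  | 0, _ => L.map (stageZero f) x
  | k + 1, h => L.map (stageSucc f k h)
      (L.comp (Sum.inr ⟨⟨k, h⟩, le_rfl⟩ : Stage f k)
        (L.partialComposite f x q k (Nat.le_of_succ_le h)) (q ⟨k, h⟩))

/-- The composite element `x(q_1, …, q_r) ∈ L(I)` of `x ∈ L(r)` with
`q_1 ∈ P(J_1), …, q_r ∈ P(J_r)`, where `I = J_1 ⊔ ⋯ ⊔ J_r`:
it is `(⋯((x ∘_1 q_1) ∘_2 q_2)⋯) ∘_r q_r`. -/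
def composite (L : RightModule P) {I : Type} [Finite I] {r : ℕ} (f : I → Fin r)
    (x : L.obj (Fin r)) (q : ∀ k, P.obj (Block f k)) : L.obj I :=
  L.map (stageEnd f) (L.partialComposite f x q r le_rfl)

/-- A morphism of right `P`-modules. -/
structure Hom (L L' : RightModule P) extends
    SigmaModule.Hom L.toSigmaModule L'.toSigmaModule where
  map_comp : ∀ {I J : Type} [Finite I] [Finite J] (i : I) (x : L.obj I) (q : P.obj J),
    app (Graft i J) (L.comp i x q) = L'.comp i (app I x) q

/-- The restriction of structure of a right `P'`-module along a morphism of operads `P → P'`. -/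
def restrict {P' : DGOperad.{u, v} K} (ψ : P.Hom P') (L' : RightModule P') : RightModule P where
  toSigmaModule := L'.toSigmaModule
  comp {_ J} _ _ i := (L'.comp i).compl₂ (ψ.app J).toFun
  comp_mem i a b x q hx hq := L'.comp_mem i a b x _ hx ((ψ.app _).map_gr b q hq)
  δ_comp i a x q hx := by
    simp only [LinearMap.compl₂_apply, (ψ.app _).map_δ]
    exact L'.δ_comp i a x _ hx
  comp_map u v i x q := by
    simp only [LinearMap.compl₂_apply]
    rw [ψ.naturality v q]
    exact L'.comp_map u v i x _
  comp_one i x := by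
    simp only [LinearMap.compl₂_apply]
    rw [ψ.map_one]
    exact L'.comp_one i x
  comp_assoc i j x q s := by
    simp only [LinearMap.compl₂_apply]
    rw [ψ.map_comp j q s]
    exact L'.comp_assoc i j x _ _
  comp_comm h a b x q q' hq hq' := by
    simp only [LinearMap.compl₂_apply]
    exact L'.comp_comm h a b x _ _ ((ψ.app _).map_gr a q hq) ((ψ.app _).map_gr b q' hq')

/-! ## Indecomposable quotients -/

/-- The decomposable elements `x ∘_i q`, where `q` runs over the augmentation ideal of `P`
(which, as `P` is connected, is `P(J)` if `J` has at least two elements and `0` otherwise).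
The elements `x` and `q` are taken homogeneous, which does not change the generated submodule. -/
def decomposables (L : RightModule P) (A : Type) [Finite A] : Set (L.obj A) :=
  {y | ∃ (I J : Type) (_ : Finite I) (_ : Finite J) (_ : Nontrivial J) (i : I)
    (e : Graft i J ≃ A) (a b : ℕ) (x : L.obj I) (q : P.obj J),
    x ∈ (L.obj I).gr a ∧ q ∈ (P.obj J).gr b ∧ y = L.map e (L.comp i x q)}

/-- All composites `x ∘_i q`, homogeneous or not, lie in the span of the decomposables. -/
theorem comp_mem_span_decomposables (L : RightModule P) {A I J : Type} [Finite A] [Finite I]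
    [Finite J] [Nontrivial J] (i : I) (e : Graft i J ≃ A) (x : L.obj I) (q : P.obj J) :
    L.map e (L.comp i x q) ∈ Submodule.span K (L.decomposables A) := by
  refine (L.obj I).homogeneous_induction
    (p := fun x => (L.map e).toFun (L.comp i x q) ∈ Submodule.span K (L.decomposables A)) x
    (fun a x hx => ?_) ?_ ?_
  · refine (P.obj J).homogeneous_induction
      (p := fun q => (L.map e).toFun (L.comp i x q) ∈ Submodule.span K (L.decomposables A)) q
      (fun b q hq => ?_) ?_ ?_
    · exact Submodule.subset_span ⟨I, J, ‹_›, ‹_›, ‹_›, i, e, a, b, x, q, hx, hq, rfl⟩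
    · simp
    · intro y z hy hz
      rw [map_add, map_add]
      exact Submodule.add_mem _ hy hz
  · simp
  · intro y z hy hz
    rw [map_add, LinearMap.add_apply, map_add]
    exact Submodule.add_mem _ hy hz

theorem decomposables_homogeneous (L : RightModule P) (A : Type) [Finite A] :
    ∀ y ∈ L.decomposables A, ∃ d, y ∈ (L.obj A).gr d := by
  rintro _ ⟨I, J, _, _, _, i, e, a, b, x, q, hx, hq, rfl⟩
  exact ⟨a + b, (L.map e).map_gr _ _ (L.comp_mem i a b x q hx hq)⟩

theorem δ_decomposables (L : RightModule P) (A : Type) [Finite A] :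
    ∀ y ∈ L.decomposables A, (L.obj A).δ y ∈ Submodule.span K (L.decomposables A) := by
  rintro _ ⟨I, J, _, _, _, i, e, a, b, x, q, hx, hq, rfl⟩
  rw [← (L.map e).map_δ, L.δ_comp i a x q hx, map_add, map_smul]
  exact Submodule.add_mem _ (L.comp_mem_span_decomposables i e _ _)
    (Submodule.smul_mem _ _ (L.comp_mem_span_decomposables i e _ _))

theorem map_decomposables (L : RightModule P) {A B : Type} [Finite A] [Finite B] (u : A ≃ B) :
    ∀ y ∈ L.decomposables A, L.map u y ∈ Submodule.span K (L.decomposables B) := by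
  rintro _ ⟨I, J, _, _, _, i, e, a, b, x, q, hx, hq, rfl⟩
  rw [← L.map_trans]
  exact L.comp_mem_span_decomposables i _ _ _

/-- The indecomposable quotient `L̄` of a right module `L` over a connected operad, with its natural
differential: the cokernel of the action of the augmentation ideal. -/
def indecomposables (L : RightModule P) : SigmaModule.{u, v} K where
  obj A _ := (L.obj A).quotient (L.decomposables A) (L.decomposables_homogeneous A)
    (L.δ_decomposables A)
  map u := DGModule.quotientMap (L.map u) _ _ _ _ (L.map_decomposables u)
  map_refl x := by
    obtain ⟨x, rfl⟩ := Submodule.Quotient.mk_surjective _ x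
    exact congrArg Submodule.Quotient.mk (L.map_refl x)
  map_trans e e' x := by
    obtain ⟨x, rfl⟩ := Submodule.Quotient.mk_surjective _ x
    exact congrArg Submodule.Quotient.mk (L.map_trans e e' x)

theorem Hom.app_decomposables {P' : DGOperad.{u, v} K} {ψ : P.Hom P'} {L : RightModule P}
    {L' : RightModule P'} (φ : L.Hom (L'.restrict ψ)) (A : Type) [Finite A] :
    ∀ y ∈ L.decomposables A, φ.app A y ∈ Submodule.span K (L'.decomposables A) := by
  rintro _ ⟨I, J, _, _, _, i, e, a, b, x, q, hx, hq, rfl⟩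
  rw [φ.naturality e, φ.map_comp]
  exact L'.comp_mem_span_decomposables i e _ _

/-- The morphism `φ̄ : L̄ → L̄'` induced by a morphism of right `P`-modules `φ : L → L'`, where `L'` is
a right `P'`-module regarded as a right `P`-module by restriction of structure, and where `L̄'` is
the indecomposable quotient of the right `P'`-module `L'`. -/
def Hom.indecomposables {P' : DGOperad.{u, v} K} {ψ : P.Hom P'} {L : RightModule P}
    {L' : RightModule P'} (φ : L.Hom (L'.restrict ψ)) :
    SigmaModule.Hom L.indecomposables L'.indecomposables where
  app A _ := DGModule.quotientMap (W := L'.obj A) (φ.app A)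
    (L.decomposables_homogeneous A) (L.δ_decomposables A)
    (L'.decomposables_homogeneous A) (L'.δ_decomposables A) (φ.app_decomposables A)
  naturality e x := by
    obtain ⟨x, rfl⟩ := Submodule.Quotient.mk_surjective _ x
    exact congrArg Submodule.Quotient.mk (φ.naturality e x)

/-! ## Quasi-free right modules -/

/-- `L = M ∘ P` is a quasi-free right `P`-module on the dg-`Σ_*`-module `M`: there is a morphism
`ι : M → L` of graded `Σ_*`-modules (not of dg-modules in general) such that
`x(q_1, …, q_r) ↦ ι(x)(q_1, …, q_r)` defines an isomorphism from the composition product `M ∘ P`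
onto `L`.  The differential `δ` of `L` (a derivation with respect to the action of `P`) may differ
from the canonical differential of `M ∘ P` by `d_θ`, determined by `d_θ(x) = δ(ι x) - ι(δ x)` on the
generators `x ∈ M`; the composite `M ∘ P → M ∘ P → M` of `d_θ` with the projection is required to
vanish, so that `M` is identified with the indecomposable quotient of `L`. -/
structure IsQuasiFreeOn (L : RightModule P) (M : SigmaModule.{u, v} K)
    (ι : ∀ (I : Type) [Finite I], M.obj I →ₗ[K] L.obj I) : Prop where
  map_gr : ∀ (I : Type) [Finite I] (d : ℕ) (x : M.obj I),
    x ∈ (M.obj I).gr d → ι I x ∈ (L.obj I).gr d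
  naturality : ∀ {I J : Type} [Finite I] [Finite J] (e : I ≃ J) (x : M.obj I),
    ι J (M.map e x) = L.map e (ι I x)
  free : ∀ (I : Type) [Finite I], ∃ E : Composite M P.toSigmaModule I ≃ₗ[K] L.obj I,
    ∀ (r : ℕ) (f : I → Fin r) (x : M.obj (Fin r)) (q : ∀ k, P.obj (Block f k)),
      E (compositeMk M P.toSigmaModule f x q) = L.composite f (ι (Fin r) x) q
  twist : ∀ (I : Type) [Finite I] (x : M.obj I),
    (L.obj I).δ (ι I x) - ι I ((M.obj I).δ x) ∈ Submodule.span K (L.decomposables I)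

/-- `L` is a quasi-free right `P`-module. -/
def IsQuasiFree (L : RightModule P) : Prop :=
  ∃ (M : SigmaModule.{u, v} K) (ι : ∀ (I : Type) [Finite I], M.obj I →ₗ[K] L.obj I),
    L.IsQuasiFreeOn M ι

end RightModule

end OperadComparison

end

noncomputable section

namespace OperadComparison

/-! ## Relative acyclicity and mapping cones -/

section Acyclic

variable {K : Type*} [CommRing K] {C : Type*} [AddCommGroup C] [Module K C]

/-! The argument is a finite dévissage of the mapping cone of φ. In `L = M ∘ P`, let `F_s` be
spanned by the composites x(q_1, …, q_r) with r < s, where r is the arity of the generator x.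
Composition with elements of `P` only affects the q_k, so it preserves `F_s`. The twist sends a
generator of arity r to decomposables of arity r, which are exactly the elements of `F_r` in that
arity (`decSpan_eq`). Hence on `F_{r+1}/F_r` only the canonical differential of `M ∘ P` survives
(`δ_summand_sub_mem`). In the same way φ becomes the map φ̄ ∘ ψ of composition products on the
graded pieces (`linear_summand_sub_mem`).

Since P(0) = 0, only decompositions into nonempty blocks contribute, and the symmetric group
permutes these freely. The coinvariants therefore disappear: `F_{r+1}/F_r` in arity A is the direct
sum, over the partitions of A into r classes, of M(r) tensored with the values of P on the classes
(`sum_summand_partProj`). In particular r ≤ |A|, so the filtration is finite in each arity.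

On such a summand, φ induces a tensor product of components of φ̄ and ψ. A quasi-isomorphism between
non-negatively graded complexes of projectives is a homotopy equivalence
(`DGModule.Hom.QuasiIso.isHomotopyEquiv`), and homotopy equivalences are stable under tensor
products. This gives `coneAcyclic_blockTensorMap` and, summing over partitions,
`relAcyclic_coneFiltration`. Over a field projectivity is automatic.

For (a), all the steps of the filtration of the cone are acyclic, hence so is the cone. For (b), the
top quotient in arity A is the cone of φ̄(A), and the lower steps involve φ̄ in smaller arities
only: induction on |A| and two out of three conclude. For (c), the bottom stage `F_2` in a nonempty
arity A is a copy of P(A), because the generators of arity one form a free module on a cycle; the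
higher steps involve ψ on proper subsets of A only, and the same induction applies, ending with
`quasiIso_of_relAcyclic`. -/

/-- The subquotient `N₂ / N₁` of `(C, D)` is acyclic. -/
def RelAcyclic (D : C →ₗ[K] C) (N₁ N₂ : Submodule K C) : Prop :=
  ∀ x ∈ N₂, D x ∈ N₁ → ∃ y ∈ N₂, x - D y ∈ N₁

theorem RelAcyclic.refl (D : C →ₗ[K] C) (N : Submodule K C) : RelAcyclic D N N :=
  fun x hx _ => ⟨0, N.zero_mem, by simpa using hx⟩

/-- This lemma and the next two replace the long exact sequence of N₁ ≤ N₂ ≤ N₃. The submodules need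
not be stable under D: the chases only use that D squares to zero. -/
theorem RelAcyclic.trans {D : C →ₗ[K] C} {N₁ N₂ N₃ : Submodule K C} (hD : ∀ x, D (D x) = 0)
    (h₁₂ : N₁ ≤ N₂) (h₂₃ : N₂ ≤ N₃)
    (a : RelAcyclic D N₁ N₂) (b : RelAcyclic D N₂ N₃) : RelAcyclic D N₁ N₃ := by
  intro x hx hDx
  obtain ⟨y, hy, hxy⟩ := b x hx (h₁₂ hDx)
  obtain ⟨z, hz, hz'⟩ := a _ hxy (by simpa [hD] using hDx)
  exact ⟨y + z, N₃.add_mem hy (h₂₃ hz), by rwa [map_add, ← sub_sub]⟩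

theorem RelAcyclic.right {D : C →ₗ[K] C} {N₁ N₂ N₃ : Submodule K C} (hD : ∀ x, D (D x) = 0)
    (h₁₂ : N₁ ≤ N₂) (h₂₃ : N₂ ≤ N₃)
    (a : RelAcyclic D N₁ N₂) (b : RelAcyclic D N₁ N₃) : RelAcyclic D N₂ N₃ := by
  intro x hx hDx
  -- The element D x is a cycle of N₂, hence a boundary D y modulo N₁; subtracting y from x moves
  -- the differential into N₁.
  obtain ⟨y, hy, hxy⟩ := a (D x) hDx (by simp [hD])
  obtain ⟨z, hz, hz'⟩ := b (x - y) (N₃.sub_mem hx (h₂₃ hy)) (by simpa using hxy)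
  refine ⟨z, hz, ?_⟩
  have := N₂.add_mem (h₁₂ hz') hy
  rwa [show x - y - D z + y = x - D z by abel] at this

theorem RelAcyclic.left {D : C →ₗ[K] C} {N₁ N₂ N₃ : Submodule K C} (hD : ∀ x, D (D x) = 0)
    (h₁₂ : N₁ ≤ N₂) (h₂₃ : N₂ ≤ N₃)
    (a : RelAcyclic D N₂ N₃) (b : RelAcyclic D N₁ N₃) : RelAcyclic D N₁ N₂ := by
  intro x hx hDx
  obtain ⟨y, hy, hxy⟩ := b x (h₂₃ hx) hDx
  have hDy : D y ∈ N₂ := by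
    have := N₂.sub_mem hx (h₁₂ hxy)
    rwa [sub_sub_cancel] at this
  -- Subtracting D z from y brings y into N₂ without changing D y.
  obtain ⟨z, hz, hz'⟩ := a y hy hDy
  exact ⟨y - D z, hz', by simpa [hD] using hxy⟩

theorem RelAcyclic.of_steps {D : C →ₗ[K] C} (hD : ∀ x, D (D x) = 0) (F : ℕ → Submodule K C)
    (hF : Monotone F) {m n : ℕ} (hmn : m ≤ n)
    (h : ∀ s, m ≤ s → s < n → RelAcyclic D (F s) (F (s + 1))) : RelAcyclic D (F m) (F n) := by
  induction n, hmn using Nat.le_induction with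
  | base => exact RelAcyclic.refl D _
  | succ n hmn ih =>
    exact RelAcyclic.trans hD (hF hmn) (hF n.le_succ)
      (ih fun s hs hsn => h s hs (hsn.trans n.lt_succ_self)) (h n hmn n.lt_succ_self)

variable {V : Type*} [AddCommGroup V] [Module K V] {W : Type*} [AddCommGroup W] [Module K W]

/-- The differential of the mapping cone of `f : V → W`. -/
def coneDiff (δ : V →ₗ[K] V) (δ' : W →ₗ[K] W) (f : V →ₗ[K] W) : W × V →ₗ[K] W × V :=
  LinearMap.prod (δ' ∘ₗ LinearMap.fst K W V + f ∘ₗ LinearMap.snd K W V)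
    (-(δ ∘ₗ LinearMap.snd K W V))

@[simp]
theorem coneDiff_apply (δ : V →ₗ[K] V) (δ' : W →ₗ[K] W) (f : V →ₗ[K] W) (x : W × V) :
    coneDiff δ δ' f x = (δ' x.1 + f x.2, -δ x.2) := rfl

theorem coneDiff_coneDiff {δ : V →ₗ[K] V} {δ' : W →ₗ[K] W} {f : V →ₗ[K] W}
    (hδ : ∀ x, δ (δ x) = 0) (hδ' : ∀ x, δ' (δ' x) = 0) (hf : ∀ x, f (δ x) = δ' (f x))
    (x : W × V) : coneDiff δ δ' f (coneDiff δ δ' f x) = 0 := by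
  simp [hδ, hδ', hf]

/-- The mapping cone of `f` is acyclic. -/
def ConeAcyclic (δ : V →ₗ[K] V) (δ' : W →ₗ[K] W) (f : V →ₗ[K] W) : Prop :=
  RelAcyclic (coneDiff δ δ' f) ⊥ ⊤

theorem coneAcyclic_iff {δ : V →ₗ[K] V} {δ' : W →ₗ[K] W} {f : V →ₗ[K] W} :
    ConeAcyclic δ δ' f ↔ ∀ w v, δ' w + f v = 0 → δ v = 0 → ∃ y z, δ' y + f z = w ∧ -δ z = v := by
  constructor
  · intro h w v h1 h2
    obtain ⟨y, -, hy⟩ := h (w, v) trivial (by simp [h1, h2])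
    rw [Submodule.mem_bot, sub_eq_zero] at hy
    exact ⟨y.1, y.2, (congrArg Prod.fst hy).symm, (congrArg Prod.snd hy).symm⟩
  · rintro h ⟨w, v⟩ - hx
    rw [Submodule.mem_bot] at hx
    obtain ⟨y, z, h1, h2⟩ := h w v (congrArg Prod.fst hx) (neg_eq_zero.1 (congrArg Prod.snd hx))
    exact ⟨(y, z), trivial, by simp [h1, h2]⟩

/-- Injectivity and surjectivity in homology amount to acyclicity of the mapping cone. -/
theorem coneAcyclic_iff_inj_surj {δ : V →ₗ[K] V} {δ' : W →ₗ[K] W} {f : V →ₗ[K] W}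
    (hf : ∀ x, f (δ x) = δ' (f x)) :
    ConeAcyclic δ δ' f ↔
      (∀ v, δ v = 0 → (∃ w, δ' w = f v) → ∃ u, δ u = v) ∧
      (∀ w, δ' w = 0 → ∃ v, δ v = 0 ∧ ∃ y, δ' y = f v - w) := by
  rw [coneAcyclic_iff]
  constructor
  · intro h
    constructor
    · rintro v hv ⟨w, hw⟩
      obtain ⟨y, z, -, hz⟩ := h (-w) v (by simp [hw]) hv
      exact ⟨-z, by simpa using hz⟩
    · intro w hw
      obtain ⟨y, z, h1, h2⟩ := h w 0 (by simp [hw]) (by simp)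
      exact ⟨z, by simpa using h2, -y, by rw [map_neg, ← h1]; abel⟩
  · rintro ⟨hi, hs⟩ w v h1 h2
    obtain ⟨z, hz⟩ := hi v h2 ⟨-w, by rw [map_neg]; exact (eq_neg_of_add_eq_zero_right h1).symm⟩
    obtain ⟨u, hu, y, hy⟩ := hs (w + f z) (by rw [map_add, ← hf, hz, h1])
    refine ⟨-y, u - z, ?_, by simp [hu, hz]⟩
    rw [map_neg, hy, map_sub]; abel

end Acyclic

/-! ## Homotopy equivalences -/

section Homotopy

variable {K : Type*} [CommRing K] {V : Type*} [AddCommGroup V] [Module K V]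
  {W : Type*} [AddCommGroup W] [Module K W] {X : Type*} [AddCommGroup X] [Module K X]
  {Y : Type*} [AddCommGroup Y] [Module K Y]

/-- `p` is homotopic to the identity of `(V, δ)` by a homotopy which anticommutes with `τ`. -/
def HomotopicToId (δ τ p : Module.End K V) : Prop :=
  ∃ h : Module.End K V, h * τ = -(τ * h) ∧ δ * h + h * δ = 1 - p

/-- `f` is a homotopy equivalence from `(V, δ)` to `(W, δ')`, in a sense that is compatible with
the grading involutions `τ` and `τ'`. -/
def IsHomotopyEquiv (δ τ : Module.End K V) (δ' τ' : Module.End K W) (f : V →ₗ[K] W) : Prop :=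
  f ∘ₗ δ = δ' ∘ₗ f ∧ f ∘ₗ τ = τ' ∘ₗ f ∧ ∃ g : W →ₗ[K] V, g ∘ₗ δ' = δ ∘ₗ g ∧ g ∘ₗ τ' = τ ∘ₗ g ∧
    HomotopicToId δ τ (g ∘ₗ f) ∧ HomotopicToId δ' τ' (f ∘ₗ g)

theorem IsHomotopyEquiv.coneAcyclic {δ τ : Module.End K V} {δ' τ' : Module.End K W}
    {f : V →ₗ[K] W} (h : IsHomotopyEquiv δ τ δ' τ' f) :
    ConeAcyclic δ δ' f := by
  obtain ⟨hf, -, g, hg, -, ⟨a, -, ha⟩, b, -, hb⟩ := h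
  rw [coneAcyclic_iff_inj_surj (fun x => LinearMap.congr_fun hf x)]
  constructor
  · rintro v hv ⟨w, hw⟩
    have h1 := LinearMap.congr_fun ha v
    have h2 := LinearMap.congr_fun hg w
    simp only [LinearMap.add_apply, Module.End.mul_apply, hv, map_zero, add_zero,
      LinearMap.sub_apply, Module.End.one_apply, LinearMap.comp_apply] at h1 h2
    refine ⟨a v + g w, ?_⟩
    rw [map_add, h1, ← h2, hw]; abel
  · intro w hw
    have h1 := LinearMap.congr_fun hb w
    have h2 := LinearMap.congr_fun hg w
    simp only [LinearMap.add_apply, Module.End.mul_apply, hw, map_zero, add_zero,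
      LinearMap.sub_apply, Module.End.one_apply, LinearMap.comp_apply] at h1 h2
    exact ⟨g w, h2.symm, -(b w), by rw [map_neg, h1]; abel⟩

theorem HomotopicToId.conj {δ τ p : Module.End K V} {δ' τ' : Module.End K W}
    (h : HomotopicToId δ τ p) (e : V ≃ₗ[K] W) (hδ : ∀ x, e (δ x) = δ' (e x))
    (hτ : ∀ x, e (τ x) = τ' (e x)) : HomotopicToId δ' τ' (e.conj p) := by
  obtain ⟨a, h1, h2⟩ := h
  have e1 : δ' = e.conj δ := by
    ext x; rw [LinearEquiv.conj_apply_apply, hδ, e.apply_symm_apply]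
  have e2 : τ' = e.conj τ := by
    ext x; rw [LinearEquiv.conj_apply_apply, hτ, e.apply_symm_apply]
  have hc : ∀ b c : Module.End K V, e.conj (b * c) = e.conj b * e.conj c :=
    fun b c => e.conj_comp c b
  refine ⟨e.conj a, ?_, ?_⟩
  · rw [e2, ← hc, ← hc, h1, map_neg]
  · rw [e1, ← hc, ← hc, ← map_add, h2, map_sub]
    congr 1
    exact LinearEquiv.conj_id e

/-- Homotopy equivalences can be transported along isomorphisms. -/
theorem IsHomotopyEquiv.transport {δ τ : Module.End K V} {δ' τ' : Module.End K W}
    {f : V →ₗ[K] W} (h : IsHomotopyEquiv δ τ δ' τ' f)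
    {δX τX : Module.End K X} {δY τY : Module.End K Y} {k : X →ₗ[K] Y} (e : V ≃ₗ[K] X)
    (e' : W ≃ₗ[K] Y) (he : ∀ x, e (δ x) = δX (e x)) (heτ : ∀ x, e (τ x) = τX (e x))
    (he' : ∀ x, e' (δ' x) = δY (e' x)) (heτ' : ∀ x, e' (τ' x) = τY (e' x))
    (hk : ∀ x, k (e x) = e' (f x)) : IsHomotopyEquiv δX τX δY τY k := by
  obtain ⟨hf, hfτ, g, hg, hgτ, a, b⟩ := h
  have hs : ∀ x, e.symm (δX x) = δ (e.symm x) := fun x => by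
    rw [LinearEquiv.symm_apply_eq, he, e.apply_symm_apply]
  have hsτ : ∀ x, e.symm (τX x) = τ (e.symm x) := fun x => by
    rw [LinearEquiv.symm_apply_eq, heτ, e.apply_symm_apply]
  have hs' : ∀ x, e'.symm (δY x) = δ' (e'.symm x) := fun x => by
    rw [LinearEquiv.symm_apply_eq, he', e'.apply_symm_apply]
  have hsτ' : ∀ x, e'.symm (τY x) = τ' (e'.symm x) := fun x => by
    rw [LinearEquiv.symm_apply_eq, heτ', e'.apply_symm_apply]
  have hk' : ∀ x, k x = e' (f (e.symm x)) := fun x => by rw [← hk, e.apply_symm_apply]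
  have hf' := fun x => LinearMap.congr_fun hf x
  have hfτ' := fun x => LinearMap.congr_fun hfτ x
  have hg' := fun x => LinearMap.congr_fun hg x
  have hgτ' := fun x => LinearMap.congr_fun hgτ x
  simp only [LinearMap.comp_apply] at hf' hfτ' hg' hgτ'
  refine ⟨?_, ?_, e.toLinearMap ∘ₗ g ∘ₗ e'.symm.toLinearMap, ?_, ?_, ?_, ?_⟩
  · ext x; simp [hk', hs, hf', he']
  · ext x; simp [hk', hsτ, hfτ', heτ']
  · ext x; simp [hs', hg', he]
  · ext x; simp [hsτ', hgτ', heτ]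
  · convert a.conj e he heτ using 1
    ext x; simp [hk', LinearEquiv.conj_apply]
  · convert b.conj e' he' heτ' using 1
    ext x; simp [hk', LinearEquiv.conj_apply]

/-- The differential of a tensor product. -/
def tensorDiff (δ τ : Module.End K V) (δ' : Module.End K W) : Module.End K (V ⊗[K] W) :=
  TensorProduct.map δ 1 + TensorProduct.map τ δ'

/-- The involution τ carries the Koszul signs, so everything is an identity between endomorphisms
and no homogeneous element has to be chosen. Anticommutation with τ expresses that a homotopy is
odd. -/
theorem HomotopicToId.tensor {δ τ p : Module.End K V} {δ' τ' p' : Module.End K W}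
    (hτ : τ * τ = 1) (hδτ : δ * τ = -(τ * δ)) (hp : p * δ = δ * p) (hpτ : p * τ = τ * p)
    (a : HomotopicToId δ τ p) (a' : HomotopicToId δ' τ' p') :
    HomotopicToId (tensorDiff δ τ δ') (TensorProduct.map τ τ') (TensorProduct.map p p') := by
  obtain ⟨h, h1, h2⟩ := a
  obtain ⟨h', h1', h2'⟩ := a'
  have hneg : ∀ (x : Module.End K V) (y : Module.End K W),
      TensorProduct.map (-x) y = -TensorProduct.map x y := fun x y => by
    ext; simp [TensorProduct.neg_tmul]
  have hneg' : ∀ (x : Module.End K V) (y : Module.End K W),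
      TensorProduct.map x (-y) = -TensorProduct.map x y := fun x y => by
    ext; simp [TensorProduct.tmul_neg]
  -- This is the usual homotopy h ⊗ 1 + p ⊗ h' with its sign put into τ. The mixed terms cancel by
  -- anticommutation, and what remains is (1 - p) ⊗ 1 + p ⊗ (1 - p').
  refine ⟨TensorProduct.map h 1 + TensorProduct.map (p * τ) h', ?_, ?_⟩
  · simp only [add_mul, mul_add, ← TensorProduct.map_mul, one_mul, mul_one, h1, h1', hneg, hneg',
      hpτ, mul_assoc]
    abel
  · have e1 : p * τ * δ = -(δ * (p * τ)) := by
      rw [mul_assoc, ← mul_assoc δ, ← hp, mul_assoc, hδτ, mul_neg, neg_neg]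
    have e2 : τ * (p * τ) = p := by rw [hpτ, ← mul_assoc, hτ, one_mul]
    have e3 : p * τ * τ = p := by rw [mul_assoc, hτ, mul_one]
    simp only [tensorDiff, add_mul, mul_add, ← TensorProduct.map_mul, one_mul, mul_one, e1, e2, e3,
      h1, hneg]
    have e4 : TensorProduct.map (δ * h) (1 : Module.End K W) + TensorProduct.map (h * δ) 1 =
        1 - TensorProduct.map p 1 := by
      rw [← TensorProduct.map_add_left, h2, sub_eq_add_neg, TensorProduct.map_add_left, hneg,
        TensorProduct.map_one, sub_eq_add_neg]
    have e5 : TensorProduct.map p (δ' * h') + TensorProduct.map p (h' * δ') =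
        TensorProduct.map p 1 - TensorProduct.map p p' := by
      rw [← TensorProduct.map_add_right, h2', sub_eq_add_neg, TensorProduct.map_add_right, hneg',
        sub_eq_add_neg]
    rw [← sub_add_sub_cancel 1 (TensorProduct.map p 1), ← e4, ← e5]
    abel

theorem IsHomotopyEquiv.tensor {δ τ : Module.End K V} {δ' τ' : Module.End K W}
    {f : V →ₗ[K] W} {δX τX : Module.End K X} {δY τY : Module.End K Y} {k : X →ₗ[K] Y}
    (hτ : τ * τ = 1) (hδτ : δ * τ = -(τ * δ)) (hτ' : τ' * τ' = 1) (hδτ' : δ' * τ' = -(τ' * δ'))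
    (hf : IsHomotopyEquiv δ τ δ' τ' f) (hk : IsHomotopyEquiv δX τX δY τY k) :
    IsHomotopyEquiv (tensorDiff δ τ δX) (TensorProduct.map τ τX) (tensorDiff δ' τ' δY)
      (TensorProduct.map τ' τY) (TensorProduct.map f k) := by
  obtain ⟨f1, f2, g, g1, g2, a, b⟩ := hf
  obtain ⟨k1, k2, l, l1, l2, c, d⟩ := hk
  refine ⟨?_, ?_, TensorProduct.map g l, ?_, ?_, ?_, ?_⟩
  · rw [tensorDiff, tensorDiff, LinearMap.comp_add, LinearMap.add_comp, ← TensorProduct.map_comp,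
      ← TensorProduct.map_comp, ← TensorProduct.map_comp, ← TensorProduct.map_comp, f1, f2, k1]
    rfl
  · rw [← TensorProduct.map_comp, ← TensorProduct.map_comp, f2, k2]
  · rw [tensorDiff, tensorDiff, LinearMap.comp_add, LinearMap.add_comp, ← TensorProduct.map_comp,
      ← TensorProduct.map_comp, ← TensorProduct.map_comp, ← TensorProduct.map_comp, g1, g2, l1]
    rfl
  · rw [← TensorProduct.map_comp, ← TensorProduct.map_comp, g2, l2]
  · rw [← TensorProduct.map_comp]
    refine HomotopicToId.tensor hτ hδτ ?_ ?_ a c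
    · change (g ∘ₗ f) ∘ₗ δ = δ ∘ₗ (g ∘ₗ f)
      rw [LinearMap.comp_assoc, f1, ← LinearMap.comp_assoc, g1, LinearMap.comp_assoc]
    · change (g ∘ₗ f) ∘ₗ τ = τ ∘ₗ (g ∘ₗ f)
      rw [LinearMap.comp_assoc, f2, ← LinearMap.comp_assoc, g2, LinearMap.comp_assoc]
  · rw [← TensorProduct.map_comp]
    refine HomotopicToId.tensor hτ' hδτ' ?_ ?_ b d
    · change (f ∘ₗ g) ∘ₗ δ' = δ' ∘ₗ (f ∘ₗ g)
      rw [LinearMap.comp_assoc, g1, ← LinearMap.comp_assoc, f1, LinearMap.comp_assoc]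
    · change (f ∘ₗ g) ∘ₗ τ' = τ' ∘ₗ (f ∘ₗ g)
      rw [LinearMap.comp_assoc, g2, ← LinearMap.comp_assoc, f2, LinearMap.comp_assoc]

end Homotopy

/-! ## Homotopies on tensor powers -/

section PiTensor

variable {K : Type*} [CommRing K] {r : ℕ} {V : Fin r → Type*} [∀ i, AddCommGroup (V i)]
  [∀ i, Module K (V i)] {W : Fin r → Type*} [∀ i, AddCommGroup (W i)] [∀ i, Module K (W i)]

/-- The family with value `a i` for `i < k`, `b k` at `k` and `c i` for `i > k`. -/
def slot {r : ℕ} {α : Fin r → Sort*} (k : Fin r) (a b c : ∀ i, α i) : ∀ i, α i :=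
  fun i => if i < k then a i else if i = k then b i else c i

theorem slot_map {r : ℕ} {α β γ : Fin r → Sort*} (F : ∀ i, α i → β i → γ i) (k : Fin r)
    (a b c : ∀ i, α i) (a' b' c' : ∀ i, β i) :
    (fun i => F i (slot k a b c i) (slot k a' b' c' i)) =
      slot k (fun i => F i (a i) (a' i)) (fun i => F i (b i) (b' i))
        (fun i => F i (c i) (c' i)) := by
  funext i; simp only [slot]; split_ifs <;> rfl

/-- This cancels mixed terms: two orders of composition which agree in every factor but one, where
they differ by a sign. -/
theorem piTensorProduct_map_eq_neg (k : Fin r) {f g : ∀ i, V i →ₗ[K] W i}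
    (h : ∀ i, i ≠ k → f i = g i) (hk : f k = -g k) :
    PiTensorProduct.map f = -PiTensorProduct.map g := by
  have e : f = Function.update g k (-g k) := by
    funext i
    by_cases hi : i = k
    · subst hi; simp [hk]
    · simp [hi, h i hi]
  have := (PiTensorProduct.mapMultilinear K V W).map_update_neg g k (g k)
  rw [Function.update_eq_self] at this
  rw [e]
  exact this

/-- The differential of a tensor product of several factors. -/
def piDiff (δ τ : ∀ i, Module.End K (V i)) : Module.End K (⨂[K] i, V i) :=
  ∑ k, PiTensorProduct.map (slot k τ δ 1)

/-- The sum telescopes: the identity is turned into the tensor power of p by changing one factor at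
a time, and `A m` has p in its first m factors. -/
theorem sum_slot_one_sub (p : ∀ i, Module.End K (V i)) :
    ∑ k, PiTensorProduct.map (slot k p (1 - p) 1) = 1 - PiTensorProduct.map p := by
  let A : ℕ → Module.End K (⨂[K] i, V i) :=
    fun m => PiTensorProduct.map (fun i => if (i : ℕ) < m then p i else 1)
  have h1 : ∀ k : Fin r, PiTensorProduct.map (slot k p (1 - p) 1) = A k - A (k + 1) := by
    intro k
    have := (PiTensorProduct.mapMultilinear K V V).map_update_sub
      (fun i => if (i : ℕ) < k then p i else 1) k 1 (p k)
    convert this using 2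
    · change PiTensorProduct.map _ = PiTensorProduct.map _
      congr 1; funext i
      by_cases hi : i = k
      · subst hi; simp [slot]
      · simp [slot, hi]
    · change PiTensorProduct.map _ = PiTensorProduct.map _
      congr 1; funext i
      by_cases hi : i = k
      · subst hi; simp
      · simp [hi]
    · change PiTensorProduct.map _ = PiTensorProduct.map _
      congr 1; funext i
      by_cases hi : i = k
      · subst hi; simp
      · have : (i : ℕ) ≠ k := fun h => hi (Fin.ext h)
        have h2 : (i : ℕ) < k + 1 ↔ (i : ℕ) < k := by omega
        simp [hi, h2]
  rw [Finset.sum_congr rfl fun k _ => h1 k, Fin.sum_univ_eq_sum_range (fun k => A k - A (k + 1)),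
    Finset.sum_range_sub']
  congr 1
  · simp only [A, Nat.not_lt_zero, if_false]
    exact PiTensorProduct.map_one
  · simp [A]

theorem HomotopicToId.piTensor {δ τ p : ∀ i, Module.End K (V i)}
    (hτ : ∀ i, τ i * τ i = 1) (hδτ : ∀ i, δ i * τ i = -(τ i * δ i))
    (hp : ∀ i, p i * δ i = δ i * p i) (hpτ : ∀ i, p i * τ i = τ i * p i)
    (a : ∀ i, HomotopicToId (δ i) (τ i) (p i)) :
    HomotopicToId (piDiff δ τ) (PiTensorProduct.map τ) (PiTensorProduct.map p) := by
  choose h h1 h2 using a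
  have e1 : ∀ i, τ i * (τ i * p i) = p i := fun i => by rw [← mul_assoc, hτ, one_mul]
  have e2 : ∀ i, τ i * p i * τ i = p i := fun i => by rw [mul_assoc, hpτ, e1]
  have e3 : ∀ i, τ i * p i * δ i = -(δ i * (τ i * p i)) := fun i => by
    rw [mul_assoc, hp, ← mul_assoc, ← mul_assoc, hδτ, neg_mul, neg_neg]
  -- Iterating the formula for two factors puts p, twisted by τ, before the factor h and the
  -- identity after it.
  refine ⟨∑ k, PiTensorProduct.map (slot k (τ * p) h 1), ?_, ?_⟩
  · rw [Finset.sum_mul, Finset.mul_sum, ← Finset.sum_neg_distrib]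
    refine Finset.sum_congr rfl fun k _ => ?_
    rw [← PiTensorProduct.map_mul, ← PiTensorProduct.map_mul]
    refine piTensorProduct_map_eq_neg k (fun i hi => ?_) ?_
    · simp only [slot, hi, if_false]
      split_ifs
      · rw [Pi.mul_apply, e2, e1]
      · rw [Pi.one_apply, one_mul, mul_one]
    · simp [slot, h1]
  · rw [piDiff, Finset.sum_mul_sum, Finset.sum_mul_sum, ← sum_slot_one_sub]
    rw [Finset.sum_comm (f := fun i j => PiTensorProduct.map (slot i (τ * p) h 1) *
      PiTensorProduct.map (slot j τ δ 1)), ← Finset.sum_add_distrib]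
    refine Finset.sum_congr rfl fun j _ => ?_
    -- Here j is the position of δ and the inner index is that of h. The diagonal terms give 1 - p
    -- in position j with p before it, as in `sum_slot_one_sub`; the others vanish.
    rw [← Finset.sum_add_distrib, Finset.sum_eq_single j]
    · rw [← PiTensorProduct.map_mul, ← PiTensorProduct.map_mul, slot_map, slot_map]
      have := (PiTensorProduct.mapMultilinear K V V).map_update_add
        (slot j p 0 1) j (δ j * h j) (h j * δ j)
      rw [h2] at this
      have hs : ∀ b : ∀ i, Module.End K (V i),
          Function.update (slot j p 0 1) j (b j) = slot j p b 1 := by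
        intro b; funext i
        by_cases hi : i = j
        · subst hi; simp [slot]
        · simp [slot, hi]
      rw [hs (fun i => δ i * h i), hs (fun i => h i * δ i), hs (fun i => 1 - p i)] at this
      refine Eq.trans ?_ this.symm
      change _ = PiTensorProduct.map _ + PiTensorProduct.map _
      congr 3
      · funext i; exact e1 i
      · funext i; exact e2 i
    · intro k _ hk
      rw [← PiTensorProduct.map_mul, ← PiTensorProduct.map_mul, add_comm]
      -- Off the diagonal the factors commute except at the smaller of the two positions, where h
      -- meets τ or τp meets δ, and these anticommute.
      rcases lt_or_gt_of_ne hk with hk | hk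
      · rw [piTensorProduct_map_eq_neg k (f := fun i => slot k (τ * p) h 1 i * slot j τ δ 1 i)
          (g := fun i => slot j τ δ 1 i * slot k (τ * p) h 1 i), neg_add_cancel]
        · intro i hi
          rcases lt_or_gt_of_ne hi with hi | hi
          · simp [slot, hi, hi.trans hk, e1, e2]
          · simp [slot, hi.not_gt, hi.ne']
        · simp [slot, hk, h1]
      · rw [piTensorProduct_map_eq_neg j (f := fun i => slot k (τ * p) h 1 i * slot j τ δ 1 i)
          (g := fun i => slot j τ δ 1 i * slot k (τ * p) h 1 i), neg_add_cancel]
        · intro i hi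
          rcases lt_or_gt_of_ne hi with hi | hi
          · simp [slot, hi, hi.trans hk, e1, e2]
          · simp [slot, hi.not_gt, hi.ne']
        · simp [slot, hk, e3]
    · simp

theorem piTensorProduct_map_comp_piDiff {δ τ : ∀ i, Module.End K (V i)}
    {δ' τ' : ∀ i, Module.End K (W i)} {f : ∀ i, V i →ₗ[K] W i}
    (h : ∀ i, f i ∘ₗ δ i = δ' i ∘ₗ f i) (hτ : ∀ i, f i ∘ₗ τ i = τ' i ∘ₗ f i) :
    PiTensorProduct.map f ∘ₗ piDiff δ τ = piDiff δ' τ' ∘ₗ PiTensorProduct.map f := by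
  refine LinearMap.ext fun x => ?_
  simp only [piDiff, LinearMap.comp_apply, LinearMap.sum_apply, map_sum]
  refine Finset.sum_congr rfl fun k _ => ?_
  rw [← LinearMap.comp_apply, ← LinearMap.comp_apply, ← PiTensorProduct.map_comp,
    ← PiTensorProduct.map_comp]
  refine LinearMap.congr_fun (congrArg _ (funext fun i => ?_)) x
  simp only [slot]
  split_ifs
  · exact hτ i
  · exact h i
  · rfl

theorem IsHomotopyEquiv.piTensor {δ τ : ∀ i, Module.End K (V i)} {δ' τ' : ∀ i, Module.End K (W i)}
    {f : ∀ i, V i →ₗ[K] W i}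
    (hτ : ∀ i, τ i * τ i = 1) (hδτ : ∀ i, δ i * τ i = -(τ i * δ i))
    (hτ' : ∀ i, τ' i * τ' i = 1) (hδτ' : ∀ i, δ' i * τ' i = -(τ' i * δ' i))
    (hf : ∀ i, IsHomotopyEquiv (δ i) (τ i) (δ' i) (τ' i) (f i)) :
    IsHomotopyEquiv (piDiff δ τ) (PiTensorProduct.map τ) (piDiff δ' τ') (PiTensorProduct.map τ')
      (PiTensorProduct.map f) := by
  choose f1 f2 g g1 g2 a b using hf
  refine ⟨?_, ?_, PiTensorProduct.map g, ?_, ?_, ?_, ?_⟩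
  · exact piTensorProduct_map_comp_piDiff f1 f2
  · rw [← PiTensorProduct.map_comp, ← PiTensorProduct.map_comp]
    exact congrArg _ (funext f2)
  · exact piTensorProduct_map_comp_piDiff g1 g2
  · rw [← PiTensorProduct.map_comp, ← PiTensorProduct.map_comp]
    exact congrArg _ (funext g2)
  · rw [← PiTensorProduct.map_comp]
    refine HomotopicToId.piTensor hτ hδτ (fun i => ?_) (fun i => ?_) a
    · change (g i ∘ₗ f i) ∘ₗ δ i = δ i ∘ₗ (g i ∘ₗ f i)
      rw [LinearMap.comp_assoc, f1, ← LinearMap.comp_assoc, g1, LinearMap.comp_assoc]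
    · change (g i ∘ₗ f i) ∘ₗ τ i = τ i ∘ₗ (g i ∘ₗ f i)
      rw [LinearMap.comp_assoc, f2, ← LinearMap.comp_assoc, g2, LinearMap.comp_assoc]
  · rw [← PiTensorProduct.map_comp]
    refine HomotopicToId.piTensor hτ' hδτ' (fun i => ?_) (fun i => ?_) b
    · change (f i ∘ₗ g i) ∘ₗ δ' i = δ' i ∘ₗ (f i ∘ₗ g i)
      rw [LinearMap.comp_assoc, g1, ← LinearMap.comp_assoc, f1, LinearMap.comp_assoc]
    · change (f i ∘ₗ g i) ∘ₗ τ' i = τ' i ∘ₗ (f i ∘ₗ g i)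
      rw [LinearMap.comp_assoc, g2, ← LinearMap.comp_assoc, f2, LinearMap.comp_assoc]

end PiTensor

/-! ## Gradings -/

namespace DGModule

variable {K : Type u} [CommRing K]

/-- The linear map with prescribed restrictions to the homogeneous components. -/
def lift (V : DGModule.{u, v} K) {X : Type*} [AddCommGroup X] [Module K X]
    (φ : ∀ d, V.gr d →ₗ[K] X) : V →ₗ[K] X :=
  DirectSum.toModule K ℕ X φ ∘ₗ
    (LinearEquiv.ofBijective (DirectSum.coeLinearMap V.gr) V.isInternal).symm.toLinearMap

theorem lift_of_mem (V : DGModule.{u, v} K) {X : Type*} [AddCommGroup X] [Module K X]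
    (φ : ∀ d, V.gr d →ₗ[K] X) {d : ℕ} {x : V} (hx : x ∈ V.gr d) : V.lift φ x = φ d ⟨x, hx⟩ := by
  have : (LinearEquiv.ofBijective (DirectSum.coeLinearMap V.gr) V.isInternal).symm x =
      DirectSum.lof K ℕ (fun d => V.gr d) d ⟨x, hx⟩ := by
    rw [LinearEquiv.symm_apply_eq]
    exact (DirectSum.coeLinearMap_lof V.gr d ⟨x, hx⟩).symm
  change DirectSum.toModule K ℕ X φ
    ((LinearEquiv.ofBijective (DirectSum.coeLinearMap V.gr) V.isInternal).symm x) = _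
  rw [this, DirectSum.toModule_lof]

theorem hom_ext (V : DGModule.{u, v} K) {X : Type*} [AddCommGroup X] [Module K X]
    {f g : V →ₗ[K] X} (h : ∀ d, ∀ x ∈ V.gr d, f x = g x) : f = g :=
  LinearMap.ext fun x => V.homogeneous_induction (p := fun x => f x = g x) x h (by simp)
    fun y z hy hz => by rw [map_add, map_add, hy, hz]

theorem component_mem (V : DGModule.{u, v} K) (d : ℕ) (x : V) : V.component d x ∈ V.gr d :=
  Subtype.property _

theorem Hom.map_component {V W : DGModule.{u, v} K} (f : Hom V W) (d : ℕ) (x : V) :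
    f (V.component d x) = W.component d (f x) := by
  have : f.toFun ∘ₗ V.component d = W.component d ∘ₗ f.toFun := by
    refine V.hom_ext fun e x hx => ?_
    simp only [LinearMap.comp_apply]
    by_cases h : e = d
    · subst h
      rw [V.component_same e x hx, W.component_same e _ (f.map_gr e x hx)]
    · rw [V.component_ne d e h x hx, W.component_ne d e h _ (f.map_gr e x hx), map_zero]
  exact LinearMap.congr_fun this x

/-- The grading involution: multiplication by `(-1) ^ d` in degree `d`. -/
def τ (V : DGModule.{u, v} K) : Module.End K V := V.lift fun d => (-1 : K) ^ d • (V.gr d).subtype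

theorem τ_of_mem (V : DGModule.{u, v} K) {d : ℕ} {x : V} (hx : x ∈ V.gr d) :
    V.τ x = (-1 : K) ^ d • x := by
  rw [τ, lift_of_mem V _ hx]; rfl

theorem τ_mul_τ (V : DGModule.{u, v} K) : V.τ * V.τ = 1 := by
  refine V.hom_ext fun d x hx => ?_
  rw [Module.End.mul_apply, V.τ_of_mem hx, map_smul, V.τ_of_mem hx, smul_smul, ← mul_pow]
  simp

theorem δ_mul_τ (V : DGModule.{u, v} K) : (V.δ : Module.End K V) * V.τ = -(V.τ * V.δ) := by
  refine V.hom_ext fun d x hx => ?_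
  rw [LinearMap.neg_apply, Module.End.mul_apply, Module.End.mul_apply, V.τ_of_mem hx, map_smul]
  cases d with
  | zero => simp [V.δ_zero x hx]
  | succ d =>
    rw [V.τ_of_mem (V.δ_mem d x hx), pow_succ]
    simp

theorem Hom.map_τ {V W : DGModule.{u, v} K} (f : Hom V W) (x : V) : f (V.τ x) = W.τ (f x) := by
  have : f.toFun ∘ₗ V.τ = W.τ ∘ₗ f.toFun := by
    refine V.hom_ext fun d x hx => ?_
    rw [LinearMap.comp_apply, LinearMap.comp_apply, V.τ_of_mem hx, map_smul,
      W.τ_of_mem (f.map_gr d x hx)]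
  exact LinearMap.congr_fun this x

/-- The projection onto the part of even or odd degree. -/
def parity (V : DGModule.{u, v} K) (b : Fin 2) : Module.End K V :=
  V.lift fun d => if d % 2 = b then (V.gr d).subtype else 0

theorem parity_of_mem (V : DGModule.{u, v} K) (b : Fin 2) {d : ℕ} {x : V} (hx : x ∈ V.gr d) :
    V.parity b x = if d % 2 = b then x else 0 := by
  rw [parity, lift_of_mem V _ hx]; split_ifs <;> rfl

/-- Submodules which are separated by projections are the components of a grading. -/
theorem isInternal_of_projections {X : Type*} [AddCommGroup X] [Module K X]
    (A : ℕ → Submodule K X) (p : ℕ → X →ₗ[K] X) (hp : ∀ d, ∀ x ∈ A d, p d x = x)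
    (hp' : ∀ d e, e ≠ d → ∀ x ∈ A e, p d x = 0) (hA : ⨆ d, A d = ⊤) :
    DirectSum.IsInternal A := by
  refine (DirectSum.isInternal_submodule_iff_iSupIndep_and_iSup_eq_top _).2 ⟨fun d => ?_, hA⟩
  rw [Submodule.disjoint_def]
  intro x hx h2
  have hker : (⨆ e, ⨆ (_ : e ≠ d), A e) ≤ LinearMap.ker (p d) :=
    iSup₂_le fun e he x hx => hp' d e he x hx
  rw [← hp d x hx]
  exact hker h2

/-! ### The mapping cone as a dg-module -/

/-- The component of degree `d` of a mapping cone. -/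
def coneGr {V W : DGModule.{u, v} K} : ℕ → Submodule K (W × V)
  | 0 => (W.gr 0).prod ⊥
  | d + 1 => (W.gr (d + 1)).prod (V.gr d)

theorem isInternal_coneGr {V W : DGModule.{u, v} K} :
    DirectSum.IsInternal (coneGr (V := V) (W := W)) := by
  refine isInternal_of_projections _ (fun d => LinearMap.prodMap (W.component d)
    (match d with
      | 0 => 0
      | d + 1 => V.component d)) ?_ ?_ ?_
  · rintro (_ | d) ⟨w, v⟩ ⟨hw, hv⟩
    · exact Prod.ext (W.component_same _ _ hw) (Eq.symm hv)
    · exact Prod.ext (W.component_same _ _ hw) (V.component_same _ _ hv)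
  · rintro (_ | d) (_ | e) hde ⟨w, v⟩ ⟨hw, hv⟩
    · exact (hde rfl).elim
    · exact Prod.ext (W.component_ne _ _ hde _ hw) rfl
    · refine Prod.ext (W.component_ne _ _ hde _ hw) ?_
      change V.component d v = 0
      rw [show v = 0 from hv, map_zero]
    · exact Prod.ext (W.component_ne _ _ hde _ hw)
        (V.component_ne _ _ (fun h => hde (congrArg _ h)) _ hv)
  · rw [eq_top_iff]
    rintro ⟨w, v⟩ -
    have h1 : ∀ w : W, ((w, 0) : W × V) ∈ ⨆ d, coneGr (V := V) (W := W) d := fun w => by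
      refine W.homogeneous_induction (p := fun w => ((w, 0) : W × V) ∈ _) w ?_ ?_ ?_
      · rintro (_ | d) y hy
        · exact Submodule.mem_iSup_of_mem 0 ⟨hy, rfl⟩
        · exact Submodule.mem_iSup_of_mem (d + 1) ⟨hy, Submodule.zero_mem _⟩
      · exact Submodule.zero_mem _
      · intro y z hy hz
        have := Submodule.add_mem _ hy hz
        rwa [Prod.mk_add_mk, add_zero] at this
    have h2 : ∀ v : V, ((0, v) : W × V) ∈ ⨆ d, coneGr (V := V) (W := W) d := fun v => by
      refine V.homogeneous_induction (p := fun v => ((0, v) : W × V) ∈ _) v ?_ ?_ ?_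
      · intro d y hy
        exact Submodule.mem_iSup_of_mem (d + 1) ⟨Submodule.zero_mem _, hy⟩
      · exact Submodule.zero_mem _
      · intro y z hy hz
        have := Submodule.add_mem _ hy hz
        rwa [Prod.mk_add_mk, add_zero] at this
    have := Submodule.add_mem _ (h1 w) (h2 v)
    rwa [Prod.mk_add_mk, add_zero, zero_add] at this

/-- The mapping cone of a morphism of dg-modules. -/
def cone {V W : DGModule.{u, v} K} (f : Hom V W) : DGModule.{u, v} K where
  carrier := W × V
  gr := coneGr
  isInternal := isInternal_coneGr
  δ := coneDiff V.δ W.δ f.toFun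
  δ_mem := by
    rintro (_ | d) ⟨w, v⟩ ⟨hw, hv⟩
    · exact ⟨Submodule.add_mem _ (W.δ_mem _ _ hw) (f.map_gr _ _ hv),
        neg_eq_zero.2 (V.δ_zero _ hv)⟩
    · exact ⟨Submodule.add_mem _ (W.δ_mem _ _ hw) (f.map_gr _ _ hv),
        Submodule.neg_mem _ (V.δ_mem _ _ hv)⟩
  δ_zero := by
    rintro ⟨w, v⟩ ⟨hw, hv⟩
    have hv : v = 0 := hv
    simp [hv, W.δ_zero w hw]
  δ_δ := coneDiff_coneDiff V.δ_δ W.δ_δ f.map_δ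

theorem cone_τ {V W : DGModule.{u, v} K} (f : Hom V W) (x : W × V) :
    (cone f).τ x = (W.τ x.1, -V.τ x.2) := by
  have : (cone f).τ = LinearMap.prodMap W.τ (-V.τ) := by
    refine (cone f).hom_ext ?_
    rintro (_ | d) ⟨w, v⟩ hx
    · rw [(cone f).τ_of_mem hx]
      obtain ⟨hw, hv⟩ := hx
      have hv : v = 0 := hv
      subst hv
      refine Prod.ext (W.τ_of_mem hw).symm ?_
      change (-1 : K) ^ 0 • (0 : V) = -V.τ 0
      simp
    · rw [(cone f).τ_of_mem hx]
      obtain ⟨hw, hv⟩ := hx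
      refine Prod.ext (W.τ_of_mem hw).symm ?_
      change (-1 : K) ^ (d + 1) • v = -V.τ v
      rw [V.τ_of_mem hv, pow_succ]; simp
  exact LinearMap.congr_fun this x

/-! ## Contractions of acyclic complexes of projective modules -/

theorem projective_gr (V : DGModule.{u, v} K) [Module.Projective K V] (d : ℕ) :
    Module.Projective K (V.gr d) :=
  Module.Projective.of_split (V.gr d).subtype
    ((V.component d).codRestrict (V.gr d) (V.component_mem d))
    (LinearMap.ext fun x => Subtype.ext (V.component_same d x x.2))

/-- The cycles of degree `d`. -/
def cyclesGr (V : DGModule.{u, v} K) (d : ℕ) : Submodule K V := V.gr d ⊓ V.cycles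

/-- The differential, as a map onto the cycles. -/
def δGr (V : DGModule.{u, v} K) (d : ℕ) : V.gr (d + 1) →ₗ[K] V.cyclesGr d :=
  (V.δ ∘ₗ (V.gr (d + 1)).subtype).codRestrict (V.cyclesGr d)
    fun x => ⟨V.δ_mem d x x.2, V.δ_δ x⟩

theorem component_δ (V : DGModule.{u, v} K) (d : ℕ) (x : V) :
    V.component d (V.δ x) = V.δ (V.component (d + 1) x) := by
  have : V.component d ∘ₗ V.δ = V.δ ∘ₗ V.component (d + 1) := by
    refine V.hom_ext fun e x hx => ?_
    simp only [LinearMap.comp_apply]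
    rcases e with _ | e
    · rw [V.δ_zero x hx, V.component_ne _ _ (by omega) x hx, map_zero, map_zero]
    · by_cases h : e = d
      · subst h
        rw [V.component_same _ _ (V.δ_mem e x hx), V.component_same _ _ hx]
      · rw [V.component_ne _ _ h _ (V.δ_mem e x hx),
          V.component_ne _ _ (fun h' => h (Nat.succ_injective h')) _ hx, map_zero]
  exact LinearMap.congr_fun this x

/-- By induction on d the cycles Z_d are projective: Z_0 = V_0 because the grading is non-negative,
and if Z_d is projective then δ : V_{d+1} → Z_d splits, so Z_{d+1} is a direct summand of V_{d+1}.
The contraction is the section σ on cycles and zero on the complement given by the splitting. -/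
theorem exists_contraction (V : DGModule.{u, v} K) [Module.Projective K V]
    (hV : ∀ x, V.δ x = 0 → ∃ y, V.δ y = x) :
    ∃ s : Module.End K V, s * V.τ = -(V.τ * s) ∧ V.δ * s + s * V.δ = 1 := by
  have hsurj : ∀ d, Function.Surjective (V.δGr d) := by
    rintro d ⟨x, hx, hx'⟩
    obtain ⟨y, hy⟩ := hV x hx'
    exact ⟨⟨V.component (d + 1) y, V.component_mem _ _⟩, Subtype.ext (by
      change V.δ (V.component (d + 1) y) = x
      rw [← component_δ, hy, V.component_same d x hx])⟩
  have hproj : ∀ d, Module.Projective K (V.cyclesGr d) := by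
    intro d
    induction d with
    | zero =>
      have := V.projective_gr 0
      exact Module.Projective.of_split
        (Submodule.inclusion (inf_le_left : V.cyclesGr 0 ≤ V.gr 0))
        (Submodule.inclusion (fun x hx => ⟨hx, V.δ_zero x hx⟩ : V.gr 0 ≤ V.cyclesGr 0))
        (LinearMap.ext fun x => rfl)
    | succ d ih =>
      have := V.projective_gr (d + 1)
      obtain ⟨σ, hσ⟩ := Module.projective_lifting_property (V.δGr d) LinearMap.id (hsurj d)
      have hσ' : ∀ z, V.δ (σ z) = z := fun z => congrArg Subtype.val (LinearMap.congr_fun hσ z)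
      refine Module.Projective.of_split
        (Submodule.inclusion (inf_le_left : V.cyclesGr (d + 1) ≤ V.gr (d + 1)))
        (((V.gr (d + 1)).subtype ∘ₗ (LinearMap.id - σ ∘ₗ V.δGr d)).codRestrict
          (V.cyclesGr (d + 1)) fun x => ⟨Subtype.property _, ?_⟩) ?_
      · change V.δ (x.1 - (σ (V.δGr d x)).1) = 0
        rw [map_sub, hσ']
        exact sub_self _
      · refine LinearMap.ext fun x => Subtype.ext ?_
        change x.1 - (σ (V.δGr d ⟨x.1, x.2.1⟩)).1 = x.1
        have : V.δGr d ⟨x.1, x.2.1⟩ = 0 := Subtype.ext x.2.2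
        rw [this, map_zero]; simp
  have hex : ∀ d, ∃ σ : V.cyclesGr d →ₗ[K] V.gr (d + 1), V.δGr d ∘ₗ σ = LinearMap.id := fun d =>
    have := hproj d
    Module.projective_lifting_property (V.δGr d) LinearMap.id (hsurj d)
  choose σ hσ using hex
  have hσ' : ∀ d z, V.δ (σ d z) = z := fun d z =>
    congrArg Subtype.val (LinearMap.congr_fun (hσ d) z)
  -- The retraction x ↦ x - σ(δ x) onto the cycles, which is the identity in degree 0.
  let q : ∀ d, V.gr d →ₗ[K] V.cyclesGr d := fun d =>
    match d with
    | 0 => Submodule.inclusion fun x hx => ⟨hx, V.δ_zero x hx⟩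
    | d + 1 => ((V.gr (d + 1)).subtype ∘ₗ (LinearMap.id - σ d ∘ₗ V.δGr d)).codRestrict
          (V.cyclesGr (d + 1)) fun x => ⟨Subtype.property _, by
            change V.δ (x.1 - (σ d (V.δGr d x)).1) = 0
            rw [map_sub, hσ']
            exact sub_self _⟩
  have hq : ∀ d (x : V) (hx : x ∈ V.gr d) (hx' : V.δ x = 0), q d ⟨x, hx⟩ = ⟨x, hx, hx'⟩ := by
    rintro (_ | d) x hx hx'
    · rfl
    · refine Subtype.ext ?_
      change x - (σ d (V.δGr d ⟨x, hx⟩)).1 = x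
      have : V.δGr d ⟨x, hx⟩ = 0 := Subtype.ext hx'
      rw [this, map_zero]; simp
  let s : Module.End K V := V.lift fun d => (V.gr (d + 1)).subtype ∘ₗ σ d ∘ₗ q d
  have hs : ∀ d (x : V) (hx : x ∈ V.gr d), s x = σ d (q d ⟨x, hx⟩) := fun d x hx =>
    V.lift_of_mem _ hx
  have hsd : ∀ d (x : V), x ∈ V.gr d → s x ∈ V.gr (d + 1) := fun d x hx => by
    rw [hs d x hx]; exact Subtype.property _
  refine ⟨s, V.hom_ext fun d x hx => ?_, V.hom_ext fun d x hx => ?_⟩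
  · rw [LinearMap.neg_apply, Module.End.mul_apply, Module.End.mul_apply, V.τ_of_mem hx, map_smul,
      V.τ_of_mem (hsd d x hx), pow_succ]
    simp
  · rw [LinearMap.add_apply, Module.End.mul_apply, Module.End.mul_apply, Module.End.one_apply,
      hs d x hx, hσ']
    rcases d with _ | d
    · rw [V.δ_zero x hx, map_zero, add_zero]; rfl
    · rw [hs d _ (V.δ_mem d x hx), hq d _ _ (V.δ_δ x)]
      exact sub_add_cancel _ _

/-! ### Quasi-isomorphisms, acyclic cones and homotopy equivalences -/

theorem Hom.quasiIso_iff {V W : DGModule.{u, v} K} (f : Hom V W) :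
    f.QuasiIso ↔ ConeAcyclic V.δ W.δ f.toFun := by
  rw [coneAcyclic_iff_inj_surj f.map_δ, Hom.QuasiIso, Function.Bijective]
  refine and_congr ?_ ?_
  · rw [injective_iff_map_eq_zero]
    constructor
    · rintro h v hv ⟨w, hw⟩
      have := h (Submodule.Quotient.mk ⟨v, hv⟩) (by
        refine (Submodule.Quotient.mk_eq_zero _).2 ?_
        exact ⟨w, hw⟩)
      exact (Submodule.Quotient.mk_eq_zero _).1 this
    · intro h x hx
      obtain ⟨⟨v, hv⟩, rfl⟩ := Submodule.Quotient.mk_surjective _ x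
      obtain ⟨w, hw⟩ := (Submodule.Quotient.mk_eq_zero _).1 hx
      exact (Submodule.Quotient.mk_eq_zero _).2 (h v hv ⟨w, hw⟩)
  · constructor
    · intro h w hw
      obtain ⟨x, hx⟩ := h (Submodule.Quotient.mk ⟨w, hw⟩)
      obtain ⟨⟨v, hv⟩, rfl⟩ := Submodule.Quotient.mk_surjective _ x
      obtain ⟨y, hy⟩ := (Submodule.Quotient.eq _).1 hx
      exact ⟨v, hv, y, hy⟩
    · intro h x
      obtain ⟨⟨w, hw⟩, rfl⟩ := Submodule.Quotient.mk_surjective _ x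
      obtain ⟨v, hv, y, hy⟩ := h w hw
      exact ⟨Submodule.Quotient.mk ⟨v, hv⟩, (Submodule.Quotient.eq _).2 ⟨y, hy⟩⟩

/-- A quasi-isomorphism between complexes of projective modules is a homotopy equivalence. -/
theorem Hom.QuasiIso.isHomotopyEquiv {V W : DGModule.{u, v} K} {f : Hom V W} (hf : f.QuasiIso)
    (hV : Module.Projective K V) (hW : Module.Projective K W) :
    IsHomotopyEquiv V.δ V.τ W.δ W.τ f.toFun := by
  rw [f.quasiIso_iff, coneAcyclic_iff] at hf
  have : Module.Projective K (cone f) := inferInstanceAs (Module.Projective K (W × V))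
  obtain ⟨s, hs, hs'⟩ := (cone f).exists_contraction (by
    rintro ⟨w, v⟩ hx
    obtain ⟨y, z, h1, h2⟩ := hf w v (congrArg Prod.fst hx) (neg_eq_zero.1 (congrArg Prod.snd hx))
    exact ⟨(y, z), Prod.ext h1 h2⟩)
  -- The contraction is read as a 2 × 2 matrix. Its entry W → V is the homotopy inverse of f, its
  -- entry W → W is a homotopy for f g, and minus its entry V → V is a homotopy for g f.
  let S : W × V →ₗ[K] W × V := s
  have hS : ∀ w v, S (W.τ w, -V.τ v) = -(W.τ (S (w, v)).1, -V.τ (S (w, v)).2) := fun w v => by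
    have : s ((cone f).τ ((w, v) : W × V)) = -((cone f).τ (s ((w, v) : W × V))) :=
      LinearMap.congr_fun hs ((w, v) : W × V)
    exact (congrArg s (cone_τ f (w, v))).symm.trans (this.trans (congrArg Neg.neg (cone_τ f _)))
  have hS' : ∀ w v, ((W.δ (S (w, v)).1 + f (S (w, v)).2, -V.δ (S (w, v)).2) : W × V) +
      S (W.δ w + f v, -V.δ v) = (w, v) := fun w v => LinearMap.congr_fun hs' ((w, v) : W × V)
  have hl : ∀ v, S (0, -v) = -S (0, v) := fun v => by
    rw [← map_neg]; congr 1; ext <;> simp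
  have hadd : ∀ w v, S (w, v) = S (w, 0) + S (0, v) := fun w v => by
    rw [← map_add]; congr 1; ext <;> simp
  have t1 := fun w => hS w 0
  have t2 := fun v => hS 0 v
  have d1 := fun w => hS' w 0
  have d2 := fun v => hS' 0 v
  simp only [map_zero, neg_zero, add_zero, zero_add, hl, Prod.ext_iff, Prod.fst_add, Prod.snd_add,
    Prod.fst_neg, Prod.snd_neg, neg_neg, neg_inj] at t1 t2 d1 d2
  refine ⟨LinearMap.ext f.map_δ, LinearMap.ext f.map_τ,
    LinearMap.snd K W V ∘ₗ S ∘ₗ LinearMap.inl K W V, ?_, ?_,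
    ⟨-(LinearMap.snd K W V ∘ₗ S ∘ₗ LinearMap.inr K W V), ?_, ?_⟩,
    ⟨LinearMap.fst K W V ∘ₗ S ∘ₗ LinearMap.inl K W V, ?_, ?_⟩⟩
  · ext w
    have := (d1 w).2
    simp only [LinearMap.comp_apply, LinearMap.inl_apply, LinearMap.snd_apply]
    rw [neg_add_eq_zero] at this
    exact this.symm
  · ext w
    exact (t1 w).2
  · ext v
    have := (t2 v).2
    simp only [Module.End.mul_apply, LinearMap.neg_apply, LinearMap.comp_apply,
      LinearMap.inr_apply, LinearMap.snd_apply, map_neg, neg_neg]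
    rw [← neg_eq_iff_eq_neg.2 this]
  · ext v
    have := (d2 v).2
    rw [hadd (f.toFun v), hl] at this
    simp only [Module.End.mul_apply, LinearMap.neg_apply, LinearMap.comp_apply,
      LinearMap.inr_apply, LinearMap.snd_apply, map_neg, LinearMap.add_apply, LinearMap.sub_apply,
      Module.End.one_apply, LinearMap.inl_apply, Prod.snd_add, Prod.snd_neg] at this ⊢
    rw [eq_sub_iff_add_eq]
    refine Eq.trans ?_ this
    abel
  · ext w
    have := (t1 w).1
    exact this
  · ext w
    have := (d1 w).1
    simp only [Module.End.mul_apply, LinearMap.comp_apply,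
      LinearMap.inl_apply, LinearMap.snd_apply, LinearMap.fst_apply, LinearMap.add_apply,
      LinearMap.sub_apply, Module.End.one_apply] at this ⊢
    rw [eq_sub_iff_add_eq]
    refine Eq.trans ?_ this
    abel

end DGModule

/-! ## Koszul signs -/

section Sign

variable (K : Type u) [CommRing K]

/-- The Koszul sign of a bijection `v`. -/
def equivSign {r s : ℕ} (v : Fin s ≃ Fin r) (d : Fin r → ℕ) : K :=
  ∏ k : Fin s, ∏ l : Fin s, if k < l ∧ v l < v k then (-1 : K) ^ (d (v k) * d (v l)) else 1

theorem equivSign_refl {r : ℕ} (d : Fin r → ℕ) : equivSign K (Equiv.refl (Fin r)) d = 1 :=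
  Finset.prod_eq_one fun _ _ => Finset.prod_eq_one fun _ _ => if_neg fun h => lt_asymm h.1 h.2

/-- The sign depends on parities only, hence takes constant values on finitely many patterns. This
is what makes the signed permutation a linear map on the whole tensor product. -/
theorem equivSign_mod_two {r s : ℕ} (v : Fin s ≃ Fin r) (d : Fin r → ℕ) :
    equivSign K v (fun k => d k % 2) = equivSign K v d := by
  refine Finset.prod_congr rfl fun k _ => Finset.prod_congr rfl fun l _ => ?_
  split_ifs
  · rw [neg_one_pow_eq_pow_mod_two, ← Nat.mul_mod, ← neg_one_pow_eq_pow_mod_two]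
  · rfl

theorem prod_prod_eq_prod_prod_lt {r : ℕ} (F : Fin r → Fin r → K) (hF : ∀ k, F k k = 1) :
    ∏ k, ∏ l, F k l = ∏ k, ∏ l, if k < l then F k l * F l k else 1 := by
  have h : ∀ k l, F k l = (if k < l then F k l else 1) * (if l < k then F k l else 1) := by
    intro k l
    rcases lt_trichotomy k l with h | h | h
    · simp [h, h.not_gt]
    · simp [h, hF]
    · simp [h, h.not_gt]
  have h' : ∀ k l, (if k < l then F k l * F l k else 1) =
      (if k < l then F k l else 1) * (if k < l then F l k else 1) := by
    intro k l; split_ifs <;> simp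
  simp only [h']
  conv_lhs => enter [2, k, 2, l]; rw [h]
  simp only [Finset.prod_mul_distrib]
  congr 1
  exact Finset.prod_comm

/-- A pair is inverted by the composite exactly when it is inverted by one and only one of v and w;
if both invert it, its sign appears twice and cancels. -/
theorem equivSign_trans {r s t : ℕ} (v : Fin t ≃ Fin s) (w : Fin s ≃ Fin r) (d : Fin r → ℕ) :
    equivSign K (v.trans w) d = equivSign K w d * equivSign K v (d ∘ w) := by
  have e : equivSign K w d = ∏ k : Fin t, ∏ l : Fin t,
      if v k < v l ∧ w (v l) < w (v k) then (-1 : K) ^ (d (w (v k)) * d (w (v l))) else 1 := by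
    rw [equivSign, ← v.prod_comp]
    exact Finset.prod_congr rfl fun k _ => (v.prod_comp _).symm
  -- After reindexing along v, the inversions of w may occur as (k, l) with k > l. Gathering both
  -- orders allows a comparison pair by pair.
  rw [e, prod_prod_eq_prod_prod_lt K _ fun k => if_neg fun h => lt_irrefl _ h.1]
  simp only [equivSign, ← Finset.prod_mul_distrib]
  refine Finset.prod_congr rfl fun k _ => Finset.prod_congr rfl fun l _ => ?_
  by_cases hkl : k < l
  · simp only [hkl, true_and, if_true, Function.comp_apply, Equiv.trans_apply]
    rw [mul_comm (d (w (v l)))]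
    have hne : v k ≠ v l := v.injective.ne hkl.ne
    have hne' : w (v k) ≠ w (v l) := w.injective.ne hne
    have hsq : (-1 : K) ^ (d (w (v k)) * d (w (v l))) * (-1) ^ (d (w (v k)) * d (w (v l))) = 1 := by
      rw [← mul_pow]; simp
    rcases lt_or_gt_of_ne hne with h1 | h1 <;> rcases lt_or_gt_of_ne hne' with h2 | h2 <;>
      simp [h1, h2, h1.not_gt, h2.not_gt, hsq]
  · simp [hkl]

end Sign

/-! ## The summands of the composition product -/

section Multilinear

variable {K : Type u} [CommRing K]

theorem multilinearMap_ext_homogeneous {ι : Type*} [Finite ι] {V : ι → DGModule.{u, v} K}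
    {X : Type*} [AddCommGroup X] [Module K X] {f g : MultilinearMap K (fun i => V i) X}
    (h : ∀ (d : ι → ℕ) (y : ∀ i, V i), (∀ i, y i ∈ (V i).gr (d i)) → f y = g y) : f = g := by
  classical
  have := Fintype.ofFinite ι
  -- The set S contains the coordinates that are allowed to be inhomogeneous; they are decomposed
  -- one at a time.
  have key : ∀ (S : Finset ι) (y : ∀ i, V i), (∀ i ∉ S, ∃ d, y i ∈ (V i).gr d) → f y = g y := by
    intro S
    induction S using Finset.induction with
    | empty =>
      intro y hy
      choose d hd using fun i => hy i (Finset.notMem_empty i)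
      exact h d y hd
    | insert k S hk ih =>
      intro y hy
      have := (V k).homogeneous_induction
        (p := fun z => f (Function.update y k z) = g (Function.update y k z)) (y k) ?_ ?_ ?_
      · simpa using this
      · intro d z hz
        refine ih _ fun i hi => ?_
        by_cases hik : i = k
        · subst hik; exact ⟨d, by simpa using hz⟩
        · simpa [hik] using hy i (by simp [hik, hi])
      · rw [f.map_update_zero, g.map_update_zero]
      · intro a b ha hb
        rw [f.map_update_add, g.map_update_add, ha, hb]
  exact MultilinearMap.ext fun y => key Finset.univ y fun i hi => (hi (Finset.mem_univ i)).elim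

end Multilinear

section Summand

variable {K : Type u} [CommRing K] (M N : SigmaModule.{u, v} K)

/-- The summand `M(r) ⊗ N(J_1) ⊗ ⋯ ⊗ N(J_r)` of the composition product. -/
abbrev BlockTensor {I : Type} [Finite I] {r : ℕ} (f : I → Fin r) : Type (max u v) :=
  M.obj (Fin r) ⊗[K] (⨂[K] k : Fin r, N.obj (Block f k))

variable {M N} in
theorem blockTensor_ext {I : Type} [Finite I] {r : ℕ} {f : I → Fin r} {X : Type*} [AddCommGroup X]
    [Module K X] {α β : BlockTensor M N f →ₗ[K] X}
    (h : ∀ (x : M.obj (Fin r)) (d : Fin r → ℕ) (y : ∀ k, N.obj (Block f k)),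
      (∀ k, y k ∈ (N.obj (Block f k)).gr (d k)) →
      α (x ⊗ₜ PiTensorProduct.tprod K y) = β (x ⊗ₜ PiTensorProduct.tprod K y)) : α = β := by
  refine TensorProduct.ext (LinearMap.ext fun x => PiTensorProduct.ext ?_)
  exact multilinearMap_ext_homogeneous (V := fun k => N.obj (Block f k)) fun d y hy => h x d y hy

/-- The canonical map from a summand to the composition product. -/
def toComposite {I : Type} [Finite I] {r : ℕ} (f : I → Fin r) :
    BlockTensor M N f →ₗ[K] Composite M N I := by
  classical
  exact (coinvariantRelations M N I).mkQ ∘ₗ DirectSum.lof K (Σ r : ℕ, (I → Fin r))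
    (fun s => M.obj (Fin s.1) ⊗[K] (⨂[K] k : Fin s.1, N.obj (Block s.2 k))) ⟨r, f⟩

theorem toComposite_tmul {I : Type} [Finite I] {r : ℕ} (f : I → Fin r)
    (x : M.obj (Fin r)) (y : ∀ k, N.obj (Block f k)) :
    toComposite M N f (x ⊗ₜ PiTensorProduct.tprod K y) = compositeMk M N f x y := rfl

/-- The comparison of the blocks of `f = v ∘ g` with the blocks of `g`. -/
def blockEquiv {I : Type} {r s : ℕ} {f : I → Fin r} {g : I → Fin s} (v : Fin s ≃ Fin r)
    (h : ∀ a, f a = v (g a)) (k : Fin s) : Block f (v k) ≃ Block g k :=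
  Equiv.subtypeEquivRight fun a => by rw [h]; exact v.injective.eq_iff

/-- The signed permutation of the factors `N(J_k)`. -/
def permuteFactors {I : Type} [Finite I] {r s : ℕ} {f : I → Fin r} {g : I → Fin s}
    (v : Fin s ≃ Fin r) (h : ∀ a, f a = v (g a)) :
    (⨂[K] k, N.obj (Block f k)) →ₗ[K] ⨂[K] k, N.obj (Block g k) :=
  PiTensorProduct.map (s := fun k => N.obj (Block f (v k)))
      (fun k => (N.map (blockEquiv v h k)).toFun) ∘ₗ
    (PiTensorProduct.reindex K (fun k => N.obj (Block f k)) v.symm).toLinearMap ∘ₗ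
    -- The tensor product is split according to the parities of its factors; on each part the sign
    -- is a constant.
    ∑ p : Fin r → Fin 2, equivSign K v (fun k => p k) •
      PiTensorProduct.map fun k => (N.obj (Block f k)).parity (p k)

theorem permuteFactors_tprod {I : Type} [Finite I] {r s : ℕ} {f : I → Fin r} {g : I → Fin s}
    (v : Fin s ≃ Fin r) (h : ∀ a, f a = v (g a)) (d : Fin r → ℕ) (y : ∀ k, N.obj (Block f k))
    (hy : ∀ k, y k ∈ (N.obj (Block f k)).gr (d k)) :
    permuteFactors N v h (PiTensorProduct.tprod K y) = equivSign K v d •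
      PiTensorProduct.tprod K fun k => N.map (blockEquiv v h k) (y (v k)) := by
  have h1 : (∑ p : Fin r → Fin 2, equivSign K v (fun k => p k) •
      PiTensorProduct.map fun k => (N.obj (Block f k)).parity (p k)) (PiTensorProduct.tprod K y) =
      equivSign K v d • PiTensorProduct.tprod K y := by
    rw [LinearMap.sum_apply, Finset.sum_eq_single fun k => ⟨d k % 2, Nat.mod_lt _ two_pos⟩]
    · rw [LinearMap.smul_apply, PiTensorProduct.map_tprod, equivSign_mod_two K v d]
      congr 2
      funext k
      rw [DGModule.parity_of_mem _ _ (hy k), if_pos rfl]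
    · intro p _ hp
      obtain ⟨k, hk⟩ := Function.ne_iff.1 hp
      rw [LinearMap.smul_apply, PiTensorProduct.map_tprod,
        MultilinearMap.map_coord_zero _ k, smul_zero]
      rw [DGModule.parity_of_mem _ _ (hy k), if_neg]
      exact fun e => hk (Fin.ext e.symm)
    · simp
  rw [permuteFactors, LinearMap.comp_apply, LinearMap.comp_apply, h1, map_smul, map_smul]
  congr 1
  rw [LinearEquiv.coe_coe, PiTensorProduct.reindex_tprod]
  exact PiTensorProduct.map_tprod _ _

/-- The signed permutation of the factors of a summand of the composition product. -/
def permuteSummand {I : Type} [Finite I] {r s : ℕ} {f : I → Fin r} {g : I → Fin s}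
    (v : Fin s ≃ Fin r) (h : ∀ a, f a = v (g a)) :
    BlockTensor M N f →ₗ[K] BlockTensor M N g :=
  TensorProduct.map (M.map v.symm).toFun (permuteFactors N v h)

theorem permuteSummand_tmul {I : Type} [Finite I] {r s : ℕ} {f : I → Fin r} {g : I → Fin s}
    (v : Fin s ≃ Fin r) (h : ∀ a, f a = v (g a)) (d : Fin r → ℕ) (x : M.obj (Fin r))
    (y : ∀ k, N.obj (Block f k)) (hy : ∀ k, y k ∈ (N.obj (Block f k)).gr (d k)) :
    permuteSummand M N v h (x ⊗ₜ PiTensorProduct.tprod K y) = equivSign K v d •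
      (M.map v.symm x ⊗ₜ PiTensorProduct.tprod K fun k =>
        N.map (blockEquiv v h k) (y (v k))) := by
  rw [permuteSummand, TensorProduct.map_tmul, permuteFactors_tprod N v h d y hy,
    TensorProduct.tmul_smul]

theorem permuteSummand_refl {I : Type} [Finite I] {r : ℕ} {f : I → Fin r}
    (t : BlockTensor M N f) :
    permuteSummand M N (Equiv.refl (Fin r)) (fun _ => rfl) t = t := by
  have : permuteSummand M N (Equiv.refl (Fin r)) (fun _ => rfl) =
      (LinearMap.id : BlockTensor M N f →ₗ[K] BlockTensor M N f) := by
    refine blockTensor_ext fun x d y hy => ?_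
    rw [permuteSummand_tmul M N _ _ d x y hy, equivSign_refl, one_smul]
    change M.map (Equiv.refl _) x ⊗ₜ _ = _
    rw [M.map_refl]
    congr 2
    funext k
    exact N.map_refl (y k)
  rw [this]; rfl

theorem map_apply_congr {I B : Type} [Finite I] [Finite B] {r : ℕ} {f : I → Fin r}
    (y : ∀ k, N.obj (Block f k)) {k k' : Fin r} (hk : k = k') (e : Block f k ≃ B)
    (e' : Block f k' ≃ B) (he : ∀ a ha ha', e ⟨a, ha⟩ = e' ⟨a, ha'⟩) :
    N.map e (y k) = N.map e' (y k') := by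
  subst hk
  exact congrArg (fun e => N.map e (y k)) (Equiv.ext fun a => he a.1 a.2 a.2)

/-- In the composition product, the summands of `f` and `g` with `f = v ∘ g` are identified. -/
theorem toComposite_permuteSummand {I : Type} [Finite I] {r s : ℕ} {f : I → Fin r} {g : I → Fin s}
    (v : Fin s ≃ Fin r) (h : ∀ a, f a = v (g a)) (t : BlockTensor M N f) :
    toComposite M N g (permuteSummand M N v h t) = toComposite M N f t := by
  obtain rfl : s = r := by simpa using Fintype.card_congr v
  have hg : g = fun a => v.symm (f a) := funext fun a => by rw [h, v.symm_apply_apply]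
  subst hg
  have : toComposite M N _ ∘ₗ permuteSummand M N v h = toComposite M N f := by
    refine blockTensor_ext fun x d y hy => ?_
    rw [LinearMap.comp_apply, permuteSummand_tmul M N v h d x y hy, map_smul, toComposite_tmul,
      toComposite_tmul]
    have hx : M.map v (M.map v.symm x) = x := by
      rw [← M.map_trans, Equiv.symm_trans_self, M.map_refl]
    have := (Submodule.Quotient.eq (coinvariantRelations M N I)).2
      (Submodule.subset_span ⟨s, f, v, d, M.map v.symm x, y, hy, rfl⟩)
    rw [hx] at this
    exact this.symm
  exact LinearMap.congr_fun this t

open Classical in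
/-- The projection of the direct sum onto the coinvariants of the summands of the orbit of `g`. -/
def preProjection {I : Type} [Finite I] {s : ℕ} (g : I → Fin s) :
    PreComposite M N I →ₗ[K] BlockTensor M N g :=
  DirectSum.toModule K (Σ r : ℕ, (I → Fin r)) _ fun f =>
    if h : ∃ v : Fin s ≃ Fin f.1, ∀ a, f.2 a = v (g a)
    then permuteSummand M N h.choose h.choose_spec else 0

/-- A surjection g determines v by f = v ∘ g, so the choice made in `preProjection` is harmless.
Equivalently, the symmetric group acts freely on surjections. -/
theorem preProjection_mk {I : Type} [Finite I] {r s : ℕ} {f : I → Fin r} {g : I → Fin s}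
    (hg : Function.Surjective g) (v : Fin s ≃ Fin r) (h : ∀ a, f a = v (g a)) (d : Fin r → ℕ)
    (x : M.obj (Fin r)) (y : ∀ k, N.obj (Block f k))
    (hy : ∀ k, y k ∈ (N.obj (Block f k)).gr (d k)) :
    preProjection M N g (preCompositeMk M N f x y) = equivSign K v d •
      (M.map v.symm x ⊗ₜ PiTensorProduct.tprod K fun k =>
        N.map (blockEquiv v h k) (y (v k))) := by
  classical
  have hex : ∃ v : Fin s ≃ Fin r, ∀ a, f a = v (g a) := ⟨v, h⟩
  have hv : hex.choose = v := Equiv.ext fun k => by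
    obtain ⟨a, rfl⟩ := hg k
    rw [← h, ← hex.choose_spec]
  have key : ∀ {w : Fin s ≃ Fin r} (_ : w = v) (hw : ∀ a, f a = w (g a)) (t : BlockTensor M N f),
      permuteSummand M N w hw t = permuteSummand M N v h t := by
    rintro _ rfl _ _; rfl
  rw [← permuteSummand_tmul M N v h d x y hy, preProjection, preCompositeMk]
  refine (DirectSum.toModule_lof K _ _).trans ?_
  rw [dif_pos hex]
  exact key hv _ _

theorem preProjection_mk_of_not {I : Type} [Finite I] {r s : ℕ} {f : I → Fin r} {g : I → Fin s}
    (h : ¬ ∃ v : Fin s ≃ Fin r, ∀ a, f a = v (g a))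
    (x : M.obj (Fin r)) (y : ∀ k, N.obj (Block f k)) :
    preProjection M N g (preCompositeMk M N f x y) = 0 := by
  classical
  rw [preProjection, preCompositeMk]
  refine (DirectSum.toModule_lof K _ _).trans ?_
  rw [dif_neg h]; rfl

/-- The projection of the composition product onto the summand of a surjection `g`. -/
def projection {I : Type} [Finite I] {s : ℕ} (g : I → Fin s) (hg : Function.Surjective g) :
    Composite M N I →ₗ[K] BlockTensor M N g :=
  (coinvariantRelations M N I).liftQ (preProjection M N g) (by
    refine Submodule.span_le.2 ?_
    rintro _ ⟨r, f, w, d, x, y, hy, rfl⟩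
    refine LinearMap.mem_ker.2 ?_
    rw [map_sub, map_smul, sub_eq_zero]
    by_cases h : ∃ v : Fin s ≃ Fin r, ∀ a, f a = v (g a)
    · obtain ⟨v, hv⟩ := h
      rw [preProjection_mk M N hg v hv d _ y hy,
        preProjection_mk M N hg (v.trans w.symm) (fun a => by simp [hv]) (d ∘ w) x _
          (fun k => (N.map (blockPerm f w k)).map_gr _ _ (hy (w k))), smul_smul]
      -- The sign in the coinvariance relation is exactly the discrepancy between the signs of the
      -- two bijections, by the cocycle identity.
      have hs : equivSign K v d = koszulSign K w d * equivSign K (v.trans w.symm) (d ∘ w) := by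
        have := equivSign_trans K (v.trans w.symm) w d
        rwa [Equiv.trans_assoc, Equiv.symm_trans_self, Equiv.trans_refl] at this
      rw [hs, ← M.map_trans]
      congr 3
      funext k
      rw [← N.map_trans]
      exact map_apply_congr N y (by simp) _ _ fun a _ _ => rfl
    · rw [preProjection_mk_of_not M N h, preProjection_mk_of_not M N, smul_zero]
      rintro ⟨v, hv⟩
      exact h ⟨v.trans w, fun a => by rw [Equiv.trans_apply, ← hv, w.apply_symm_apply]⟩)

/-- No coinvariants are lost on the summand of a surjection: it embeds in the composition product
with this retraction. -/
theorem projection_toComposite {I : Type} [Finite I] {r : ℕ} (g : I → Fin r)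
    (hg : Function.Surjective g) (t : BlockTensor M N g) :
    projection M N g hg (toComposite M N g t) = t := by
  have : projection M N g hg ∘ₗ toComposite M N g = LinearMap.id := by
    refine blockTensor_ext fun x d y hy => ?_
    rw [LinearMap.comp_apply, toComposite_tmul]
    refine (preProjection_mk M N hg (Equiv.refl _) (fun _ => rfl) d x y hy).trans ?_
    exact (permuteSummand_tmul M N (Equiv.refl _) (fun _ => rfl) d x y hy).symm.trans
      (permuteSummand_refl M N _)
  exact LinearMap.congr_fun this t

theorem projection_toComposite_of_not {I : Type} [Finite I] {r s : ℕ} {f : I → Fin r}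
    {g : I → Fin s} (hg : Function.Surjective g)
    (h : ¬ ∃ v : Fin s ≃ Fin r, ∀ a, f a = v (g a)) (t : BlockTensor M N f) :
    projection M N g hg (toComposite M N f t) = 0 := by
  have : projection M N g hg ∘ₗ toComposite M N f = 0 := by
    refine blockTensor_ext fun x d y hy => ?_
    exact preProjection_mk_of_not M N h x y
  exact LinearMap.congr_fun this t

/-- The composition product is spanned by the images of its summands. -/
theorem composite_induction {I : Type} [Finite I] {S : Submodule K (Composite M N I)}
    (h : ∀ (r : ℕ) (f : I → Fin r) (t : BlockTensor M N f), toComposite M N f t ∈ S)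
    (z : Composite M N I) : z ∈ S := by
  classical
  obtain ⟨z, rfl⟩ := Submodule.Quotient.mk_surjective _ z
  induction z using DirectSum.induction_on with
  | zero => exact S.zero_mem
  | of s t => exact h s.1 s.2 t
  | add a b ha hb => exact S.add_mem ha hb

/-- If `N(0) = 0`, the summands of maps which are not surjective vanish. -/
theorem blockTensor_eq_zero (hN : N.ZeroInArityZero) {I : Type} [Finite I] {r : ℕ} {f : I → Fin r}
    (hf : ¬ Function.Surjective f) (t : BlockTensor M N f) : t = 0 := by
  have : (LinearMap.id : BlockTensor M N f →ₗ[K] BlockTensor M N f) = 0 := by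
    refine blockTensor_ext fun x d y hy => ?_
    simp only [Function.Surjective, not_forall, not_exists] at hf
    obtain ⟨k, hk⟩ := hf
    have : IsEmpty (Block f k) := ⟨fun a => hk a.1 a.2⟩
    have hN : Subsingleton (N.obj Empty) := hN
    have h0 : y k = 0 := by
      have e : Block f k ≃ Empty := Equiv.equivEmpty _
      rw [← N.map_refl (y k), ← Equiv.self_trans_symm e, N.map_trans,
        Subsingleton.elim (N.map e (y k)) 0]
      exact map_zero _
    rw [LinearMap.id_apply, MultilinearMap.map_coord_zero _ k h0, TensorProduct.tmul_zero]; rfl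
  exact LinearMap.congr_fun this t

end Summand

/-! ## Set partitions -/

section Partition

/-- The number of classes of a partition. -/
def blockCount {I : Type} (π : Setoid I) : ℕ := Nat.card (Quotient π)

/-- The surjection onto `{1, …, r}` whose blocks are the classes of a partition. -/
def blockMap {I : Type} [Finite I] (π : Setoid I) (a : I) : Fin (blockCount π) :=
  Finite.equivFin (Quotient π) (Quotient.mk π a)

theorem blockMap_surjective {I : Type} [Finite I] (π : Setoid I) :
    Function.Surjective (blockMap π) :=
  (Finite.equivFin (Quotient π)).surjective.comp Quotient.mk_surjective

theorem blockMap_eq_iff {I : Type} [Finite I] (π : Setoid I) (a b : I) :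
    blockMap π a = blockMap π b ↔ π a b :=
  (Finite.equivFin (Quotient π)).injective.eq_iff.trans Quotient.eq

/-- Together with `eq_ker_of_equiv`, this identifies the surjections out of I, up to relabelling of
their values, with the partitions of I. The map `blockMap` selects one representative in each orbit.
-/
theorem exists_equiv_blockMap {I : Type} [Finite I] {r : ℕ} {f : I → Fin r}
    (hf : Function.Surjective f) :
    ∃ v : Fin (blockCount (Setoid.ker f)) ≃ Fin r, ∀ a, f a = v (blockMap (Setoid.ker f) a) :=
  ⟨(Finite.equivFin _).symm.trans (Setoid.quotientKerEquivOfSurjective f hf), fun a =>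
    congrArg (Setoid.quotientKerEquivOfSurjective f hf)
      ((Finite.equivFin (Quotient (Setoid.ker f))).symm_apply_apply (Quotient.mk _ a)).symm⟩

theorem eq_ker_of_equiv {I : Type} [Finite I] {r : ℕ} {f : I → Fin r} {π : Setoid I}
    (v : Fin (blockCount π) ≃ Fin r) (hv : ∀ a, f a = v (blockMap π a)) : π = Setoid.ker f := by
  ext a b
  rw [← blockMap_eq_iff, Setoid.ker_def, hv, hv, v.injective.eq_iff]

instance {I : Type} [Finite I] : Finite (Setoid I) :=
  Finite.of_injective (fun π : Setoid I => fun a b => π a b) fun _ _ h =>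
    Setoid.ext fun a b => iff_of_eq (congrFun (congrFun h a) b)

theorem blockCount_le {I : Type} [Finite I] (π : Setoid I) : blockCount π ≤ Nat.card I :=
  Nat.card_le_card_of_surjective _ (Quotient.mk_surjective (s := π))

theorem blockCount_eq_card_iff {I : Type} [Finite I] (π : Setoid I) :
    blockCount π = Nat.card I ↔ π = ⊥ := by
  constructor
  · intro h
    have hb : Function.Bijective (Quotient.mk π) :=
      (Nat.bijective_iff_surjective_and_card _).2 ⟨Quotient.mk_surjective, h.symm⟩
    ext a b
    constructor
    · intro hab
      exact hb.1 (Quotient.sound hab)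
    · intro hab
      have hab : a = b := hab
      rw [hab]
  · rintro rfl
    exact (Nat.card_congr (Equiv.ofBijective (Quotient.mk (⊥ : Setoid I))
      ⟨fun a b h => Quotient.exact h, Quotient.mk_surjective⟩)).symm

end Partition

/-! ## Iterated partial composites -/

section Graft

/-- The extension of `g` to the substitution of `J` for `u`, which is constant on `J`. -/
def graftMap {I : Type} {r : ℕ} (g : I → Fin r) (u : I) {J : Type} : Graft u J → Fin r :=
  Sum.elim (fun a => g a.1) fun _ => g u

theorem exists_eq_sumCongr {A B A' B' : Type} (e : A ⊕ B ≃ A' ⊕ B')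
    (hl : ∀ a, ∃ a', e (Sum.inl a) = Sum.inl a') (hr : ∀ b, ∃ b', e (Sum.inr b) = Sum.inr b') :
    ∃ (u : A ≃ A') (v : B ≃ B'), e = Equiv.sumCongr u v := by
  choose u hu using hl
  choose v hv using hr
  have hub : Function.Bijective u := by
    constructor
    · intro a b h
      exact Sum.inl_injective (e.injective (by rw [hu, hu, h]))
    · intro a'
      rcases h : e.symm (Sum.inl a') with a | b
      · exact ⟨a, Sum.inl_injective (by rw [← hu, ← h, e.apply_symm_apply])⟩
      · have := hv b
        rw [← h, e.apply_symm_apply] at this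
        simp at this
  have hvb : Function.Bijective v := by
    constructor
    · intro a b h
      exact Sum.inr_injective (e.injective (by rw [hv, hv, h]))
    · intro b'
      rcases h : e.symm (Sum.inr b') with a | b
      · have := hu a
        rw [← h, e.apply_symm_apply] at this
        simp at this
      · exact ⟨b, Sum.inr_injective (by rw [← hv, ← h, e.apply_symm_apply])⟩
  refine ⟨Equiv.ofBijective u hub, Equiv.ofBijective v hvb, Equiv.ext ?_⟩
  rintro (a | b)
  · exact hu a
  · exact hv b

theorem exists_equiv_of_subtype_ne {I I' : Type} {i : I} {i' : I'}
    (w : {x : I // x ≠ i} ≃ {x : I' // x ≠ i'}) :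
    ∃ U : I ≃ I', U i = i' ∧ ∀ x : {x : I // x ≠ i}, U x.1 = (w x).1 := by
  classical
  let F : I → I' := fun x => if h : x = i then i' else (w ⟨x, h⟩).1
  have h1 : F i = i' := dif_pos rfl
  have h2 : ∀ x : {x : I // x ≠ i}, F x.1 = (w x).1 := fun x => dif_neg x.2
  refine ⟨Equiv.ofBijective F ⟨fun x y hxy => ?_, fun y => ?_⟩, h1, h2⟩
  · by_cases hx : x = i <;> by_cases hy : y = i
    · rw [hx, hy]
    · rw [hx, h1, h2 ⟨y, hy⟩] at hxy
      exact ((w ⟨y, hy⟩).2 hxy.symm).elim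
    · rw [hy, h1, h2 ⟨x, hx⟩] at hxy
      exact ((w ⟨x, hx⟩).2 hxy).elim
    · rw [h2 ⟨x, hx⟩, h2 ⟨y, hy⟩] at hxy
      exact congrArg Subtype.val (w.injective (Subtype.ext hxy))
  · by_cases hy : y = i'
    · exact ⟨i, h1.trans hy.symm⟩
    · exact ⟨(w.symm ⟨y, hy⟩).1, by rw [h2, w.apply_symm_apply]⟩

/-- A bijection between substitutions which respects the substituted sets is induced by
bijections between the components. -/
theorem exists_eq_graftCongr {I I' J J' : Type} {i : I} {i' : I'} (e : Graft i J ≃ Graft i' J')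
    (hl : ∀ a, ∃ a', e (Sum.inl a) = Sum.inl a') (hr : ∀ b, ∃ b', e (Sum.inr b) = Sum.inr b') :
    ∃ (U : I ≃ I') (v : J ≃ J'), U i = i' ∧
      (∀ a, ∃ a', e (Sum.inl a) = Sum.inl a' ∧ U a.1 = a'.1) ∧
      ∀ b, e (Sum.inr b) = Sum.inr (v b) := by
  obtain ⟨w, v, rfl⟩ := exists_eq_sumCongr e hl hr
  obtain ⟨U, hU, hw⟩ := exists_equiv_of_subtype_ne w
  exact ⟨U, v, hU, fun a => ⟨w a, rfl, hw a⟩, fun b => rfl⟩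

end Graft

/-! ### Normal form of iterated composites in a right module -/

namespace RightModule

variable {K : Type u} [CommRing K] {P : DGOperad.{u, v} K}

/-- `IsPartialComposite x k A g S`: the element `S ∈ L(A)` is obtained from `x ∈ L(r)` by
substituting elements of `P` for the first `k` entries; `g` sends an element of `A` to the entry
of `x` that it comes from. -/
inductive IsPartialComposite (L : RightModule P) {r : ℕ} (x : L.obj (Fin r)) :
    ℕ → ∀ (A : Type) [Finite A], (A → Fin r) → L.obj A → Prop
  | zero {A : Type} [Finite A] (e : Fin r ≃ A) (g : A → Fin r) (hg : ∀ j, g (e j) = j) :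
      IsPartialComposite L x 0 A g (L.map e x)
  | succ {k : ℕ} {A J B : Type} [Finite A] [Finite J] [Finite B] {g : A → Fin r} {S : L.obj A}
      (h : IsPartialComposite L x k A g S) (u : A) (hu : (g u : ℕ) = k) (p : P.obj J)
      (e : Graft u J ≃ B) (g' : B → Fin r) (hg' : ∀ s, g' (e s) = graftMap g u s) :
      IsPartialComposite L x (k + 1) B g' (L.map e (L.comp u S p))

variable {L : RightModule P} {r : ℕ} {x : L.obj (Fin r)}

/-- An entry of index at least k has not yet been substituted, so a single element lies over it. -/
theorem IsPartialComposite.eq_of_le {k : ℕ} {A : Type} [Finite A] {g : A → Fin r} {S : L.obj A}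
    (h : IsPartialComposite L x k A g S) : ∀ a b, g a = g b → k ≤ g a → a = b := by
  induction h with
  | zero e g hg =>
    intro a b hab _
    obtain ⟨a, rfl⟩ := e.surjective a
    obtain ⟨b, rfl⟩ := e.surjective b
    rw [hg, hg] at hab
    rw [hab]
  | succ h u hu p e g' hg' ih =>
    intro a b hab hk
    obtain ⟨a, rfl⟩ := e.surjective a
    obtain ⟨b, rfl⟩ := e.surjective b
    rw [hg'] at hab hk
    rw [hg'] at hab
    rcases a with a | a
    · rcases b with b | b
      · have := ih a.1 b.1 hab (Nat.le_of_succ_le hk)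
        rw [Subtype.ext this]
      · have hab : _ = _ := congrArg Fin.val hab
        simp only [graftMap, Sum.elim_inl, Sum.elim_inr] at hab hk
        omega
    · simp only [graftMap, Sum.elim_inr] at hk
      omega

theorem IsPartialComposite.map {k : ℕ} {A B : Type} [Finite A] [Finite B] {g : A → Fin r}
    {S : L.obj A} (h : IsPartialComposite L x k A g S) (e : A ≃ B) (g' : B → Fin r)
    (hg' : ∀ a, g' (e a) = g a) : IsPartialComposite L x k B g' (L.map e S) := by
  cases h with
  | zero e₀ _ hg =>
    rw [← L.map_trans]
    exact .zero _ _ fun j => by rw [Equiv.trans_apply, hg', hg]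
  | succ h u hu p e₀ _ hg =>
    rw [← L.map_trans]
    exact .succ h u hu p _ _ fun s => by rw [Equiv.trans_apply, hg', hg]

/-- Induction on the number of substitutions. If i lies in the block inserted last, associativity
merges q into that block. Otherwise the two insertions commute and the induction hypothesis applies
before the last one. The commutation creates a sign and requires homogeneous elements, hence the
span. -/
theorem IsPartialComposite.comp {k : ℕ} {A : Type} [Finite A] {g : A → Fin r} {S : L.obj A}
    (h : IsPartialComposite L x k A g S) : ∀ (i : A), (g i : ℕ) < k → ∀ {J : Type} [Finite J]
      (q : P.obj J), L.comp i S q ∈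
        Submodule.span K {S' | IsPartialComposite L x k (Graft i J) (graftMap g i) S'} := by
  induction h with
  | zero e g hg => intro i hi; exact (Nat.not_lt_zero _ hi).elim
  | @succ k A J₀ B _ _ _ g S h u hu p e g' hg' ih =>
    intro i hi J _ q
    obtain ⟨i, rfl⟩ := e.surjective i
    have hq : L.comp (e i) (L.map e (L.comp u S p)) q =
        L.map (graftCongr e (Equiv.refl J) i) (L.comp i (L.comp u S p) q) := by
      rw [← L.comp_map]
      exact congrArg _ (P.map_refl q).symm
    rw [hq]
    rcases i with ⟨i, hiu⟩ | j
    · have hik : (g i : ℕ) < k := by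
        rw [hg'] at hi
        have hne : (g i : ℕ) ≠ k := fun h' =>
          hiu (h.eq_of_le i u (Fin.ext (h'.trans hu.symm)) h'.ge)
        change (g i : ℕ) < k + 1 at hi
        omega
      refine (P.obj J).homogeneous_induction (p := fun q => (L.map _).toFun
        (L.comp (Sum.inl ⟨i, hiu⟩ : Graft u J₀) (L.comp u S p) q) ∈ _) q (fun b q hq => ?_)
        (by simp) fun y z hy hz => by
          rw [map_add, map_add]; exact Submodule.add_mem _ hy hz
      refine (P.obj J₀).homogeneous_induction (p := fun p => (L.map _).toFun
        (L.comp (Sum.inl ⟨i, hiu⟩ : Graft u J₀) (L.comp u S p) q) ∈ _) p (fun a p hp => ?_)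
        (by simp) fun y z hy hz => by
          rw [map_add, map_add, LinearMap.add_apply, map_add]; exact Submodule.add_mem _ hy hz
      have hc := L.comp_comm (Ne.symm hiu) a b S p q hp hq
      have hc' : L.comp (Sum.inl ⟨i, hiu⟩ : Graft u J₀) (L.comp u S p) q =
          L.map (graftComm (Ne.symm hiu) J₀ J).symm ((-1 : K) ^ (a * b) •
            L.comp (Sum.inl ⟨u, Ne.symm hiu⟩ : Graft i J) (L.comp i S q) p) := by
        rw [← hc, ← L.map_trans, Equiv.self_trans_symm, L.map_refl]
      rw [hc', map_smul, map_smul]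
      refine Submodule.smul_mem _ _ ?_
      rw [← L.map_trans]
      have key : ∀ T ∈ Submodule.span K
          {S' | IsPartialComposite L x k (Graft i J) (graftMap g i) S'},
          (L.map ((graftComm (Ne.symm hiu) J₀ J).symm.trans
            (graftCongr e (Equiv.refl J) (Sum.inl ⟨i, hiu⟩)))).toFun
          (L.comp (Sum.inl ⟨u, Ne.symm hiu⟩ : Graft i J) T p) ∈ Submodule.span K
            {S' | IsPartialComposite L x (k + 1) (Graft (e (Sum.inl ⟨i, hiu⟩)) J)
              (graftMap g' (e (Sum.inl ⟨i, hiu⟩))) S'} := by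
        intro T hT
        induction hT using Submodule.span_induction with
        | mem T hT =>
          refine Submodule.subset_span (.succ hT (Sum.inl ⟨u, Ne.symm hiu⟩) hu p _ _ ?_)
          rintro (⟨⟨s, hs⟩ | s, hs'⟩ | s)
          · exact hg' _
          · exact hg' _
          · exact hg' _
        | zero => simp
        | add y z _ _ hy hz =>
          rw [map_add, LinearMap.add_apply, map_add]; exact Submodule.add_mem _ hy hz
        | smul c y _ hy =>
          rw [map_smul, LinearMap.smul_apply, map_smul]; exact Submodule.smul_mem _ _ hy
      exact key _ (ih i hik q)
    · have ha : L.comp (Sum.inr j : Graft u J₀) (L.comp u S p) q =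
          L.map (graftAssoc u j J).symm (L.comp u S (P.comp j p q)) := by
        rw [← L.comp_assoc, ← L.map_trans, Equiv.self_trans_symm, L.map_refl]
      rw [ha, ← L.map_trans]
      refine Submodule.subset_span (.succ h u hu _ _ _ ?_)
      rintro (s | s | s)
      · exact hg' _
      · exact hg' _
      · exact hg' _

theorem map_comp_eq (L : RightModule P) {A A' J J' : Type} [Finite A] [Finite A'] [Finite J]
    [Finite J'] {u : A} {i : A'} (U : A ≃ A') (v : J ≃ J') (hU : U u = i)
    (e : Graft u J ≃ Graft i J') (hl : ∀ a, ∃ a', e (Sum.inl a) = Sum.inl a' ∧ U a.1 = a'.1)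
    (hr : ∀ b, e (Sum.inr b) = Sum.inr (v b)) (S : L.obj A) (p : P.obj J) :
    L.map e (L.comp u S p) = L.comp i (L.map U S) (P.map v p) := by
  subst hU
  rw [L.comp_map]
  refine congrArg (fun e => L.map e (L.comp u S p)) (Equiv.ext ?_)
  rintro (a | b)
  · obtain ⟨a', h1, h2⟩ := hl a
    rw [h1]
    exact congrArg Sum.inl (Subtype.ext h2.symm)
  · exact hr b

/-- The entry from which an element of a stage comes. -/
def stageMap {I : Type} {r : ℕ} (f : I → Fin r) (k : ℕ) : Stage f k → Fin r :=
  Sum.elim (fun a => f a.1) fun j => j.1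

theorem isPartialComposite_partialComposite {I : Type} [Finite I] (f : I → Fin r)
    (q : ∀ k, P.obj (Block f k)) (k : ℕ) (hk : k ≤ r) :
    IsPartialComposite L x k (Stage f k) (stageMap f k) (L.partialComposite f x q k hk) := by
  induction k with
  | zero => exact .zero _ _ fun j => rfl
  | succ k ih =>
    refine .succ (ih _) _ rfl _ _ _ ?_
    rintro (⟨s | s, hs⟩ | s)
    · rfl
    · rfl
    · exact s.2

theorem isPartialComposite_composite {I : Type} [Finite I] (f : I → Fin r)
    (q : ∀ k, P.obj (Block f k)) : IsPartialComposite L x r I f (L.composite f x q) := by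
  refine (isPartialComposite_partialComposite f q r le_rfl).map _ _ ?_
  rintro (a | j)
  · rfl
  · exact (Nat.not_le_of_lt j.1.2 j.2).elim

theorem partialComposite_congr {I : Type} [Finite I] (f : I → Fin r)
    {q q' : ∀ k, P.obj (Block f k)} (k : ℕ) (hk : k ≤ r)
    (h : ∀ j : Fin r, (j : ℕ) < k → q j = q' j) :
    L.partialComposite f x q k hk = L.partialComposite f x q' k hk := by
  induction k with
  | zero => rfl
  | succ k ih =>
    rw [partialComposite, partialComposite, ih _ fun j hj => h j (hj.trans k.lt_succ_self),
      h ⟨k, hk⟩ k.lt_succ_self]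

/-- Any bijections used along the way can be straightened. A bijection of graftings over {1, …, r}
must match the inserted blocks, which are the fibres over the entry k. It is therefore given by a
bijection U of the sets before insertion, absorbed by the induction hypothesis, and a bijection v of
the blocks, absorbed by the inserted element. -/
theorem IsPartialComposite.exists_eq_partialComposite {k : ℕ} {A : Type} [Finite A]
    {g : A → Fin r} {S : L.obj A} (h : IsPartialComposite L x k A g S) (hk : k ≤ r)
    {I : Type} [Finite I] (f : I → Fin r) : ∀ (e : A ≃ Stage f k)
    (_ : ∀ a, stageMap f k (e a) = g a),
      ∃ q, L.map e S = L.partialComposite f x q k hk := by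
  induction h with
  | zero e₀ g hg =>
    intro e he
    -- Nothing has been inserted at stage 0, so the family is irrelevant.
    refine ⟨fun _ => 0, ?_⟩
    rw [← L.map_trans, partialComposite]
    refine congrArg (fun e => L.map e x) (Equiv.ext fun j => ?_)
    rw [Equiv.trans_apply]
    have h1 := he (e₀ j)
    rw [hg] at h1
    rcases hj : e (e₀ j) with a | j'
    · exact (Nat.not_lt_zero _ a.2).elim
    · rw [hj] at h1
      exact congrArg Sum.inr (Subtype.ext h1)
  | @succ k A J B _ _ _ g S h u hu p e₀ g' hg' ih =>
    intro e he
    have hΘ : ∀ s, graftMap (stageMap f k) (Sum.inr ⟨⟨k, hk⟩, le_rfl⟩)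
        (((e₀.trans e).trans (stageSucc f k hk).symm) s) = graftMap g u s := by
      intro s
      rw [← hg', ← he]
      simp only [Equiv.trans_apply]
      generalize e (e₀ s) = t
      obtain ⟨t, rfl⟩ := (stageSucc f k hk).surjective t
      rw [Equiv.symm_apply_apply]
      rcases t with ⟨t | t, ht⟩ | t
      · rfl
      · rfl
      · exact t.2.symm
    have hgu : g u = ⟨k, hk⟩ := Fin.ext hu
    set Θ := (e₀.trans e).trans (stageSucc f k hk).symm with hΘ_def
    obtain ⟨U, v, hU, hUl, hUr⟩ := exists_eq_graftCongr Θ (fun a => by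
        have h1 := hΘ (Sum.inl a)
        rcases hs : Θ (Sum.inl a) with s | s
        · exact ⟨s, rfl⟩
        · rw [hs] at h1
          have h1 : (⟨k, hk⟩ : Fin r) = g a.1 := h1
          refine (a.2 (h.eq_of_le a.1 u ?_ ?_)).elim
          · rw [hgu, h1]
          · rw [← h1]) (fun b => by
        have h1 := hΘ (Sum.inr b)
        rcases hs : Θ (Sum.inr b) with s | s
        · rw [hs] at h1
          have h2 : stageMap f k s.1 = ⟨k, hk⟩ := Eq.trans h1 hgu
          refine (s.2 ?_).elim
          rcases h3 : s.1 with a | j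
          · rw [h3] at h2
            have h4 : ((f a.1 : Fin r) : ℕ) = k := congrArg Fin.val h2
            have := a.2
            omega
          · rw [h3] at h2
            exact congrArg Sum.inr (Subtype.ext h2)
        · exact ⟨s, rfl⟩)
    have hUg : ∀ a, stageMap f k (U a) = g a := by
      intro a
      by_cases ha : a = u
      · rw [ha, hU, hgu]; rfl
      · have h1 := hΘ (Sum.inl ⟨a, ha⟩)
        obtain ⟨a', h2, h3⟩ := hUl ⟨a, ha⟩
        rw [h2] at h1
        have h3 : U a = a'.1 := h3
        rw [h3]
        exact h1
    obtain ⟨q, hq⟩ := ih (Nat.le_of_succ_le hk) U hUg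
    refine ⟨Function.update q ⟨k, hk⟩ (P.map v p), ?_⟩
    rw [partialComposite, Function.update_self, partialComposite_congr (q' := q), ← hq,
      ← L.map_comp_eq U v hU Θ hUl hUr, ← L.map_trans, ← L.map_trans]
    · refine congrArg (fun e => L.map e (L.comp u S p)) (Equiv.ext fun s => ?_)
      simp [hΘ_def]
    · intro j hj
      exact Function.update_of_ne (fun h' => by rw [h'] at hj; exact lt_irrefl _ hj) _ _

theorem IsPartialComposite.exists_eq_composite {A : Type} [Finite A] {g : A → Fin r}
    {S : L.obj A} (h : IsPartialComposite L x r A g S) : ∃ q, S = L.composite g x q := by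
  obtain ⟨q, hq⟩ := h.exists_eq_partialComposite le_rfl g (stageEnd g).symm fun a => rfl
  refine ⟨q, ?_⟩
  rw [composite, ← hq, ← L.map_trans, Equiv.symm_trans_self, L.map_refl]

end RightModule

namespace RightModule

variable {K : Type u} [CommRing K] {P : DGOperad.{u, v} K}

/-! ## Linearity and derivation formulas for composites -/

section Composite

variable (L : RightModule P) {I : Type} [Finite I] {r : ℕ} (f : I → Fin r)

theorem partialComposite_add (x y : L.obj (Fin r)) (q : ∀ k, P.obj (Block f k)) (k : ℕ)
    (hk : k ≤ r) : L.partialComposite f (x + y) q k hk =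
      L.partialComposite f x q k hk + L.partialComposite f y q k hk := by
  induction k with
  | zero => exact map_add _ _ _
  | succ k ih =>
    rw [partialComposite, ih, map_add, LinearMap.add_apply, map_add]; rfl

theorem partialComposite_smul (c : K) (x : L.obj (Fin r)) (q : ∀ k, P.obj (Block f k)) (k : ℕ)
    (hk : k ≤ r) : L.partialComposite f (c • x) q k hk = c • L.partialComposite f x q k hk := by
  induction k with
  | zero => exact map_smul _ _ _
  | succ k ih =>
    rw [partialComposite, ih, map_smul, LinearMap.smul_apply, map_smul]; rfl

/-- The composite `x(q_1, …, q_r)` as a linear function of `x`. -/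
def compositeLinear (q : ∀ k, P.obj (Block f k)) : L.obj (Fin r) →ₗ[K] L.obj I where
  toFun x := L.composite f x q
  map_add' x y := by rw [composite, partialComposite_add, map_add]; rfl
  map_smul' c x := by rw [composite, partialComposite_smul, map_smul]; rfl

theorem compositeLinear_apply (q : ∀ k, P.obj (Block f k)) (x : L.obj (Fin r)) :
    L.compositeLinear f q x = L.composite f x q := rfl

variable {f}

theorem τ_comp {J : Type} [Finite J] (i : I) (x : L.obj I) (q : P.obj J) :
    (L.obj (Graft i J)).τ (L.comp i x q) = L.comp i ((L.obj I).τ x) ((P.obj J).τ q) := by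
  have : (L.comp i).compr₂ (L.obj (Graft i J)).τ =
      (L.comp (J := J) i).compl₁₂ (L.obj I).τ (P.obj J).τ := by
    refine (L.obj I).hom_ext fun a x hx => (P.obj J).hom_ext fun b q hq => ?_
    rw [LinearMap.compr₂_apply, LinearMap.compl₁₂_apply,
      DGModule.τ_of_mem _ (L.comp_mem i a b x q hx hq), DGModule.τ_of_mem _ hx,
      DGModule.τ_of_mem _ hq, map_smul, map_smul, LinearMap.smul_apply, smul_smul, pow_add,
      mul_comm]
  exact LinearMap.congr_fun₂ this x q

/-- With τ in place of the sign, the derivation relation is bilinear and can be iterated on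
arbitrary elements. -/
theorem δ_comp_τ {J : Type} [Finite J] (i : I) (x : L.obj I) (q : P.obj J) :
    (L.obj (Graft i J)).δ (L.comp i x q) =
      L.comp i ((L.obj I).δ x) q + L.comp i ((L.obj I).τ x) ((P.obj J).δ q) := by
  have : (L.comp i).compr₂ (L.obj (Graft i J)).δ =
      (L.comp (J := J) i) ∘ₗ (L.obj I).δ +
        (L.comp (J := J) i).compl₁₂ (L.obj I).τ (P.obj J).δ := by
    refine (L.obj I).hom_ext fun a x hx => LinearMap.ext fun q => ?_
    rw [LinearMap.compr₂_apply, LinearMap.add_apply, LinearMap.add_apply,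
      LinearMap.compl₁₂_apply, LinearMap.comp_apply,
      L.δ_comp i a x q hx, DGModule.τ_of_mem _ hx, map_smul, LinearMap.smul_apply]
  exact LinearMap.congr_fun₂ this x q

variable (f)

theorem τ_partialComposite (x : L.obj (Fin r)) (q : ∀ k, P.obj (Block f k)) (k : ℕ)
    (hk : k ≤ r) : (L.obj (Stage f k)).τ (L.partialComposite f x q k hk) =
      L.partialComposite f ((L.obj (Fin r)).τ x) (fun j => (P.obj (Block f j)).τ (q j)) k hk := by
  induction k with
  | zero => exact ((L.map (stageZero f)).map_τ x).symm
  | succ k ih =>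
    rw [partialComposite, ← DGModule.Hom.map_τ, τ_comp, ih]; rfl

theorem δ_partialComposite (x : L.obj (Fin r)) (q : ∀ k, P.obj (Block f k)) (k : ℕ)
    (hk : k ≤ r) : (L.obj (Stage f k)).δ (L.partialComposite f x q k hk) =
      L.partialComposite f ((L.obj (Fin r)).δ x) q k hk +
        ∑ j : Fin r, if (j : ℕ) < k then L.partialComposite f ((L.obj (Fin r)).τ x)
          (slot j (fun i => (P.obj (Block f i)).τ (q i)) (fun i => (P.obj (Block f i)).δ (q i)) q)
          k hk else 0 := by
  induction k with
  | zero =>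
    rw [Finset.sum_eq_zero fun j _ => if_neg (Nat.not_lt_zero _), add_zero]
    exact ((L.map (stageZero f)).map_δ x).symm
  | succ k ih =>
    -- Passing from k to k + 1, the terms with j < k are composed with q_k, the term j = k is new,
    -- and those with j > k are still absent.
    have hsplit : ∀ j : Fin r, (if (j : ℕ) < k + 1 then
        L.partialComposite f ((L.obj (Fin r)).τ x)
          (slot j (fun i => (P.obj (Block f i)).τ (q i)) (fun i => (P.obj (Block f i)).δ (q i)) q)
          (k + 1) hk else 0) =
        (L.map (stageSucc f k hk)).toFun (L.comp (Sum.inr ⟨⟨k, hk⟩, le_rfl⟩ : Stage f k)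
          (if (j : ℕ) < k then L.partialComposite f ((L.obj (Fin r)).τ x)
          (slot j (fun i => (P.obj (Block f i)).τ (q i)) (fun i => (P.obj (Block f i)).δ (q i)) q)
          k (Nat.le_of_succ_le hk) else 0) (q ⟨k, hk⟩)) +
        if j = ⟨k, hk⟩ then (L.map (stageSucc f k hk)).toFun
          (L.comp (Sum.inr ⟨⟨k, hk⟩, le_rfl⟩ : Stage f k)
            ((L.obj (Stage f k)).τ (L.partialComposite f x q k (Nat.le_of_succ_le hk)))
            ((P.obj _).δ (q ⟨k, hk⟩))) else 0 := by
      intro j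
      rcases lt_trichotomy (j : ℕ) k with h | h | h
      · have hne : j ≠ ⟨k, hk⟩ := fun h' => by rw [h'] at h; exact lt_irrefl _ h
        rw [if_pos (h.trans k.lt_succ_self), if_pos h, if_neg hne, add_zero, partialComposite]
        congr 2
        have h1 : ¬ (⟨k, hk⟩ : Fin r) < j := not_lt.2 h.le
        simp [slot, h1, hne.symm]
      · have he : j = ⟨k, hk⟩ := Fin.ext h
        subst he
        rw [if_pos (Nat.lt_succ_self k), if_neg (lt_irrefl _), if_pos rfl, map_zero,
          LinearMap.zero_apply, map_zero, zero_add, partialComposite, τ_partialComposite]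
        rw [partialComposite_congr (q' := fun j => (P.obj (Block f j)).τ (q j))]
        · simp [slot]
        · intro i hi
          have : i < ⟨k, hk⟩ := hi
          simp [slot, this]
      · have hne : j ≠ ⟨k, hk⟩ := fun h' => by rw [h'] at h; exact lt_irrefl _ h
        rw [if_neg (by omega), if_neg (by omega), if_neg hne]
        simp
    rw [Finset.sum_congr rfl fun j _ => hsplit j, Finset.sum_add_distrib, Finset.sum_ite_eq',
      if_pos (Finset.mem_univ _), partialComposite, ← DGModule.Hom.map_δ, δ_comp_τ, ih, map_add,
      map_add, LinearMap.add_apply, map_add]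
    rw [add_assoc, partialComposite, map_sum, LinearMap.sum_apply, map_sum]

/-- The sum has the same shape as in `blockDiff_tmul`. Hence the differential of a quasi-free module
departs from the canonical one only through the differential of the generator. -/
theorem δ_composite (x : L.obj (Fin r)) (q : ∀ k, P.obj (Block f k)) :
    (L.obj I).δ (L.composite f x q) = L.composite f ((L.obj (Fin r)).δ x) q +
      ∑ j : Fin r, L.composite f ((L.obj (Fin r)).τ x)
        (slot j (fun i => (P.obj (Block f i)).τ (q i))
          (fun i => (P.obj (Block f i)).δ (q i)) q) := by
  rw [composite, ← DGModule.Hom.map_δ, δ_partialComposite, map_add, map_sum]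
  congr 1
  refine Finset.sum_congr rfl fun j _ => ?_
  rw [if_pos j.2]; rfl

theorem Hom.map_composite {P' : DGOperad.{u, v} K} {ψ : P.Hom P'} {L : RightModule P}
    {L' : RightModule P'} (φ : L.Hom (L'.restrict ψ)) (x : L.obj (Fin r))
    (q : ∀ k, P.obj (Block f k)) :
    φ.app I (L.composite f x q) =
      L'.composite f (φ.app (Fin r) x) fun k => ψ.app (Block f k) (q k) := by
  have key : ∀ k hk, φ.app (Stage f k) (L.partialComposite f x q k hk) =
      L'.partialComposite f (φ.app (Fin r) x) (fun k => ψ.app (Block f k) (q k)) k hk := by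
    intro k hk
    induction k with
    | zero => exact φ.naturality _ _
    | succ k ih =>
      rw [partialComposite, φ.naturality, φ.map_comp, ih]; rfl
  rw [composite, φ.naturality, key]; rfl

end Composite

/-! ## Decomposable elements -/

section Decomposables

variable (L : RightModule P)

/-- The span of the decomposable elements. -/
abbrev decSpan (A : Type) [Finite A] : Submodule K (L.obj A) :=
  Submodule.span K (L.decomposables A)

theorem map_mem_decSpan {A B : Type} [Finite A] [Finite B] (e : A ≃ B) {z : L.obj A}
    (hz : z ∈ L.decSpan A) : L.map e z ∈ L.decSpan B := by
  have : L.decSpan A ≤ (L.decSpan B).comap (L.map e).toFun :=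
    Submodule.span_le.2 (L.map_decomposables e)
  exact this hz

/-- The composite with the unit is given by a bijection. -/
theorem exists_comp_map_one {A J : Type} [Finite A] [Finite J] (i : A) (w : Unit ≃ J) :
    ∃ e : A ≃ Graft i J, ∀ z, L.comp i z (P.map w P.one) = L.map e z := by
  refine ⟨(graftUnit i).symm.trans (graftCongr (Equiv.refl A) w i), fun z => ?_⟩
  have h1 := L.comp_map (Equiv.refl A) w i z P.one
  have h2 : L.comp i z P.one = L.map (graftUnit i).symm z := by
    conv_rhs => rw [← L.comp_one i z]
    rw [← L.map_trans, Equiv.self_trans_symm, L.map_refl]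
  rw [L.map_refl, h2] at h1
  exact h1.trans (L.map_trans _ _ z).symm

theorem exists_eq_smul_map_one (hP : P.IsConnected) {J : Type} [Finite J] (w : Unit ≃ J)
    (q : P.obj J) : ∃ c : K, q = c • P.map w P.one := by
  obtain ⟨c, hc⟩ := hP.one.2 (P.map w.symm q)
  refine ⟨c, ?_⟩
  have := congrArg (P.map w).toFun hc
  rw [← P.map_trans, Equiv.symm_trans_self, P.map_refl, map_smul] at this
  exact this.symm

theorem subsingleton_of_isEmpty (hP : P.IsConnected) {J : Type} [Finite J] [IsEmpty J] :
    Subsingleton (P.obj J) := by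
  have hN : Subsingleton (P.obj Empty) := hP.zero
  refine ⟨fun a b => ?_⟩
  have e : J ≃ Empty := Equiv.equivEmpty _
  rw [← P.map_refl a, ← P.map_refl b, ← Equiv.self_trans_symm e, P.map_trans, P.map_trans,
    Subsingleton.elim (P.map e a) (P.map e b)]

/-- Connectedness leaves three cases: P(J) is zero if J is empty, it consists of multiples of the
unit if J is a singleton, and otherwise the composite is decomposable by definition. -/
theorem comp_mem_decSpan (hP : P.IsConnected) {A J : Type} [Finite A] [Finite J] (i : A)
    {z : L.obj A} (hz : z ∈ L.decSpan A) (q : P.obj J) : L.comp i z q ∈ L.decSpan (Graft i J) := by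
  rcases isEmpty_or_nonempty J with h | h
  · have := subsingleton_of_isEmpty hP (J := J)
    rw [Subsingleton.elim q 0, map_zero]
    exact Submodule.zero_mem _
  · rcases subsingleton_or_nontrivial J with h' | h'
    · have : Unique J := (unique_iff_subsingleton_and_nonempty J).2 ⟨h', h⟩ |>.some
      obtain ⟨c, rfl⟩ := exists_eq_smul_map_one hP (Equiv.ofUnique Unit J) q
      obtain ⟨e, he⟩ := L.exists_comp_map_one i (Equiv.ofUnique Unit J)
      rw [map_smul, he]
      exact Submodule.smul_mem _ _ (L.map_mem_decSpan e hz)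
    · rw [← L.map_refl (L.comp i z q)]
      exact L.comp_mem_span_decomposables i _ z q

/-- By the pigeonhole principle some block has at least two elements. Its insertion produces a
decomposable element, and the later insertions preserve decomposables. -/
theorem composite_mem_decSpan (hP : P.IsConnected) {I : Type} [Finite I] {r : ℕ} (f : I → Fin r)
    (hr : r < Nat.card I) (x : L.obj (Fin r)) (q : ∀ k, P.obj (Block f k)) :
    L.composite f x q ∈ L.decSpan I := by
  have key : ∀ k hk, (∃ j : Fin r, (j : ℕ) < k ∧ Nontrivial (Block f j)) →
      L.partialComposite f x q k hk ∈ L.decSpan (Stage f k) := by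
    intro k hk
    induction k with
    | zero => rintro ⟨j, hj, -⟩; exact (Nat.not_lt_zero _ hj).elim
    | succ k ih =>
      rintro ⟨j, hj, hj'⟩
      rw [partialComposite]
      by_cases h : (j : ℕ) = k
      · have : j = ⟨k, hk⟩ := Fin.ext h
        subst this
        exact L.comp_mem_span_decomposables _ _ _ _
      · exact L.map_mem_decSpan _ (L.comp_mem_decSpan hP _ (ih _ ⟨j, by omega, hj'⟩) _)
  refine L.map_mem_decSpan _ (key r le_rfl ?_)
  by_contra! hc
  have hinj : Function.Injective f := by
    intro a b hab
    have := hc (f b) (f b).2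
    exact congrArg Subtype.val (Subsingleton.elim (⟨a, hab⟩ : Block f (f b)) ⟨b, rfl⟩)
  have := Nat.card_le_card_of_injective f hinj
  rw [Nat.card_fin] at this
  omega

end Decomposables
end RightModule

namespace RightModule

variable {K : Type u} [CommRing K] {P : DGOperad.{u, v} K}

/-! ## The filtration by the number of blocks -/

section Filtration

variable (L : RightModule P) {M : SigmaModule.{u, v} K}
  (ι : ∀ (I : Type) [Finite I], M.obj I →ₗ[K] L.obj I)

/-- The span of the composites `ι(x)(q_1, …, q_r)` with `r < s`. -/
def blockFiltration (s : ℕ) (A : Type) [Finite A] : Submodule K (L.obj A) :=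
  Submodule.span K {z | ∃ r < s, ∃ (f : A → Fin r) (x : M.obj (Fin r))
    (q : ∀ k, P.obj (Block f k)), z = L.composite f (ι (Fin r) x) q}

theorem composite_mem_blockFiltration {r s : ℕ} (h : r < s) {A : Type} [Finite A] (f : A → Fin r)
    (x : M.obj (Fin r)) (q : ∀ k, P.obj (Block f k)) :
    L.composite f (ι (Fin r) x) q ∈ L.blockFiltration ι s A :=
  Submodule.subset_span ⟨r, h, f, x, q, rfl⟩

theorem blockFiltration_mono (A : Type) [Finite A] :
    Monotone fun s => L.blockFiltration ι s A := fun _ _ hst =>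
  Submodule.span_mono fun _ ⟨r, hr, h⟩ => ⟨r, hr.trans_le hst, h⟩

theorem blockFiltration_zero (A : Type) [Finite A] : L.blockFiltration ι 0 A = ⊥ :=
  (Submodule.eq_bot_iff _).2 fun z hz => by
    induction hz using Submodule.span_induction with
    | mem z hz => obtain ⟨r, hr, -⟩ := hz; exact (Nat.not_lt_zero _ hr).elim
    | zero => rfl
    | add y z _ _ hy hz => rw [hy, hz, add_zero]
    | smul c y _ hy => rw [hy, smul_zero]

theorem blockFiltration_one_eq_bot (A : Type) [Finite A] [Nonempty A] :
    L.blockFiltration ι 1 A = ⊥ := by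
  rw [eq_bot_iff]
  refine Submodule.span_le.2 ?_
  rintro _ ⟨r, hr, f, x, q, rfl⟩
  obtain rfl : r = 0 := by omega
  exact (f (Classical.arbitrary A)).elim0

theorem map_mem_blockFiltration {s : ℕ} {A B : Type} [Finite A] [Finite B] (e : A ≃ B)
    {z : L.obj A} (hz : z ∈ L.blockFiltration ι s A) : L.map e z ∈ L.blockFiltration ι s B := by
  have : L.blockFiltration ι s A ≤ (L.blockFiltration ι s B).comap (L.map e).toFun := by
    refine Submodule.span_le.2 ?_
    rintro _ ⟨r, hr, f, x, q, rfl⟩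
    obtain ⟨q', hq'⟩ := ((isPartialComposite_composite f q).map e (fun b => f (e.symm b))
      fun a => by rw [e.symm_apply_apply]).exists_eq_composite
    change L.map e _ ∈ L.blockFiltration ι s B
    rw [hq']
    exact L.composite_mem_blockFiltration ι hr _ x q'
  exact this hz

/-- Further composition acts on the inserted elements and never on x; the normal form then gives
composites of the same x, with the same r. -/
theorem comp_mem_blockFiltration {s : ℕ} {A J : Type} [Finite A] [Finite J] (i : A)
    {z : L.obj A} (hz : z ∈ L.blockFiltration ι s A) (q : P.obj J) :
    L.comp i z q ∈ L.blockFiltration ι s (Graft i J) := by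
  have : L.blockFiltration ι s A ≤
      (L.blockFiltration ι s (Graft i J)).comap ((L.comp i).flip q) := by
    refine Submodule.span_le.2 ?_
    rintro _ ⟨r, hr, f, x, q', rfl⟩
    change L.comp i _ q ∈ L.blockFiltration ι s (Graft i J)
    refine Submodule.span_le.2 ?_ ((isPartialComposite_composite f q').comp i (f i).2 q)
    intro S hS
    obtain ⟨q'', rfl⟩ := IsPartialComposite.exists_eq_composite hS
    exact L.composite_mem_blockFiltration ι hr _ x q''
  exact this hz

theorem composite_mem_blockFiltration_of_mem {r s : ℕ} {A : Type} [Finite A] (f : A → Fin r)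
    {z : L.obj (Fin r)} (hz : z ∈ L.blockFiltration ι s (Fin r)) (q : ∀ k, P.obj (Block f k)) :
    L.composite f z q ∈ L.blockFiltration ι s A := by
  have key : ∀ k hk, L.partialComposite f z q k hk ∈ L.blockFiltration ι s (Stage f k) := by
    intro k hk
    induction k with
    | zero => exact L.map_mem_blockFiltration ι _ hz
    | succ k ih =>
      exact L.map_mem_blockFiltration ι _ (L.comp_mem_blockFiltration ι _ (ih _) _)
  exact L.map_mem_blockFiltration ι _ (key r le_rfl)

end Filtration

/-! ## The decomposition of a quasi-free module -/

section Partitions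

instance {I : Type} [Finite I] : Fintype (Setoid I) := Fintype.ofFinite _

end Partitions

theorem blockTensor_induction {M N : SigmaModule.{u, v} K} {I : Type} [Finite I] {r : ℕ}
    {f : I → Fin r} {X : Type*} [AddCommGroup X] [Module K X] (α : BlockTensor M N f →ₗ[K] X)
    (S : Submodule K X)
    (h : ∀ x y, α (x ⊗ₜ PiTensorProduct.tprod K y) ∈ S) (t : BlockTensor M N f) : α t ∈ S := by
  have : S.mkQ ∘ₗ α = 0 := blockTensor_ext fun x d y _ =>
    (Submodule.Quotient.mk_eq_zero S).2 (h x y)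
  exact (Submodule.Quotient.mk_eq_zero S).1 (LinearMap.congr_fun this t)

/-- The differential of a summand of the composition product. -/
def blockDiff (M N : SigmaModule.{u, v} K) {I : Type} [Finite I] {r : ℕ} (f : I → Fin r) :
    Module.End K (BlockTensor M N f) :=
  tensorDiff (M.obj (Fin r)).δ (M.obj (Fin r)).τ
    (piDiff (fun k => (N.obj (Block f k)).δ) fun k => (N.obj (Block f k)).τ)

theorem blockDiff_tmul (M N : SigmaModule.{u, v} K) {I : Type} [Finite I] {r : ℕ} (f : I → Fin r)
    (x : M.obj (Fin r)) (y : ∀ k, N.obj (Block f k)) :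
    blockDiff M N f (x ⊗ₜ PiTensorProduct.tprod K y) =
      (M.obj (Fin r)).δ x ⊗ₜ PiTensorProduct.tprod K y +
        ∑ j, (M.obj (Fin r)).τ x ⊗ₜ PiTensorProduct.tprod K
          (slot j (fun i => (N.obj (Block f i)).τ (y i))
            (fun i => (N.obj (Block f i)).δ (y i)) y) := by
  rw [blockDiff, tensorDiff, LinearMap.add_apply, TensorProduct.map_tmul, TensorProduct.map_tmul,
    piDiff, LinearMap.sum_apply, TensorProduct.tmul_sum]
  congr 1
  refine Finset.sum_congr rfl fun j _ => ?_
  rw [PiTensorProduct.map_tprod]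
  congr 2
  funext i
  simp only [slot]
  split_ifs <;> rfl

namespace IsQuasiFreeOn

variable {L : RightModule P} {M : SigmaModule.{u, v} K}
  {ι : ∀ (I : Type) [Finite I], M.obj I →ₗ[K] L.obj I}

/-- The isomorphism from the composition product. -/
def equiv (h : L.IsQuasiFreeOn M ι) (I : Type) [Finite I] :
    Composite M P.toSigmaModule I ≃ₗ[K] L.obj I := (h.free I).choose

/-- The map `x ⊗ q_1 ⊗ ⋯ ⊗ q_r ↦ ι(x)(q_1, …, q_r)`. -/
def summand (h : L.IsQuasiFreeOn M ι) {I : Type} [Finite I] {r : ℕ} (f : I → Fin r) :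
    BlockTensor M P.toSigmaModule f →ₗ[K] L.obj I :=
  (h.equiv I).toLinearMap ∘ₗ toComposite M P.toSigmaModule f

theorem summand_tmul (h : L.IsQuasiFreeOn M ι) {I : Type} [Finite I] {r : ℕ} (f : I → Fin r)
    (x : M.obj (Fin r))
    (q : ∀ k, P.obj (Block f k)) :
    h.summand f (x ⊗ₜ PiTensorProduct.tprod K q) = L.composite f (ι (Fin r) x) q :=
  (h.free I).choose_spec r f x q

/-- The projection onto the summand of a surjection. -/
def proj (h : L.IsQuasiFreeOn M ι) {I : Type} [Finite I] {r : ℕ} (g : I → Fin r)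
    (hg : Function.Surjective g) :
    L.obj I →ₗ[K] BlockTensor M P.toSigmaModule g :=
  projection M P.toSigmaModule g hg ∘ₗ (h.equiv I).symm.toLinearMap

theorem proj_summand (h : L.IsQuasiFreeOn M ι) {I : Type} [Finite I] {r : ℕ} {g : I → Fin r}
    (hg : Function.Surjective g)
    (t : BlockTensor M P.toSigmaModule g) : h.proj g hg (h.summand g t) = t := by
  simp [proj, summand, projection_toComposite]

theorem proj_summand_of_not (h : L.IsQuasiFreeOn M ι) {I : Type} [Finite I] {r s : ℕ}
    {f : I → Fin r}
    {g : I → Fin s} (hg : Function.Surjective g)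
    (hfg : ¬ ∃ v : Fin s ≃ Fin r, ∀ a, f a = v (g a)) (t : BlockTensor M P.toSigmaModule f) :
    h.proj g hg (h.summand f t) = 0 := by
  simp [proj, summand, projection_toComposite_of_not _ _ hg hfg]

theorem summand_mem_blockFiltration (h : L.IsQuasiFreeOn M ι) {I : Type} [Finite I] {r s : ℕ}
    (hr : r < s) (f : I → Fin r)
    (t : BlockTensor M P.toSigmaModule f) : h.summand f t ∈ L.blockFiltration ι s I :=
  blockTensor_induction _ _ (fun x y => by
    rw [summand_tmul]
    exact L.composite_mem_blockFiltration ι hr f x y) t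

/-- The projection onto the summand of a partition. -/
def partProj (h : L.IsQuasiFreeOn M ι) {I : Type} [Finite I] (π : Setoid I) :
    L.obj I →ₗ[K] BlockTensor M P.toSigmaModule (blockMap π) :=
  h.proj (blockMap π) (blockMap_surjective π)

theorem partProj_summand_of_ne (h : L.IsQuasiFreeOn M ι) {I : Type} [Finite I] {π π' : Setoid I}
    (hπ : π ≠ π')
    (t : BlockTensor M P.toSigmaModule (blockMap π')) :
    h.partProj π (h.summand (blockMap π') t) = 0 := by
  refine h.proj_summand_of_not _ ?_ t
  rintro ⟨v, hv⟩
  refine hπ ((eq_ker_of_equiv v hv).trans ?_)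
  ext a b
  exact blockMap_eq_iff π' a b

theorem partProj_summand_of_blockCount_ne (h : L.IsQuasiFreeOn M ι) {I : Type} [Finite I]
    {π : Setoid I} {r : ℕ}
    (hr : r ≠ blockCount π) (f : I → Fin r) (t : BlockTensor M P.toSigmaModule f) :
    h.partProj π (h.summand f t) = 0 := by
  refine h.proj_summand_of_not _ ?_ t
  rintro ⟨v, hv⟩
  exact hr (by simpa using (Fintype.card_congr v).symm)

/-- This is the splitting of L(I) over the partitions of I. A summand of a surjection is carried to
the representative of its orbit, and the other summands vanish because P(0) = 0. -/
theorem sum_summand_partProj (h : L.IsQuasiFreeOn M ι) (hP : P.IsConnected) {I : Type} [Finite I]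
    (z : L.obj I) :
    ∑ π : Setoid I, h.summand (blockMap π) (h.partProj π z) = z := by
  let S : Submodule K (Composite M P.toSigmaModule I) :=
    LinearMap.ker ((∑ π : Setoid I, h.summand (blockMap π) ∘ₗ h.partProj π - LinearMap.id) ∘ₗ
      (h.equiv I).toLinearMap)
  have hS : ∀ z, z ∈ S := composite_induction M P.toSigmaModule fun r f t => by
    by_cases hf : Function.Surjective f
    · obtain ⟨v, hv⟩ := exists_equiv_blockMap hf
      rw [← toComposite_permuteSummand M P.toSigmaModule v hv t]
      generalize permuteSummand M P.toSigmaModule v hv t = t'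
      rw [LinearMap.mem_ker, LinearMap.comp_apply, LinearMap.sub_apply, LinearMap.sum_apply,
        sub_eq_zero, Finset.sum_eq_single (Setoid.ker f)]
      · exact congrArg (h.summand _) (h.proj_summand _ t')
      · intro π _ hπ
        exact (congrArg (h.summand _) (h.partProj_summand_of_ne hπ t')).trans (map_zero _)
      · simp
    · rw [blockTensor_eq_zero M P.toSigmaModule hP.zero hf t, map_zero]
      exact S.zero_mem
  have := hS ((h.equiv I).symm z)
  rw [LinearMap.mem_ker, LinearMap.comp_apply, LinearEquiv.coe_coe, LinearEquiv.apply_symm_apply,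
    LinearMap.sub_apply, LinearMap.sum_apply, sub_eq_zero] at this
  exact this

/-- The filtration is split: it consists of whole summands, so membership can be tested by
projections. As the definition requires r < s, partitions into s classes are already excluded. -/
theorem mem_blockFiltration_iff (h : L.IsQuasiFreeOn M ι) (hP : P.IsConnected)
    {I : Type} [Finite I] {s : ℕ} {z : L.obj I} :
    z ∈ L.blockFiltration ι s I ↔ ∀ π : Setoid I, s ≤ blockCount π → h.partProj π z = 0 := by
  constructor
  · intro hz π hπ
    have : L.blockFiltration ι s I ≤ LinearMap.ker (h.partProj π) := by
      refine Submodule.span_le.2 ?_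
      rintro _ ⟨r, hr, f, x, q, rfl⟩
      refine LinearMap.mem_ker.2 ?_
      rw [← h.summand_tmul]
      exact h.partProj_summand_of_blockCount_ne (by omega) _ _
    exact this hz
  · intro hz
    rw [← h.sum_summand_partProj hP z]
    refine Submodule.sum_mem _ fun π _ => ?_
    by_cases hπ : s ≤ blockCount π
    · rw [hz π hπ, map_zero]; exact Submodule.zero_mem _
    · exact h.summand_mem_blockFiltration (not_le.1 hπ) _ _

theorem blockFiltration_eq_top (h : L.IsQuasiFreeOn M ι) (hP : P.IsConnected)
    {I : Type} [Finite I] {s : ℕ}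
    (hs : Nat.card I < s) : L.blockFiltration ι s I = ⊤ :=
  eq_top_iff.2 fun _ _ => (h.mem_blockFiltration_iff hP).2 fun π hπ =>
    absurd (blockCount_le π) (by omega)

/-- The decomposable elements form the second highest stage of the filtration. -/
theorem decSpan_eq (h : L.IsQuasiFreeOn M ι) (hP : P.IsConnected) (I : Type) [Finite I] :
    L.decSpan I = L.blockFiltration ι (Nat.card I) I := by
  apply le_antisymm
  · refine Submodule.span_le.2 ?_
    rintro _ ⟨A, J, _, _, hJ, i, e, a, b, x, q, -, -, rfl⟩
    refine L.map_mem_blockFiltration ι e (L.comp_mem_blockFiltration ι i ?_ q)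
    -- Grafting a set with at least two elements strictly increases the arity, and an element of
    -- arity |A| involves at most |A| blocks.
    have hcard : Nat.card A < Nat.card I := by
      have h1 : Nat.card {x : A // x ≠ i} + 1 = Nat.card A := by
        classical
        have := Fintype.ofFinite A
        rw [Nat.card_eq_fintype_card, Nat.card_eq_fintype_card, Fintype.card_subtype_compl,
          Fintype.card_subtype_eq]
        have := Fintype.card_pos_iff.2 ⟨i⟩
        omega
      have h2 : 1 < Nat.card J := Finite.one_lt_card
      rw [← Nat.card_congr e, Nat.card_sum]
      omega
    refine L.blockFiltration_mono ι A hcard ?_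
    change x ∈ L.blockFiltration ι (Nat.card A + 1) A
    rw [h.blockFiltration_eq_top hP (Nat.lt_succ_self _)]
    trivial
  · refine Submodule.span_le.2 ?_
    rintro _ ⟨r, hr, f, x, q, rfl⟩
    exact L.composite_mem_decSpan hP f hr _ q

/-- The differential of `L` agrees with the canonical differential up to lower filtration. -/
theorem δ_summand_sub_mem (h : L.IsQuasiFreeOn M ι) (hP : P.IsConnected) {I : Type} [Finite I]
    {r : ℕ} (f : I → Fin r)
    (t : BlockTensor M P.toSigmaModule f) :
    (L.obj I).δ (h.summand f t) - h.summand f (blockDiff M P.toSigmaModule f t) ∈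
      L.blockFiltration ι r I := by
  refine blockTensor_induction ((L.obj I).δ ∘ₗ h.summand f -
    h.summand f ∘ₗ blockDiff M P.toSigmaModule f) _ (fun x q => ?_) t
  have hτ : (L.obj (Fin r)).τ (ι (Fin r) x) = ι (Fin r) ((M.obj (Fin r)).τ x) := by
    have : (L.obj (Fin r)).τ ∘ₗ ι (Fin r) = ι (Fin r) ∘ₗ (M.obj (Fin r)).τ := by
      refine (M.obj (Fin r)).hom_ext fun d x hx => ?_
      rw [LinearMap.comp_apply, LinearMap.comp_apply, DGModule.τ_of_mem _ hx,
        DGModule.τ_of_mem _ (h.map_gr _ d x hx), map_smul]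
    exact LinearMap.congr_fun this x
  -- The twist of a generator of arity r is decomposable in arity r, hence involves generators of
  -- arity less than r only.
  have htw := h.twist (Fin r) x
  rw [show Submodule.span K (L.decomposables (Fin r)) = L.blockFiltration ι r (Fin r) by
    have := h.decSpan_eq hP (Fin r)
    rwa [Nat.card_fin] at this] at htw
  rw [LinearMap.sub_apply, LinearMap.comp_apply, LinearMap.comp_apply, summand_tmul,
    blockDiff_tmul, map_add, map_sum, summand_tmul, δ_composite, hτ]
  simp only [summand_tmul]
  rw [add_sub_add_right_eq_sub, ← compositeLinear_apply, ← compositeLinear_apply, ← map_sub]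
  exact L.composite_mem_blockFiltration_of_mem ι f htw q

theorem δ_mem_blockFiltration (h : L.IsQuasiFreeOn M ι) (hP : P.IsConnected)
    {I : Type} [Finite I] {s : ℕ} {z : L.obj I}
    (hz : z ∈ L.blockFiltration ι s I) : (L.obj I).δ z ∈ L.blockFiltration ι s I := by
  have : L.blockFiltration ι s I ≤ (L.blockFiltration ι s I).comap (L.obj I).δ := by
    refine Submodule.span_le.2 ?_
    rintro _ ⟨r, hr, f, x, q, rfl⟩
    rw [← h.summand_tmul]
    have h1 := L.blockFiltration_mono ι I hr.le (h.δ_summand_sub_mem hP f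
      (x ⊗ₜ PiTensorProduct.tprod K q))
    have h2 := Submodule.add_mem _ h1 (h.summand_mem_blockFiltration hr f
      (blockDiff M P.toSigmaModule f (x ⊗ₜ PiTensorProduct.tprod K q)))
    rwa [sub_add_cancel] at h2
  exact this hz

/-- The differential on the highest summands of an element of the filtration. -/
theorem partProj_δ (h : L.IsQuasiFreeOn M ι) (hP : P.IsConnected) {I : Type} [Finite I]
    {z : L.obj I} {π : Setoid I}
    (hz : z ∈ L.blockFiltration ι (blockCount π + 1) I) :
    h.partProj π ((L.obj I).δ z) = blockDiff M P.toSigmaModule (blockMap π) (h.partProj π z) := by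
  have hlow : ∀ {y}, y ∈ L.blockFiltration ι (blockCount π) I → h.partProj π y = 0 := fun hy =>
    (h.mem_blockFiltration_iff hP).1 hy π le_rfl
  -- For a summand with no more classes than π, the twist falls in filtration too low to be seen by
  -- the projection. The summands with more classes do not occur in z.
  have key : ∀ (π' : Setoid I) (t : BlockTensor M P.toSigmaModule (blockMap π')),
      blockCount π' ≤ blockCount π →
      h.partProj π ((L.obj I).δ (h.summand (blockMap π') t)) =
        h.partProj π (h.summand (blockMap π') (blockDiff M P.toSigmaModule (blockMap π') t)) := by
    intro π' t hπ'
    rw [← sub_eq_zero, ← map_sub]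
    exact hlow (L.blockFiltration_mono ι I hπ' (h.δ_summand_sub_mem hP _ t))
  conv_lhs => rw [← h.sum_summand_partProj hP z]
  rw [map_sum, map_sum, Finset.sum_eq_single π]
  · rw [key π _ le_rfl]
    exact h.proj_summand _ _
  · intro π' _ hπ'
    by_cases hc : blockCount π' ≤ blockCount π
    · rw [key π' _ hc, h.partProj_summand_of_ne hπ'.symm]
    · rw [(h.mem_blockFiltration_iff hP).1 hz π' (by omega), map_zero, map_zero, map_zero]
  · simp

end IsQuasiFreeOn
end RightModule

namespace RightModule

variable {K : Type u} [CommRing K] {P : DGOperad.{u, v} K}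

/-! ## Generators and indecomposables -/

/-- Composites with units are given by a bijection. -/
theorem exists_composite_units (L : RightModule P) {I : Type} [Finite I] {r : ℕ} (f : I → Fin r)
    (w : ∀ k, Unit ≃ Block f k) : ∃ e : Fin r ≃ I, ∀ y,
      L.composite f y (fun k => P.map (w k) P.one) = L.map e y := by
  have key : ∀ k hk, ∃ e : Fin r ≃ Stage f k, ∀ y,
      L.partialComposite f y (fun k => P.map (w k) P.one) k hk = L.map e y := by
    intro k hk
    induction k with
    | zero => exact ⟨stageZero f, fun y => rfl⟩
    | succ k ih =>
      obtain ⟨e, he⟩ := ih (Nat.le_of_succ_le hk)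
      obtain ⟨e', he'⟩ := L.exists_comp_map_one
        (Sum.inr ⟨⟨k, hk⟩, le_rfl⟩ : Stage f k) (w ⟨k, hk⟩)
      refine ⟨(e.trans e').trans (stageSucc f k hk), fun y => ?_⟩
      rw [partialComposite, he, he', L.map_trans, L.map_trans]
  obtain ⟨e, he⟩ := key r le_rfl
  exact ⟨e.trans (stageEnd f), fun y => by rw [composite, he, L.map_trans]⟩

/-- Functionals with value 1 on the y_i contract the tensor back to x. -/
theorem eq_zero_of_tmul_tprod_eq_zero {X : Type*} [AddCommGroup X] [Module K X] {r : ℕ}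
    {V : Fin r → Type*} [∀ i, AddCommGroup (V i)] [∀ i, Module K (V i)] {x : X} {y : ∀ i, V i}
    (c : ∀ i, V i →ₗ[K] K) (hc : ∀ i, c i (y i) = 1)
    (h : x ⊗ₜ[K] PiTensorProduct.tprod K y = 0) : x = 0 := by
  have := congrArg ((TensorProduct.rid K X).toLinearMap ∘ₗ TensorProduct.map LinearMap.id
    (PiTensorProduct.lift ((MultilinearMap.mkPiAlgebra K (Fin r) K).compLinearMap c))) h
  simpa [hc] using this

namespace IsQuasiFreeOn

variable {L : RightModule P} {M : SigmaModule.{u, v} K}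
  {ι : ∀ (I : Type) [Finite I], M.obj I →ₗ[K] L.obj I}

/-- The morphism from the generators to the indecomposable quotient. -/
def toIndecomposables (h : L.IsQuasiFreeOn M ι) (A : Type) [Finite A] :
    (M.obj A).Hom (L.indecomposables.obj A) where
  toFun := (L.decSpan A).mkQ ∘ₗ ι A
  map_gr d x hx := ⟨ι A x, h.map_gr A d x hx, rfl⟩
  -- The condition on the twist says precisely that ι commutes with differentials modulo
  -- decomposables.
  map_δ x := ((Submodule.Quotient.eq (L.decSpan A)).2 (h.twist A x)).symm

/-- The discrete partition contributes M(A) tensored with copies of P(1) = K, that is M(A) itself,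
and all other partitions contribute decomposables. Freeness of P(1) on the unit gives injectivity.
-/
theorem bijective_toIndecomposables (h : L.IsQuasiFreeOn M ι) (hP : P.IsConnected) (A : Type)
    [Finite A] : Function.Bijective (h.toIndecomposables A).toFun := by
  have hcount : blockCount (⊥ : Setoid A) = Nat.card A := (blockCount_eq_card_iff ⊥).2 rfl
  have hinj : Function.Injective (blockMap (⊥ : Setoid A)) := fun a b hab =>
    (blockMap_eq_iff ⊥ a b).1 hab
  have hw : ∀ k, Nonempty (Unit ≃ Block (blockMap (⊥ : Setoid A)) k) := fun k => by
    obtain ⟨a, ha⟩ := blockMap_surjective (⊥ : Setoid A) k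
    have : Unique (Block (blockMap (⊥ : Setoid A)) k) :=
      ⟨⟨⟨a, ha⟩⟩, fun b => Subtype.ext (hinj (b.2.trans ha.symm))⟩
    exact ⟨Equiv.ofUnique _ _⟩
  let w := fun k => (hw k).some
  obtain ⟨e, he⟩ := L.exists_composite_units (blockMap (⊥ : Setoid A)) w
  let c₀ : K ≃ₗ[K] P.obj Unit :=
    LinearEquiv.ofBijective (LinearMap.toSpanSingleton K _ P.one) hP.one
  constructor
  · rw [injective_iff_map_eq_zero]
    intro x hx
    have hx : ι A x ∈ L.decSpan A := (Submodule.Quotient.mk_eq_zero _).1 hx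
    rw [h.decSpan_eq hP, ← hcount, h.mem_blockFiltration_iff hP] at hx
    have h1 : ι A x = h.summand (blockMap ⊥)
        (M.map e.symm x ⊗ₜ PiTensorProduct.tprod K fun k => P.map (w k) P.one) := by
      rw [summand_tmul, he, ← h.naturality, ← M.map_trans, Equiv.symm_trans_self, M.map_refl]
    have h2 := hx ⊥ le_rfl
    rw [h1, partProj, proj_summand] at h2
    have h3 := eq_zero_of_tmul_tprod_eq_zero
      (fun k => c₀.symm.toLinearMap ∘ₗ (P.map (w k).symm).toFun) (fun k => by
        rw [LinearMap.comp_apply, ← P.map_trans, Equiv.self_trans_symm, P.map_refl]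
        exact c₀.symm_apply_eq.2 (one_smul K _).symm) h2
    rw [← M.map_refl x, ← Equiv.symm_trans_self e, M.map_trans, h3]
    exact map_zero _
  · intro z
    obtain ⟨z, rfl⟩ := Submodule.Quotient.mk_surjective _ z
    have hrange : ∀ t, h.summand (blockMap (⊥ : Setoid A)) t ∈ LinearMap.range (ι A) := by
      refine blockTensor_induction _ _ fun x q => ?_
      choose c hc using fun k => exists_eq_smul_map_one hP (w k) (q k)
      rw [show q = fun k => c k • P.map (w k) P.one from funext hc, MultilinearMap.map_smul_univ,
        TensorProduct.tmul_smul, map_smul, summand_tmul, he, ← h.naturality]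
      exact Submodule.smul_mem _ _ ⟨_, rfl⟩
    obtain ⟨x, hx⟩ := hrange (h.partProj ⊥ z)
    refine ⟨x, (Submodule.Quotient.eq (L.decSpan A)).2 ?_⟩
    have hsum := h.sum_summand_partProj hP z
    classical
    rw [← Finset.add_sum_erase _ _ (Finset.mem_univ (⊥ : Setoid A))] at hsum
    have hsub : ∀ {a b c : L.obj A}, a + b = c → a - c = -b := by
      rintro a b _ rfl; abel
    rw [hx, hsub hsum]
    refine Submodule.neg_mem _ (Submodule.sum_mem _ fun π hπ => ?_)
    rw [h.decSpan_eq hP]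
    refine h.summand_mem_blockFiltration (lt_of_le_of_ne (blockCount_le π) fun hc => ?_) _ _
    exact Finset.ne_of_mem_erase hπ ((blockCount_eq_card_iff π).1 hc)

/-- The generators are isomorphic to the indecomposables. -/
def indecomposablesEquiv (h : L.IsQuasiFreeOn M ι) (hP : P.IsConnected) (A : Type) [Finite A] :
    M.obj A ≃ₗ[K] L.indecomposables.obj A :=
  LinearEquiv.ofBijective _ (h.bijective_toIndecomposables hP A)

theorem indecomposablesEquiv_symm_δ (h : L.IsQuasiFreeOn M ι) (hP : P.IsConnected) (A : Type)
    [Finite A] (x : L.indecomposables.obj A) :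
    (h.indecomposablesEquiv hP A).symm ((L.indecomposables.obj A).δ x) =
      (M.obj A).δ ((h.indecomposablesEquiv hP A).symm x) := by
  obtain ⟨x, rfl⟩ := (h.indecomposablesEquiv hP A).surjective x
  rw [LinearEquiv.symm_apply_apply, LinearEquiv.symm_apply_eq]
  exact ((h.toIndecomposables A).map_δ x).symm

theorem indecomposablesEquiv_symm_τ (h : L.IsQuasiFreeOn M ι) (hP : P.IsConnected) (A : Type)
    [Finite A] (x : L.indecomposables.obj A) :
    (h.indecomposablesEquiv hP A).symm ((L.indecomposables.obj A).τ x) =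
      (M.obj A).τ ((h.indecomposablesEquiv hP A).symm x) := by
  obtain ⟨x, rfl⟩ := (h.indecomposablesEquiv hP A).surjective x
  rw [LinearEquiv.symm_apply_apply, LinearEquiv.symm_apply_eq]
  exact ((h.toIndecomposables A).map_τ x).symm

theorem exists_generator (h : L.IsQuasiFreeOn M ι) (hP : P.IsConnected)
    (hL : L.indecomposables.GroundRingInArityOne) :
    ∃ m ∈ (M.obj Unit).gr 0, Function.Bijective fun k : K => k • m := by
  obtain ⟨u, hu, hb⟩ := hL
  let α := h.indecomposablesEquiv hP Unit
  refine ⟨α.symm u, ?_, ?_⟩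
  · have h1 : (M.obj Unit).component 0 (α.symm u) = α.symm u := by
      apply α.injective
      have := (h.toIndecomposables Unit).map_component 0 (α.symm u)
      refine this.trans ?_
      have h2 : (h.toIndecomposables Unit) (α.symm u) = u := α.apply_symm_apply u
      rw [h2, DGModule.component_same _ _ _ hu]
      exact h2.symm
    rw [← h1]
    exact DGModule.component_mem _ _ _
  · have : (fun k : K => k • α.symm u) = α.symm ∘ fun k : K => k • u := by
      funext k; simp
    rw [this]
    exact α.symm.bijective.comp hb

/-! ## The operad in the second stage of the filtration -/

/-- The map `p ↦ ι(m)(p)` defined by a generator `m` of arity one. -/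
def arityOne (_ : L.IsQuasiFreeOn M ι) (m : M.obj Unit) (A : Type) [Finite A] :
    P.obj A →ₗ[K] L.obj A :=
  (L.map (unitGraft A)).toFun ∘ₗ L.comp () (ι Unit m)

/-- The composite of m with p is the composite along the constant map, with A as the only block.
This places the image of P(A) in the part r = 1. -/
theorem arityOne_eq (h : L.IsQuasiFreeOn M ι) (m : M.obj Unit) {A : Type} [Finite A]
    (f : A → Fin 1) (w : ∀ k, A ≃ Block f k) (hw : ∀ k a, (w k a).1 = a) (p : P.obj A) :
    h.arityOne m A p =
      L.composite f (ι (Fin 1) (M.map (Equiv.ofUnique Unit (Fin 1)) m)) fun k => P.map (w k) p := by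
  let U : Unit ≃ Stage f 0 := (Equiv.ofUnique Unit (Fin 1)).trans (stageZero f)
  let i : Stage f 0 := Sum.inr ⟨⟨0, Nat.one_pos⟩, le_rfl⟩
  obtain ⟨G, hG, key⟩ : ∃ G : Graft () A ≃ Graft i (Block f ⟨0, Nat.one_pos⟩),
      (∀ a, G (Sum.inr a) = Sum.inr (w ⟨0, Nat.one_pos⟩ a)) ∧
      L.comp i (L.map (stageZero f) (L.map (Equiv.ofUnique Unit (Fin 1)) (ι Unit m)))
        (P.map (w ⟨0, Nat.one_pos⟩) p) = L.map G (L.comp () (ι Unit m) p) := by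
    refine ⟨graftCongr U (w ⟨0, Nat.one_pos⟩) (), fun a => rfl, ?_⟩
    rw [← L.map_trans]
    exact (L.map_comp_eq U (w ⟨0, Nat.one_pos⟩) rfl _ (fun a => (a.2 rfl).elim) (fun b => rfl)
      _ p).symm
  rw [composite, partialComposite, partialComposite, h.naturality]
  refine Eq.trans ?_ (congrArg (fun z => (L.map (stageEnd f)).toFun
    ((L.map (stageSucc f 0 Nat.one_pos)).toFun z)) key.symm)
  rw [← L.map_trans, ← L.map_trans]
  refine congrArg (fun e => L.map e (L.comp () (ι Unit m) p)) (Equiv.ext ?_)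
  rintro (a | a)
  · exact (a.2 rfl).elim
  · rw [Equiv.trans_apply, Equiv.trans_apply, hG]
    exact (hw _ a).symm

/-- In degree 0 the generator is a cycle of L and creates no sign, so p ↦ ι(m)(p) is a chain map
despite the twist. -/
theorem δ_arityOne (h : L.IsQuasiFreeOn M ι) {m : M.obj Unit} (hm : m ∈ (M.obj Unit).gr 0)
    {A : Type} [Finite A] (p : P.obj A) :
    (L.obj A).δ (h.arityOne m A p) = h.arityOne m A ((P.obj A).δ p) := by
  have h0 := h.map_gr Unit 0 m hm
  refine ((L.map (unitGraft A)).map_δ _).symm.trans (congrArg (L.map (unitGraft A)).toFun ?_)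
  rw [L.δ_comp () 0 _ p h0, DGModule.δ_zero _ _ h0]
  simp

theorem arityOne_mem (h : L.IsQuasiFreeOn M ι) (m : M.obj Unit) {A : Type} [Finite A]
    (p : P.obj A) : h.arityOne m A p ∈ L.blockFiltration ι 2 A := by
  rw [h.arityOne_eq m (fun _ => 0) (fun k => (Equiv.subtypeUnivEquiv
    fun _ => Subsingleton.elim _ _).symm) fun k a => rfl]
  exact L.composite_mem_blockFiltration ι one_lt_two _ _ _

theorem injective_arityOne (h : L.IsQuasiFreeOn M ι) {m : M.obj Unit}
    (hm : Function.Bijective fun k : K => k • m) {A : Type} [Finite A] [Nonempty A] :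
    Function.Injective (h.arityOne m A) := by
  rw [injective_iff_map_eq_zero]
  intro p hp
  let f : A → Fin 1 := fun _ => 0
  have hf : Function.Surjective f := fun k => ⟨Classical.arbitrary A, Subsingleton.elim _ _⟩
  let w : ∀ k, A ≃ Block f k := fun k =>
    (Equiv.subtypeUnivEquiv fun _ => Subsingleton.elim _ _).symm
  rw [h.arityOne_eq m f w fun k a => rfl, ← h.summand_tmul] at hp
  have h1 := congrArg (h.proj f hf) hp
  rw [proj_summand, map_zero] at h1
  let c : K ≃ₗ[K] M.obj Unit := LinearEquiv.ofBijective (LinearMap.toSpanSingleton K _ m) hm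
  have hc : c.symm m = 1 := c.symm_apply_eq.2 (one_smul K _).symm
  have h2 := congrArg ((TensorProduct.lid K _).toLinearMap ∘ₗ TensorProduct.map
    (c.symm.toLinearMap ∘ₗ (M.map (Equiv.ofUnique (Fin 1) Unit)).toFun)
    (PiTensorProduct.subsingletonEquiv (R := K) (s := fun k => P.obj (Block f k)) 0).toLinearMap) h1
  rw [map_zero, LinearMap.comp_apply, TensorProduct.map_tmul, LinearMap.comp_apply,
    ← M.map_trans] at h2
  have h3 : M.map ((Equiv.ofUnique Unit (Fin 1)).trans (Equiv.ofUnique (Fin 1) Unit)) m = m :=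
    M.map_refl m
  have h4 : P.map (w 0) p = 0 := by
    simpa [h3, hc] using h2
  rw [← P.map_refl p, ← Equiv.self_trans_symm (w 0), P.map_trans, h4]
  exact map_zero _

/-- For A nonempty there is no map to the empty set, so r = 0 contributes nothing and r = 1
contributes composites of multiples of m. With `injective_arityOne`, the second stage of the
filtration is a copy of the complex P(A). -/
theorem blockFiltration_two_le (h : L.IsQuasiFreeOn M ι) {m : M.obj Unit}
    (hm : Function.Bijective fun k : K => k • m) {A : Type} [Finite A] [Nonempty A] :
    L.blockFiltration ι 2 A ≤ LinearMap.range (h.arityOne m A) := by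
  refine Submodule.span_le.2 ?_
  rintro _ ⟨r, hr, f, x, q, rfl⟩
  obtain rfl | rfl : r = 0 ∨ r = 1 := by omega
  · exact (f (Classical.arbitrary A)).elim0
  let w : ∀ k, A ≃ Block f k := fun k =>
    (Equiv.subtypeUnivEquiv fun _ => Subsingleton.elim _ _).symm
  obtain ⟨c, hc⟩ := hm.2 (M.map (Equiv.ofUnique (Fin 1) Unit) x)
  have hx : x = c • M.map (Equiv.ofUnique Unit (Fin 1)) m := by
    have := congrArg (M.map (Equiv.ofUnique Unit (Fin 1))).toFun hc
    rw [← M.map_trans, map_smul] at this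
    rw [this]
    refine (M.map_refl x).symm.trans (congrArg (fun e => M.map e x) ?_)
    exact Equiv.ext fun _ => Subsingleton.elim _ _
  have hq : q = fun k => P.map (w k) (P.map (w 0).symm (q 0)) := by
    funext k
    obtain rfl : k = 0 := Subsingleton.elim _ _
    rw [← P.map_trans, Equiv.symm_trans_self, P.map_refl]
  refine ⟨c • P.map (w 0).symm (q 0), ?_⟩
  rw [map_smul, h.arityOne_eq m f w (fun k a => rfl), ← hq, hx, map_smul,
    ← compositeLinear_apply, ← compositeLinear_apply, map_smul]

end IsQuasiFreeOn
end RightModule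

namespace RightModule

variable {K : Type u} [CommRing K] {P P' : DGOperad.{u, v} K} {ψ : P.Hom P'}
  {L : RightModule P} {L' : RightModule P'}

/-! ## Comparison of quasi-free modules -/

/-- A morphism of right modules, as a family of linear maps. -/
def Hom.linear (φ : L.Hom (L'.restrict ψ)) (A : Type) [Finite A] : L.obj A →ₗ[K] L'.obj A :=
  (φ.app A).toFun

theorem Hom.linear_δ (φ : L.Hom (L'.restrict ψ)) (A : Type) [Finite A] (x : L.obj A) :
    φ.linear A ((L.obj A).δ x) = (L'.obj A).δ (φ.linear A x) := (φ.app A).map_δ x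

/-- The differential of the mapping cone of a morphism of right modules. -/
abbrev Hom.coneδ (φ : L.Hom (L'.restrict ψ)) (A : Type) [Finite A] :
    L'.obj A × L.obj A →ₗ[K] L'.obj A × L.obj A :=
  coneDiff (L.obj A).δ (L'.obj A).δ (φ.linear A)

theorem Hom.coneδ_coneδ (φ : L.Hom (L'.restrict ψ)) (A : Type) [Finite A]
    (x : L'.obj A × L.obj A) : φ.coneδ A (φ.coneδ A x) = 0 :=
  coneDiff_coneDiff (L.obj A).δ_δ (L'.obj A).δ_δ (φ.linear_δ A) x

theorem Hom.quasiIso_iff (φ : L.Hom (L'.restrict ψ)) (A : Type) [Finite A] :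
    (φ.app A).QuasiIso ↔ RelAcyclic (φ.coneδ A) ⊥ ⊤ :=
  (φ.app A).quasiIso_iff

/-- If the mapping cone is acyclic modulo decomposables, then the morphism of indecomposable
quotients is a quasi-isomorphism. -/
theorem Hom.quasiIso_indecomposables (φ : L.Hom (L'.restrict ψ)) (A : Type) [Finite A]
    (h : RelAcyclic (φ.coneδ A) ((L'.decSpan A).prod (L.decSpan A)) ⊤) :
    (φ.indecomposables.app A).QuasiIso := by
  rw [DGModule.Hom.quasiIso_iff, coneAcyclic_iff]
  intro w v h1 h2
  obtain ⟨w, rfl⟩ := Submodule.Quotient.mk_surjective _ w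
  obtain ⟨v, rfl⟩ := Submodule.Quotient.mk_surjective _ v
  have h1 : (L'.obj A).δ w + φ.linear A v ∈ L'.decSpan A :=
    (Submodule.Quotient.mk_eq_zero _).1 h1
  have h2 : (L.obj A).δ v ∈ L.decSpan A := (Submodule.Quotient.mk_eq_zero _).1 h2
  obtain ⟨⟨y, z⟩, -, h3, h4⟩ := h (w, v) trivial ⟨h1, Submodule.neg_mem _ h2⟩
  exact ⟨Submodule.Quotient.mk y, Submodule.Quotient.mk z,
    ((Submodule.Quotient.eq (L'.decSpan A)).2 h3).symm,
    ((Submodule.Quotient.eq (L.decSpan A)).2 h4).symm⟩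

namespace IsQuasiFreeOn

variable {M M' : SigmaModule.{u, v} K}
  {ι : ∀ (I : Type) [Finite I], M.obj I →ₗ[K] L.obj I}
  {ι' : ∀ (I : Type) [Finite I], M'.obj I →ₗ[K] L'.obj I}

/-- The map on generators induced by a morphism of quasi-free modules. -/
def genMap (h : L.IsQuasiFreeOn M ι) (h' : L'.IsQuasiFreeOn M' ι') (hP' : P'.IsConnected)
    (φ : L.Hom (L'.restrict ψ)) (A : Type) [Finite A] : M.obj A →ₗ[K] M'.obj A :=
  (h'.indecomposablesEquiv hP' A).symm.toLinearMap ∘ₗ (φ.indecomposables.app A).toFun ∘ₗ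
    (h.toIndecomposables A).toFun

theorem linear_sub_genMap_mem (h : L.IsQuasiFreeOn M ι) (h' : L'.IsQuasiFreeOn M' ι')
    (hP' : P'.IsConnected) (φ : L.Hom (L'.restrict ψ)) (A : Type) [Finite A] (x : M.obj A) :
    φ.linear A (ι A x) - ι' A (h.genMap h' hP' φ A x) ∈ L'.decSpan A :=
  (Submodule.Quotient.eq (L'.decSpan A)).1 ((h'.indecomposablesEquiv hP' A).apply_symm_apply
    (φ.indecomposables.app A (h.toIndecomposables A x))).symm

/-- The map on summands induced by a morphism of quasi-free modules. -/
def blockTensorMap (h : L.IsQuasiFreeOn M ι) (h' : L'.IsQuasiFreeOn M' ι') (hP' : P'.IsConnected)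
    (φ : L.Hom (L'.restrict ψ)) {I : Type} [Finite I] {r : ℕ} (f : I → Fin r) :
    BlockTensor M P.toSigmaModule f →ₗ[K] BlockTensor M' P'.toSigmaModule f :=
  TensorProduct.map (h.genMap h' hP' φ (Fin r))
    (PiTensorProduct.map fun k => (ψ.app (Block f k)).toFun)

/-- A morphism commutes with composites, and on generators of arity r it agrees with the map induced
on indecomposables up to decomposables, which lie in stage r of the filtration. -/
theorem linear_summand_sub_mem (h : L.IsQuasiFreeOn M ι) (h' : L'.IsQuasiFreeOn M' ι')
    (hP' : P'.IsConnected) (φ : L.Hom (L'.restrict ψ)) {I : Type} [Finite I] {r : ℕ}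
    (f : I → Fin r) (t : BlockTensor M P.toSigmaModule f) :
    φ.linear I (h.summand f t) - h'.summand f (h.blockTensorMap h' hP' φ f t) ∈
      L'.blockFiltration ι' r I := by
  refine blockTensor_induction (φ.linear I ∘ₗ h.summand f -
    h'.summand f ∘ₗ h.blockTensorMap h' hP' φ f) _ (fun x q => ?_) t
  have hx := h.linear_sub_genMap_mem h' hP' φ (Fin r) x
  rw [h'.decSpan_eq hP', Nat.card_fin] at hx
  rw [LinearMap.sub_apply, LinearMap.comp_apply, LinearMap.comp_apply, summand_tmul,
    blockTensorMap, TensorProduct.map_tmul, PiTensorProduct.map_tprod, summand_tmul]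
  rw [show φ.linear I (L.composite f (ι (Fin r) x) q) =
    L'.composite f (φ.linear (Fin r) (ι (Fin r) x)) fun k => ψ.app (Block f k) (q k) from
    Hom.map_composite f φ _ q, ← compositeLinear_apply, ← compositeLinear_apply, ← map_sub]
  exact L'.composite_mem_blockFiltration_of_mem ι' f hx _

theorem linear_mem_blockFiltration (h : L.IsQuasiFreeOn M ι) (h' : L'.IsQuasiFreeOn M' ι')
    (hP' : P'.IsConnected) (φ : L.Hom (L'.restrict ψ)) {I : Type} [Finite I] {s : ℕ} {z : L.obj I}
    (hz : z ∈ L.blockFiltration ι s I) : φ.linear I z ∈ L'.blockFiltration ι' s I := by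
  have : L.blockFiltration ι s I ≤ (L'.blockFiltration ι' s I).comap (φ.linear I) := by
    refine Submodule.span_le.2 ?_
    rintro _ ⟨r, hr, f, x, q, rfl⟩
    rw [← h.summand_tmul]
    have h1 := L'.blockFiltration_mono ι' I hr.le (h.linear_summand_sub_mem h' hP' φ f
      (x ⊗ₜ PiTensorProduct.tprod K q))
    have h2 := Submodule.add_mem _ h1 (h'.summand_mem_blockFiltration hr f
      (h.blockTensorMap h' hP' φ f (x ⊗ₜ PiTensorProduct.tprod K q)))
    rwa [sub_add_cancel] at h2
  exact this hz

theorem partProj_linear (h : L.IsQuasiFreeOn M ι) (h' : L'.IsQuasiFreeOn M' ι')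
    (hP : P.IsConnected) (hP' : P'.IsConnected) (φ : L.Hom (L'.restrict ψ)) {I : Type} [Finite I]
    {z : L.obj I} {π : Setoid I} (hz : z ∈ L.blockFiltration ι (blockCount π + 1) I) :
    h'.partProj π (φ.linear I z) = h.blockTensorMap h' hP' φ (blockMap π) (h.partProj π z) := by
  have hlow : ∀ {y}, y ∈ L'.blockFiltration ι' (blockCount π) I → h'.partProj π y = 0 := fun hy =>
    (h'.mem_blockFiltration_iff hP').1 hy π le_rfl
  have key : ∀ (π' : Setoid I) (t : BlockTensor M P.toSigmaModule (blockMap π')),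
      blockCount π' ≤ blockCount π →
      h'.partProj π (φ.linear I (h.summand (blockMap π') t)) =
        h'.partProj π (h'.summand (blockMap π') (h.blockTensorMap h' hP' φ (blockMap π') t)) := by
    intro π' t hπ'
    rw [← sub_eq_zero, ← map_sub]
    exact hlow (L'.blockFiltration_mono ι' I hπ' (h.linear_summand_sub_mem h' hP' φ _ t))
  conv_lhs => rw [← h.sum_summand_partProj hP z]
  rw [map_sum, map_sum, Finset.sum_eq_single π]
  · rw [key π _ le_rfl]
    exact h'.proj_summand _ _
  · intro π' _ hπ'
    by_cases hc : blockCount π' ≤ blockCount π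
    · rw [key π' _ hc, h'.partProj_summand_of_ne hπ'.symm]
    · rw [(h.mem_blockFiltration_iff hP).1 hz π' (by omega), map_zero, map_zero, map_zero]
  · simp

/-- The filtration of the mapping cone. -/
abbrev coneFiltration (_ : L.IsQuasiFreeOn M ι) (_ : L'.IsQuasiFreeOn M' ι') (A : Type)
    [Finite A] (s : ℕ) : Submodule K (L'.obj A × L.obj A) :=
  (L'.blockFiltration ι' s A).prod (L.blockFiltration ι s A)

theorem coneFiltration_mono (h : L.IsQuasiFreeOn M ι) (h' : L'.IsQuasiFreeOn M' ι') (A : Type)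
    [Finite A] : Monotone (h.coneFiltration h' A) := fun _ _ hst =>
  Submodule.prod_mono (L'.blockFiltration_mono ι' A hst) (L.blockFiltration_mono ι A hst)

theorem coneFiltration_zero (h : L.IsQuasiFreeOn M ι) (h' : L'.IsQuasiFreeOn M' ι') (A : Type)
    [Finite A] : h.coneFiltration h' A 0 = ⊥ := by
  rw [coneFiltration, blockFiltration_zero, blockFiltration_zero, Submodule.prod_bot]

theorem coneFiltration_eq_top (h : L.IsQuasiFreeOn M ι) (h' : L'.IsQuasiFreeOn M' ι')
    (hP : P.IsConnected) (hP' : P'.IsConnected) (A : Type) [Finite A] :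
    h.coneFiltration h' A (Nat.card A + 1) = ⊤ := by
  rw [coneFiltration, h.blockFiltration_eq_top hP (Nat.lt_succ_self _),
    h'.blockFiltration_eq_top hP' (Nat.lt_succ_self _), Submodule.prod_top]

/-- A graded piece of the mapping cone is acyclic if this holds for the summands. -/
theorem relAcyclic_coneFiltration (h : L.IsQuasiFreeOn M ι) (h' : L'.IsQuasiFreeOn M' ι')
    (hP : P.IsConnected) (hP' : P'.IsConnected) (φ : L.Hom (L'.restrict ψ)) (A : Type) [Finite A]
    (s : ℕ) (hs : ∀ π : Setoid A, blockCount π = s →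
      ConeAcyclic (blockDiff M P.toSigmaModule (blockMap π))
        (blockDiff M' P'.toSigmaModule (blockMap π)) (h.blockTensorMap h' hP' φ (blockMap π))) :
    RelAcyclic (φ.coneδ A) (h.coneFiltration h' A s) (h.coneFiltration h' A (s + 1)) := by
  rintro ⟨w, v⟩ ⟨hw, hv⟩ ⟨h1, h2⟩
  change w ∈ L'.blockFiltration ι' (s + 1) A at hw
  change v ∈ L.blockFiltration ι (s + 1) A at hv
  change (L'.obj A).δ w + φ.linear A v ∈ L'.blockFiltration ι' s A at h1
  change -(L.obj A).δ v ∈ L.blockFiltration ι s A at h2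
  -- The equation is solved separately in each summand with exactly s classes; elsewhere the values
  -- are never used.
  have hex : ∀ π : Setoid A, ∃ (y : BlockTensor M' P'.toSigmaModule (blockMap π))
      (z : BlockTensor M P.toSigmaModule (blockMap π)), blockCount π = s →
      blockDiff M' P'.toSigmaModule (blockMap π) y + h.blockTensorMap h' hP' φ (blockMap π) z =
        h'.partProj π w ∧ -blockDiff M P.toSigmaModule (blockMap π) z = h.partProj π v := by
    intro π
    by_cases hπ : blockCount π = s
    · obtain ⟨y, z, hyz⟩ := coneAcyclic_iff.1 (hs π hπ) (h'.partProj π w) (h.partProj π v) (by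
        rw [← h'.partProj_δ hP' (by rwa [hπ]), ← h.partProj_linear h' hP hP' φ (by rwa [hπ]),
          ← map_add]
        exact (h'.mem_blockFiltration_iff hP').1 h1 π hπ.ge) (by
        rw [← h.partProj_δ hP (by rwa [hπ]), ← neg_eq_zero, ← map_neg]
        exact (h.mem_blockFiltration_iff hP).1 h2 π hπ.ge)
      exact ⟨y, z, fun _ => hyz⟩
    · exact ⟨0, 0, fun hc => (hπ hc).elim⟩
  choose y z hyz using hex
  classical
  let Y := ∑ π : Setoid A, if blockCount π = s then h'.summand (blockMap π) (y π) else 0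
  let Z := ∑ π : Setoid A, if blockCount π = s then h.summand (blockMap π) (z π) else 0
  have hY : Y ∈ L'.blockFiltration ι' (s + 1) A := Submodule.sum_mem _ fun π _ => by
    split_ifs with hπ
    · exact h'.summand_mem_blockFiltration (by omega) _ _
    · exact Submodule.zero_mem _
  have hZ : Z ∈ L.blockFiltration ι (s + 1) A := Submodule.sum_mem _ fun π _ => by
    split_ifs with hπ
    · exact h.summand_mem_blockFiltration (by omega) _ _
    · exact Submodule.zero_mem _
  have hYπ : ∀ π, blockCount π = s → h'.partProj π Y = y π := fun π hπ => by
    rw [map_sum, Finset.sum_eq_single π]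
    · rw [if_pos hπ]; exact h'.proj_summand _ _
    · intro π' _ hne
      split_ifs
      · exact h'.partProj_summand_of_ne hne.symm _
      · exact map_zero _
    · simp
  have hZπ : ∀ π, blockCount π = s → h.partProj π Z = z π := fun π hπ => by
    rw [map_sum, Finset.sum_eq_single π]
    · rw [if_pos hπ]; exact h.proj_summand _ _
    · intro π' _ hne
      split_ifs
      · exact h.partProj_summand_of_ne hne.symm _
      · exact map_zero _
    · simp
  have hw' : w - ((L'.obj A).δ Y + φ.linear A Z) ∈ L'.blockFiltration ι' (s + 1) A :=
    Submodule.sub_mem _ hw (Submodule.add_mem _ (h'.δ_mem_blockFiltration hP' hY)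
      (h.linear_mem_blockFiltration h' hP' φ hZ))
  have hv' : v - -(L.obj A).δ Z ∈ L.blockFiltration ι (s + 1) A :=
    Submodule.sub_mem _ hv (Submodule.neg_mem _ (h.δ_mem_blockFiltration hP hZ))
  -- Components with s classes vanish by the choice of Y and Z; those with more vanish because
  -- everything stays in stage s + 1.
  refine ⟨(Y, Z), ⟨hY, hZ⟩, (h'.mem_blockFiltration_iff hP').2 fun π hπ => ?_,
    (h.mem_blockFiltration_iff hP).2 fun π hπ => ?_⟩
  · change h'.partProj π (w - ((L'.obj A).δ Y + φ.linear A Z)) = 0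
    rcases hπ.eq_or_lt with hπ | hπ
    · rw [map_sub, map_add, h'.partProj_δ hP' (by rwa [← hπ]),
        h.partProj_linear h' hP hP' φ (by rwa [← hπ]), hYπ π hπ.symm, hZπ π hπ.symm,
        (hyz π hπ.symm).1, sub_self]
    · exact (h'.mem_blockFiltration_iff hP').1 hw' π hπ
  · change h.partProj π (v - -(L.obj A).δ Z) = 0
    rcases hπ.eq_or_lt with hπ | hπ
    · rw [map_sub, map_neg, h.partProj_δ hP (by rwa [← hπ]), hZπ π hπ.symm,
        (hyz π hπ.symm).2, sub_self]
    · exact (h.mem_blockFiltration_iff hP).1 hv' π hπ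

/-- The summands of the mapping cone are acyclic if the components are quasi-isomorphisms between
complexes of projective modules. -/
theorem coneAcyclic_blockTensorMap (h : L.IsQuasiFreeOn M ι) (h' : L'.IsQuasiFreeOn M' ι')
    (hP : P.IsConnected) (hP' : P'.IsConnected) (φ : L.Hom (L'.restrict ψ))
    (pP : P.IsKProjective) (pP' : P'.IsKProjective)
    (pL : L.indecomposables.IsKProjective) (pL' : L'.indecomposables.IsKProjective)
    {A : Type} [Finite A] {r : ℕ} (f : A → Fin r)
    (hφ : (φ.indecomposables.app (Fin r)).QuasiIso) (hψ : ∀ k, (ψ.app (Block f k)).QuasiIso) :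
    ConeAcyclic (blockDiff M P.toSigmaModule f) (blockDiff M' P'.toSigmaModule f)
      (h.blockTensorMap h' hP' φ f) := by
  -- Projectivity is known for the indecomposable quotients; the homotopy equivalence found there is
  -- transported to the generators.
  have h1 := (hφ.isHomotopyEquiv (pL _) (pL' _)).transport (k := h.genMap h' hP' φ (Fin r))
    (h.indecomposablesEquiv hP _).symm (h'.indecomposablesEquiv hP' _).symm
    (h.indecomposablesEquiv_symm_δ hP _) (h.indecomposablesEquiv_symm_τ hP _)
    (h'.indecomposablesEquiv_symm_δ hP' _) (h'.indecomposablesEquiv_symm_τ hP' _) (fun x =>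
      congrArg (fun x => (h'.indecomposablesEquiv hP' _).symm (φ.indecomposables.app (Fin r) x))
        ((h.indecomposablesEquiv hP _).apply_symm_apply x))
  exact (h1.tensor (DGModule.τ_mul_τ _) (DGModule.δ_mul_τ _) (DGModule.τ_mul_τ _)
    (DGModule.δ_mul_τ _) (IsHomotopyEquiv.piTensor (fun _ => DGModule.τ_mul_τ _)
    (fun _ => DGModule.δ_mul_τ _) (fun _ => DGModule.τ_mul_τ _) (fun _ => DGModule.δ_mul_τ _)
    fun k => (hψ k).isHomotopyEquiv (pP _) (pP' _))).coneAcyclic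

/-- A morphism of quasi-free modules on generators with value `K` in arity one detects
quasi-isomorphisms of operads. -/
theorem quasiIso_of_relAcyclic (h : L.IsQuasiFreeOn M ι) (h' : L'.IsQuasiFreeOn M' ι')
    (hP : P.IsConnected) (hP' : P'.IsConnected) (φ : L.Hom (L'.restrict ψ))
    (hL : L.indecomposables.GroundRingInArityOne) (hL' : L'.indecomposables.GroundRingInArityOne)
    (hφ : (φ.indecomposables.app Unit).QuasiIso) (A : Type) [Finite A] [Nonempty A]
    (hA : RelAcyclic (φ.coneδ A) ⊥ (h.coneFiltration h' A 2)) : (ψ.app A).QuasiIso := by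
  obtain ⟨m, hm, hb⟩ := h.exists_generator hP hL
  obtain ⟨m', hm', hb'⟩ := h'.exists_generator hP' hL'
  obtain ⟨c, hc⟩ := hb'.2 (h.genMap h' hP' φ Unit m)
  have hφm : φ.linear Unit (ι Unit m) = c • ι' Unit m' := by
    have h1 := h.linear_sub_genMap_mem h' hP' φ Unit m
    rw [h'.decSpan_eq hP', show Nat.card Unit = 1 from Nat.card_unique,
      L'.blockFiltration_one_eq_bot, Submodule.mem_bot, sub_eq_zero] at h1
    rw [h1, ← hc, map_smul]
  -- The differential of L̄'(1) vanishes, so surjectivity in homology is surjectivity. The generator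
  -- m' is thus hit, which makes c invertible.
  obtain ⟨k, hk⟩ : ∃ k : K, k * c = 1 := by
    have hδ : ∀ x, (L'.indecomposables.obj Unit).δ x = 0 := by
      obtain ⟨u, hu, hu'⟩ := hL'
      intro x
      obtain ⟨k, rfl⟩ := hu'.2 x
      exact (map_smul _ _ _).trans (by rw [DGModule.δ_zero _ _ hu, smul_zero])
    rw [DGModule.Hom.quasiIso_iff, coneAcyclic_iff_inj_surj (DGModule.Hom.map_δ _)] at hφ
    obtain ⟨x, -, y, hy⟩ := hφ.2 (h'.indecomposablesEquiv hP' Unit m') (hδ _)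
    rw [hδ, eq_comm, sub_eq_zero] at hy
    obtain ⟨n, rfl⟩ := (h.indecomposablesEquiv hP Unit).surjective x
    obtain ⟨k, rfl⟩ := hb.2 n
    have h1 : h.genMap h' hP' φ Unit (k • m) = m' := (LinearEquiv.symm_apply_eq _).2 hy
    refine ⟨k, hb'.1 ?_⟩
    change (k * c) • m' = (1 : K) • m'
    rw [mul_smul, one_smul]
    refine Eq.trans ?_ h1
    rw [map_smul, ← hc]
  have hφ1 : ∀ p, φ.linear A (h.arityOne m A p) = c • h'.arityOne m' A (ψ.app A p) := by
    intro p
    have h1 : φ.linear A (h.arityOne m A p) = L'.map (unitGraft A)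
        (L'.comp () (φ.linear Unit (ι Unit m)) (ψ.app A p)) :=
      (φ.naturality _ _).trans (congrArg (L'.map (unitGraft A)).toFun (φ.map_comp _ _ _))
    rw [h1, hφm, map_smul, LinearMap.smul_apply, map_smul]; rfl
  rw [DGModule.Hom.quasiIso_iff, coneAcyclic_iff]
  intro w v h1 h2
  -- On the copies of P(A) and P'(A) the map φ is c ψ, so w is rescaled by c to turn a cycle of the
  -- cone of ψ into a cycle of the cone of φ.
  obtain ⟨⟨Y, Z⟩, ⟨hY, hZ⟩, hYZ⟩ := hA (c • h'.arityOne m' A w, h.arityOne m A v)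
    ⟨Submodule.smul_mem _ _ (h'.arityOne_mem m' w), h.arityOne_mem m v⟩ (by
      refine (Submodule.mem_bot K).2 (Prod.ext ?_ ?_)
      · change (L'.obj A).δ (c • h'.arityOne m' A w) + φ.linear A (h.arityOne m A v) = 0
        rw [map_smul, h'.δ_arityOne hm', hφ1, ← smul_add, ← map_add, h1, map_zero, smul_zero]
      · change -(L.obj A).δ (h.arityOne m A v) = 0
        rw [h.δ_arityOne hm, h2, map_zero, neg_zero])
  obtain ⟨y, rfl⟩ := h'.blockFiltration_two_le hb' hY
  obtain ⟨z, rfl⟩ := h.blockFiltration_two_le hb hZ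
  have h3 : c • h'.arityOne m' A w - ((L'.obj A).δ (h'.arityOne m' A y) +
      φ.linear A (h.arityOne m A z)) = 0 := congrArg Prod.fst ((Submodule.mem_bot K).1 hYZ)
  have h4 : h.arityOne m A v - -(L.obj A).δ (h.arityOne m A z) = 0 :=
    congrArg Prod.snd ((Submodule.mem_bot K).1 hYZ)
  rw [h'.δ_arityOne hm', hφ1, ← map_smul, ← map_smul, ← map_add, ← map_sub] at h3
  rw [h.δ_arityOne hm, ← map_neg, ← map_sub] at h4
  have h3 := (injective_iff_map_eq_zero _).1 (h'.injective_arityOne hb') _ h3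
  have h4 := (injective_iff_map_eq_zero _).1 (h.injective_arityOne hb) _ h4
  -- Dividing by c undoes the rescaling of w, and only y has to be changed.
  refine ⟨k • y, z, ?_, (sub_eq_zero.1 h4).symm⟩
  have h5 := congrArg (k • ·) (sub_eq_zero.1 h3)
  simp only [smul_add, smul_smul, hk, one_smul] at h5
  rw [map_smul]
  exact h5.symm

end IsQuasiFreeOn
end RightModule

/-! ### Proof of the comparison theorem -/

theorem projective_of_isField {K : Type u} [CommRing K] (hK : IsField K) (V : Type v)
    [AddCommGroup V] [Module K V] : Module.Projective K V := by
  let := hK.toField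
  exact Module.Projective.of_free

theorem DGModule.Hom.quasiIso_of_subsingleton {K : Type u} [CommRing K] {V W : DGModule.{u, v} K}
    [Subsingleton V] [Subsingleton W] (f : V.Hom W) : f.QuasiIso := by
  rw [DGModule.Hom.quasiIso_iff, coneAcyclic_iff]
  exact fun w v _ _ => ⟨0, 0, Subsingleton.elim _ _, Subsingleton.elim _ _⟩

end OperadComparison

end

open OperadComparison in
theorem mainTheorem6 {K : Type u} [CommRing K]
    (P P' : DGOperad.{u, v} K) (hP : P.IsConnected) (hP' : P'.IsConnected)
    (ψ : P.Hom P')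
    (L : RightModule P) (L' : RightModule P')
    (hL : L.IsQuasiFree) (hL' : L'.IsQuasiFree)
    (φ : L.Hom (L'.restrict ψ))
    (hproj : ¬ IsField K →
      P.IsKProjective ∧ P'.IsKProjective ∧
        L.indecomposables.IsKProjective ∧ L'.indecomposables.IsKProjective) :
    (ψ.QuasiIso → φ.indecomposables.QuasiIso → φ.QuasiIso) ∧
    (ψ.QuasiIso → φ.QuasiIso → φ.indecomposables.QuasiIso) ∧
    (L.indecomposables.ZeroInArityZero → L'.indecomposables.ZeroInArityZero →
      L.indecomposables.GroundRingInArityOne → L'.indecomposables.GroundRingInArityOne →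
      φ.QuasiIso → φ.indecomposables.QuasiIso → ψ.QuasiIso) := by
  obtain ⟨M, ι, h⟩ := hL
  obtain ⟨M', ι', h'⟩ := hL'
  obtain ⟨pP, pP', pL, pL'⟩ : P.IsKProjective ∧ P'.IsKProjective ∧
      L.indecomposables.IsKProjective ∧ L'.indecomposables.IsKProjective := by
    by_cases hK : IsField K
    · exact ⟨fun _ _ => projective_of_isField hK _, fun _ _ => projective_of_isField hK _,
        fun _ _ => projective_of_isField hK _, fun _ _ => projective_of_isField hK _⟩
    · exact hproj hK
  -- Step s involves φ̄ in arity s only, and ψ on the blocks of surjections onto s elements only;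
  -- the inductions for (b) and (c) rest on this.
  have hstep : ∀ (A : Type) [Finite A] (s : ℕ), (φ.indecomposables.app (Fin s)).QuasiIso →
      (∀ (f : A → Fin s), Function.Surjective f → ∀ k, (ψ.app (Block f k)).QuasiIso) →
      RelAcyclic (φ.coneδ A) (h.coneFiltration h' A s) (h.coneFiltration h' A (s + 1)) := by
    intro A _ s hφ hψ
    refine h.relAcyclic_coneFiltration h' hP hP' φ A s ?_
    rintro π rfl
    exact h.coneAcyclic_blockTensorMap h' hP hP' φ pP pP' pL pL' _ hφ
      (hψ _ (blockMap_surjective π))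
  refine ⟨fun hψ hφ A _ => ?_, fun hψ hφ => ?_, fun _ _ hL hL' hφ hφ' => ?_⟩
  · rw [RightModule.Hom.quasiIso_iff, ← h.coneFiltration_zero h' A,
      ← h.coneFiltration_eq_top h' hP hP' A]
    exact RelAcyclic.of_steps (φ.coneδ_coneδ A) _ (h.coneFiltration_mono h' A) (Nat.zero_le _)
      fun s _ _ => hstep A s (hφ _) fun f _ k => hψ _
  · have key : ∀ (n : ℕ) (A : Type) [Finite A], Nat.card A = n →
        (φ.indecomposables.app A).QuasiIso := by
      intro n
      induction n using Nat.strong_induction_on with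
      | _ n ih =>
        rintro A _ rfl
        refine φ.quasiIso_indecomposables A ?_
        rw [h.decSpan_eq hP, h'.decSpan_eq hP']
        have h1 := RelAcyclic.of_steps (φ.coneδ_coneδ A) _ (h.coneFiltration_mono h' A)
          (Nat.zero_le (Nat.card A)) fun s _ hs =>
            hstep A s (ih s hs (Fin s) (Nat.card_fin s)) fun f _ k => hψ _
        rw [h.coneFiltration_zero h' A] at h1
        -- Stage |A| of the cone is acyclic by induction and the whole cone by hypothesis; their
        -- quotient is the cone modulo decomposables.
        exact RelAcyclic.right (φ.coneδ_coneδ A) bot_le le_top h1 ((φ.quasiIso_iff A).1 (hφ A))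
    exact fun A _ => key _ A rfl
  · have key : ∀ (n : ℕ) (A : Type) [Finite A], Nat.card A = n → (ψ.app A).QuasiIso := by
      intro n
      induction n using Nat.strong_induction_on with
      | _ n ih =>
        rintro A _ rfl
        rcases isEmpty_or_nonempty A with hA | hA
        · have := RightModule.subsingleton_of_isEmpty hP (J := A)
          have := RightModule.subsingleton_of_isEmpty hP' (J := A)
          exact DGModule.Hom.quasiIso_of_subsingleton _
        · refine h.quasiIso_of_relAcyclic h' hP hP' φ hL hL' (hφ' Unit) A ?_
          have hpos : 0 < Nat.card A := Nat.card_pos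
          -- The steps start at 2, above the copy of the cone of ψ(A), so that every partition
          -- involved has at least two classes.
          have h1 := RelAcyclic.of_steps (φ.coneδ_coneδ A) _ (h.coneFiltration_mono h' A)
            (show 2 ≤ Nat.card A + 1 by omega) fun s hs _ => hstep A s (hφ' _) fun f hf k => by
              refine ih _ ?_ (Block f k) rfl
              -- A second nonempty block makes the block over k a proper subset of A, to which the
              -- induction hypothesis applies.
              obtain ⟨l, hl⟩ : ∃ l : Fin s, l ≠ k := by
                have : Nontrivial (Fin s) := Fin.nontrivial_iff_two_le.2 hs
                exact exists_ne k
              obtain ⟨a, ha⟩ := hf l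
              refine Finite.card_subtype_lt (x := a) ?_
              rw [ha]; exact hl
          rw [h.coneFiltration_eq_top h' hP hP' A] at h1
          exact RelAcyclic.left (φ.coneδ_coneδ A) bot_le le_top h1 ((φ.quasiIso_iff A).1 (hφ A))
    exact fun A _ => key _ A rfl
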